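/- A measure space $(\Omega,\Sigma,\mu)$ is called admissible if: $\mu$ is complete; a set $A\subset\Omega$ is measurable as soon as $A\cap B$ is measurable for all $B\in\Sigma$ with $\mu(B)<\infty$; $\mu$ is semifinite (every measurable set of infinite measure contains a measurable set of finite positive measure); and there is a pairwise disjoint family $(A_i)_{i\in I}$ of sets of finite measure such that every $B\in\Sigma$ of finite measure is, up to a null set, contained in the union of countably many $A_i$. Let $L_0(\mu)$ be the space of classes of measurable real functions. For $x\in L_0(\mu)$ put $n_{|x|}(s)=\mu(\{|x|>s\})$ for $s\ge 0$ and $x^*(t)=\inf\{s\ge 0: n_{|x|}(s)<t\}$. A symmetric space over $\mu$ is a linear subspace $E\subset L_0(\mu)$ with a complete norm such that (i) $y\in E$, $x\in L_0(\mu)$, $|x|\le|y|$ imply $x\in E$ and $\|x\|_E\le\|y\|_E$; (ii) only $z=0$ in $L_0(\mu)$ satisfies $zy=0$ for all $y\in E$; (iii) $x\in E$, $y\in L_0(\mu)$, $n_{|x|}=n_{|y|}$ imply $y\in E$ and $\|y\|_E=\|x\|_E$. Let $\mathcal S(\mu)$ be the set of all symmetric spaces over $\mu$, ordered by $E\subset^1F$: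 $E\subset F$ and $\|x\|_F\le\|x\|_E$ for all $x\in E$. $E$ satisfies the norming condition if $\|\chi_e\|_E=1$ whenever $\mu(e)=1$. Further: $E\cap F$ carries the norm $\max(\|x\|_E,\|x\|_F)$; $E+F$ carries the norm $\inf\{\|u\|_E+\|v\|_F:u+v=x\}$; $E_0\subset E$ is the subspace (with the norm of $E$) of those $x\in E$ for which $\|x_i\|_E\to0$ for every net $x_i$ with $|x|\ge x_i\downarrow0$; $E'$ is the space of all $f\in L_0(\mu)$ with $\|f\|_{E'}=\sup\{\int|fx|\,d\mu:\|x\|_E=1\}<\infty$. Let $\mu$ and $\nu$ be admissible measures of the same one of the following three types: (1) non-atomic probability measures; ($\infty$) non-atomic measures of infinite total mass; (D) measures on infinite sets (of any, possibly different, cardinalities) all of whose points have mass $1$. Then: (a) $\mathcal S(\mu)$ and $\mathcal S(\nu)$ are lattices under $\subset^1$, with $E\wedge F=E\cap F$ and $E\vee F=E+F$, and the spaces with the norming condition form sublattices of them. For $E$ in one of these sets, $E'$ belongs to the same set, and so does $E_0$ if $E_0\ne\{0\}$; both satisfy the norming condition if $E$ does. (b) For $E\in\mathcal S(\mu)$ let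 $\operatorname{Mekl}_{\mu,\nu}(E)$ be the set of all $y\in L_0(\nu)$ for which there is $x\in E$ with $x^*=y^*$, with $\|y\|=\|x\|_E$. This norm is well defined, $\operatorname{Mekl}_{\mu,\nu}$ is a lattice isomorphism of $\mathcal S(\mu)$ onto $\mathcal S(\nu)$ with inverse $\operatorname{Mekl}_{\nu,\mu}$, and $E$ satisfies the norming condition if and only if $\operatorname{Mekl}_{\mu,\nu}(E)$ does. (c) For all $E,F\in\mathcal S(\mu)$, with equal norms throughout (and with $\operatorname{Mekl}_{\mu,\nu}(\{0\})=\{0\}$), $\operatorname{Mekl}_{\mu,\nu}(E\cap F)=\operatorname{Mekl}_{\mu,\nu}(E)\cap\operatorname{Mekl}_{\mu,\nu}(F)$, $\operatorname{Mekl}_{\mu,\nu}(E+F)=\operatorname{Mekl}_{\mu,\nu}(E)+\operatorname{Mekl}_{\mu,\nu}(F)$, $\operatorname{Mekl}_{\mu,\nu}(E_0)=(\operatorname{Mekl}_{\mu,\nu}(E))_0$ and $\operatorname{Mekl}_{\mu,\nu}(E')=(\operatorname{Mekl}_{\mu,\nu}(E))'$. -/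

import Mathlib

open MeasureTheory Filter Topology
open scoped ENNReal NNReal

namespace SymSpaces

universe u v

/-- An admissible measure space: complete, locally determined, semifinite and with the direct sum
property. (The set `B` in the semifiniteness clause has to have positive measure.) -/
structure Admissible {Ω : Type u} [MeasurableSpace Ω] (μ : Measure Ω) : Prop where
  complete : μ.IsComplete
  locallyMeasurable : ∀ A : Set Ω,
    (∀ B : Set Ω, MeasurableSet B → μ B < ∞ → MeasurableSet (A ∩ B)) → MeasurableSet A
  semifinite : ∀ A : Set Ω, MeasurableSet A → μ A = ∞ →
    ∃ B : Set Ω, B ⊆ A ∧ MeasurableSet B ∧ 0 < μ B ∧ μ B < ∞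
  directSum : ∃ 𝒜 : Set (Set Ω), 𝒜.PairwiseDisjoint id ∧
    (∀ A ∈ 𝒜, MeasurableSet A ∧ μ A < ∞) ∧
    ∀ B : Set Ω, MeasurableSet B → μ B < ∞ →
      ∃ 𝒞 : Set (Set Ω), 𝒞 ⊆ 𝒜 ∧ 𝒞.Countable ∧ μ (B \ ⋃₀ 𝒞) = 0

/-- The measure has no atoms: every measurable set of positive measure has a measurable subset of
strictly smaller positive measure. -/
def Nonatomic {Ω : Type u} [MeasurableSpace Ω] (μ : Measure Ω) : Prop :=
  ∀ A : Set Ω, MeasurableSet A → 0 < μ A →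
    ∃ B : Set Ω, B ⊆ A ∧ MeasurableSet B ∧ 0 < μ B ∧ μ B < μ A

/-- The three types `1`, `∞`, `D` of measure spaces. -/
inductive SpaceType where
  | probability : SpaceType
  | infinite : SpaceType
  | discrete : SpaceType

/-- `τ.Holds μ`: the measure space is of type `τ`, that is, non-atomic probability, non-atomic of
infinite total mass, or an infinite set all of whose points have mass `1`. -/
def SpaceType.Holds (τ : SpaceType) {Ω : Type u} [MeasurableSpace Ω] (μ : Measure Ω) : Prop :=
  match τ with
  | .probability => Nonatomic μ ∧ μ Set.univ = 1
  | .infinite => Nonatomic μ ∧ μ Set.univ = ∞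
  | .discrete => Infinite Ω ∧ ∀ ω : Ω, MeasurableSet ({ω} : Set Ω) ∧ μ {ω} = 1

section Basic

variable {Ω : Type u} [MeasurableSpace Ω] {μ : Measure Ω}

/-- The distribution function `s ↦ μ {|x| > s}` of `|x|`. -/
noncomputable def distrib (x : Ω →ₘ[μ] ℝ) (s : ℝ≥0) : ℝ≥0∞ :=
  μ {ω | (s : ℝ) < |x ω|}

/-- The non-increasing rearrangement `x*(t) = inf {s ≥ 0 : μ {|x| > s} < t}`. -/
noncomputable def rearr (x : Ω →ₘ[μ] ℝ) (t : ℝ≥0) : ℝ≥0∞ :=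
  ⨅ (s : ℝ≥0) (_ : distrib x s < t), (s : ℝ≥0∞)

/-- A Banach ideal space `E` of classes of measurable functions is given by its norm, extended by
the value `∞` to all measurable functions; so `E = {x | N x < ∞}`. This predicate says that `E` is
a vector space, `N` is a norm on it, `E` is an ideal with monotone norm, and `E` is complete. -/
structure IsBanachIdealNorm (N : (Ω →ₘ[μ] ℝ) → ℝ≥0∞) : Prop where
  eq_zero_iff : ∀ x, N x = 0 ↔ x = 0
  smul : ∀ (c : ℝ) (x), N (c • x) = ‖c‖ₑ * N x
  add_le : ∀ x y, N (x + y) ≤ N x + N y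
  mono : ∀ x y, |x| ≤ |y| → N x ≤ N y
  complete : ∀ x : ℕ → (Ω →ₘ[μ] ℝ), (∀ n, N (x n) < ∞) →
    (∀ ε : ℝ≥0∞, 0 < ε → ∃ K : ℕ, ∀ m, K ≤ m → ∀ n, K ≤ n → N (x m - x n) < ε) →
    ∃ y, N y < ∞ ∧ Tendsto (fun n => N (x n - y)) atTop (𝓝 0)

/-- Maximal width: only `0` is disjoint from all elements of the space. -/
def IsMaximalWidth (N : (Ω →ₘ[μ] ℝ) → ℝ≥0∞) : Prop :=
  ∀ z : Ω →ₘ[μ] ℝ, (∀ y, N y < ∞ → z * y = 0) → z = 0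

/-- Symmetry: if `x` lies in the space and `|y|` is equimeasurable with `|x|`, then `y` lies in
the space and has the same norm. -/
def IsSymmetricNorm (N : (Ω →ₘ[μ] ℝ) → ℝ≥0∞) : Prop :=
  ∀ x y, N x < ∞ → (∀ s, distrib y s = distrib x s) → N y = N x

/-- The norming condition: indicators of sets of measure one have norm one. -/
def IsNormed (N : (Ω →ₘ[μ] ℝ) → ℝ≥0∞) : Prop :=
  ∀ e : Set Ω, MeasurableSet e → μ e = 1 →
    ∀ x : Ω →ₘ[μ] ℝ, x =ᵐ[μ] e.indicator 1 → N x = 1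

/-- The norm of `E ∩ F`. -/
noncomputable def interNorm (N M : (Ω →ₘ[μ] ℝ) → ℝ≥0∞) (x : Ω →ₘ[μ] ℝ) : ℝ≥0∞ :=
  max (N x) (M x)

/-- The norm of `E + F`. -/
noncomputable def sumNorm (N M : (Ω →ₘ[μ] ℝ) → ℝ≥0∞) (x : Ω →ₘ[μ] ℝ) : ℝ≥0∞ :=
  ⨅ (u : Ω →ₘ[μ] ℝ) (v : Ω →ₘ[μ] ℝ) (_ : u + v = x), N u + M v

/-- The norm of `x` is order continuous: if `0 ≤ xᵢ ≤ |x|` and `xᵢ ↓ 0`, then `‖xᵢ‖ → 0`. A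
decreasing net enters only through the set `D` of its members, as the norm is monotone. -/
def IsOrderContinuousAt (N : (Ω →ₘ[μ] ℝ) → ℝ≥0∞) (x : Ω →ₘ[μ] ℝ) : Prop :=
  ∀ D : Set (Ω →ₘ[μ] ℝ), D.Nonempty → DirectedOn (fun a b => b ≤ a) D → IsGLB D 0 →
    (∀ d ∈ D, d ≤ |x|) → ∀ ε : ℝ≥0∞, 0 < ε → ∃ d ∈ D, N d < ε

open Classical in
/-- The norm of `E₀`, the space of the elements of `E` with order continuous norm. -/
noncomputable def ocNorm (N : (Ω →ₘ[μ] ℝ) → ℝ≥0∞) (x : Ω →ₘ[μ] ℝ) : ℝ≥0∞ :=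
  if IsOrderContinuousAt N x then N x else ∞

/-- The norm of the dual space `E'`: the supremum of `∫ |f x| dμ` over `‖x‖ = 1`. -/
noncomputable def dualNorm (N : (Ω →ₘ[μ] ℝ) → ℝ≥0∞) (f : Ω →ₘ[μ] ℝ) : ℝ≥0∞ :=
  ⨆ (x : Ω →ₘ[μ] ℝ) (_ : N x = 1), ∫⁻ ω, ‖f ω * x ω‖ₑ ∂μ

end Basic

/-- The set of symmetric Banach spaces (of maximal width) over `μ`. -/
@[ext]
structure SymmetricSpace {Ω : Type u} [MeasurableSpace Ω] (μ : Measure Ω) where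
  nrm : (Ω →ₘ[μ] ℝ) → ℝ≥0∞
  isBanachIdeal : IsBanachIdealNorm nrm
  maximalWidth : IsMaximalWidth nrm
  isSymmetric : IsSymmetricNorm nrm

/-- The order `E ⊂¹ F`: `E ⊆ F` and `‖x‖_F ≤ ‖x‖_E` for `x ∈ E`. -/
instance {Ω : Type u} [MeasurableSpace Ω] (μ : Measure Ω) : PartialOrder (SymmetricSpace μ) where
  le E F := ∀ x, F.nrm x ≤ E.nrm x
  le_refl _ _ := le_rfl
  le_trans _ _ _ h₁ h₂ x := (h₂ x).trans (h₁ x)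
  le_antisymm _ _ h₁ h₂ := SymmetricSpace.ext (funext fun x => le_antisymm (h₂ x) (h₁ x))

/-- The symmetric spaces over `μ` form a lattice under `⊂¹` with `E ∧ F = E ∩ F` and
`E ∨ F = E + F`, in which the spaces with the norming condition form a sublattice; this set is
closed under `E ↦ E'` and, as long as `E₀` is not trivial, under `E ↦ E₀`. -/
structure IsSymmetricLattice {Ω : Type u} [MeasurableSpace Ω] (μ : Measure Ω) : Prop where
  inter : ∀ E F : SymmetricSpace μ, ∃ G : SymmetricSpace μ,
    G.nrm = interNorm E.nrm F.nrm ∧ IsGLB {E, F} G ∧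
      (IsNormed E.nrm → IsNormed F.nrm → IsNormed G.nrm)
  sum : ∀ E F : SymmetricSpace μ, ∃ G : SymmetricSpace μ,
    G.nrm = sumNorm E.nrm F.nrm ∧ IsLUB {E, F} G ∧
      (IsNormed E.nrm → IsNormed F.nrm → IsNormed G.nrm)
  dual : ∀ E : SymmetricSpace μ, ∃ G : SymmetricSpace μ,
    G.nrm = dualNorm E.nrm ∧ (IsNormed E.nrm → IsNormed G.nrm)
  oc : ∀ E : SymmetricSpace μ, (∃ x, x ≠ 0 ∧ ocNorm E.nrm x < ∞) →
    ∃ G : SymmetricSpace μ, G.nrm = ocNorm E.nrm ∧ (IsNormed E.nrm → IsNormed G.nrm)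

/-- Replanting from `μ` to `ν`: the new space consists of the `y` over `ν` with `y* = x*` for some
`x` in the old space, and then `‖y‖ = ‖x‖`. For a symmetric space all such `x` have one and the
same norm, so that the infimum is the common value (and `∞` if there is no such `x`). -/
noncomputable def mekler {Ω : Type u} {Ω' : Type v} [MeasurableSpace Ω] [MeasurableSpace Ω']
    {μ : Measure Ω} (ν : Measure Ω') (N : (Ω →ₘ[μ] ℝ) → ℝ≥0∞) (y : Ω' →ₘ[ν] ℝ) : ℝ≥0∞ :=
  ⨅ (x : Ω →ₘ[μ] ℝ) (_ : rearr x = rearr y), N x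

end SymSpaces

namespace SymSpaces

universe u v

set_option linter.unusedSectionVars false

/-! Call norms `N` over `μ` and `M` over `ν` `Related` if equimeasurable elements have equal norms.
The functions `rearr` and `distrib` determine each other (`rearr_eq_iff`), so a norm is symmetric
exactly if it is related to itself, and for a symmetric `N` the norm `mekler ν N` is the only norm
over `ν` related to `N` (`Related.mekler_eq`). Everything thus reduces to two facts: relatedness
carries the axioms of a symmetric space from `μ` to `ν`, and it is preserved by `E ∩ F`, `E + F`,
`E₀` and `E'`. For `ν = μ` the second fact says that these constructions are again symmetric, as the
lattice statements require.

The two measure spaces can have quite different sizes, so points cannot be moved. But each norm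
axiom concerns only countably many functions, that is, one measurable map into a standard Borel
space. Such a map is coded by a sequence of sets, and the finite partitions generated by these can
be copied one by one, because every finite value of one measure is attained by the other inside each
large enough set. This is `Compatible.transfer`. On pieces of finite measure the full law is kept;
in general the measures of countably many events are kept, which is enough. Completeness is used in
the Riesz–Fischer form, which asks for one majorant of one sequence.

For sums and duals a function is prescribed on both sides, so that copying a map is not enough.
`Compatible.exists_cells` makes two equimeasurable functions comparable up to a factor `c > 1` on
cells of equal measures; a decomposition or a test function is copied cell by cell, and `c` tends to
`1` (`sumNorm_le_of_equimeasurable`, `dualNorm_le_of_equimeasurable`). For `E₀` arbitrary nets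
enter; for `x ≠ 0` order continuity is equivalent to conditions on the distribution of `x` alone
(`HasSmallParts`), which do transfer.

Finally, averaging over equimeasurable rearrangements gives `(∫_e |x|) ‖χ_e‖ ≤ μ e ‖x‖`
(`IsIdealNorm.setLIntegral_mul_le`). It puts indicators of sets of finite measure into `E'` and
yields the norming condition for `E'` and `E + F`. -/

theorem exists_seq_dep {α : Type*} {P : ℕ → α → Prop} {Q : ℕ → α → α → Prop} (h0 : ∃ a, P 0 a)
    (hs : ∀ n a, P n a → ∃ b, P (n + 1) b ∧ Q n a b) :
    ∃ f : ℕ → α, ∀ n, P n (f n) ∧ Q n (f n) (f (n + 1)) := by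
  obtain ⟨a, ha⟩ := h0
  choose g hg using hs
  let F : (n : ℕ) → {a // P n a} :=
    fun n => Nat.rec ⟨a, ha⟩ (fun n x => ⟨g n x.1 x.2, (hg n x.1 x.2).1⟩) n
  exact ⟨fun n => (F n).1, fun n => ⟨(F n).2, (hg n (F n).1 (F n).2).2⟩⟩

/-! ### Subsets of prescribed measure -/

section Sets

variable {Ω : Type u} [MeasurableSpace Ω] {μ : Measure Ω}
variable {Ω' : Type v} [MeasurableSpace Ω'] {ν : Measure Ω'}

/-- Every measurable set of infinite measure has a measurable subset of measure one. -/
def HasUnits (μ : Measure Ω) : Prop :=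
  ∀ B, MeasurableSet B → μ B = ∞ → ∃ C ⊆ B, MeasurableSet C ∧ μ C = 1

/-- Every finite value of `μ` is attained by `ν` inside each large enough set. -/
def Cuts (μ : Measure Ω) (ν : Measure Ω') : Prop :=
  ∀ A, MeasurableSet A → μ A < ∞ → ∀ B, MeasurableSet B → μ A ≤ ν B →
    ∃ C ⊆ B, MeasurableSet C ∧ ν C = μ A

/-- Of `D` and `C \ D` one has at most half the measure of `C`. The halving starts at `B0` because
its measure is finite. -/
theorem Nonatomic.exists_small (h : Nonatomic μ) {A : Set Ω} (hA : MeasurableSet A)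
    (hA0 : 0 < μ A) {ε : ℝ≥0∞} (hε : 0 < ε) :
    ∃ B ⊆ A, MeasurableSet B ∧ 0 < μ B ∧ μ B ≤ ε := by
  obtain ⟨B0, hB0A, hB0, hpos, hlt⟩ := h A hA hA0
  have key : ∀ n : ℕ, ∃ B ⊆ A, MeasurableSet B ∧ 0 < μ B ∧ μ B ≤ μ B0 * 2⁻¹ ^ n := by
    intro n
    induction n with
    | zero => exact ⟨B0, hB0A, hB0, hpos, by simp⟩
    | succ n ih =>
      obtain ⟨C, hCA, hC, hCpos, hCle⟩ := ih
      obtain ⟨D, hDC, hD, hDpos, hDlt⟩ := h C hC hCpos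
      have hsum : μ D + μ (C \ D) = μ C := by
        rw [measure_sdiff hDC hD.nullMeasurableSet hDlt.ne_top, add_tsub_cancel_of_le hDlt.le]
      have hdpos : 0 < μ (C \ D) := by
        rw [measure_sdiff hDC hD.nullMeasurableSet hDlt.ne_top]
        exact tsub_pos_of_lt hDlt
      have half : ∀ x : ℝ≥0∞, 2 * x ≤ μ C → x ≤ μ B0 * 2⁻¹ ^ (n + 1) := by
        intro x hx
        calc x = (2 * x) * 2⁻¹ := by
              rw [mul_comm, ← mul_assoc, ENNReal.inv_mul_cancel (by norm_num) (by norm_num),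
                one_mul]
          _ ≤ μ B0 * 2⁻¹ ^ n * 2⁻¹ := mul_le_mul' (hx.trans hCle) le_rfl
          _ = μ B0 * 2⁻¹ ^ (n + 1) := by rw [pow_succ, mul_assoc]
      rcases le_total (μ D) (μ (C \ D)) with hle | hle
      · refine ⟨D, hDC.trans hCA, hD, hDpos, half _ ?_⟩
        rw [two_mul, ← hsum]; gcongr
      · refine ⟨C \ D, Set.sdiff_subset.trans hCA, hC.diff hD, hdpos, half _ ?_⟩
        rw [two_mul, ← hsum]; gcongr
  have hlim : Tendsto (fun n : ℕ => μ B0 * (2⁻¹ : ℝ≥0∞) ^ n) atTop (𝓝 (μ B0 * 0)) :=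
    ENNReal.Tendsto.const_mul (ENNReal.tendsto_pow_atTop_nhds_zero_of_lt_one (by norm_num))
      (Or.inr hlt.ne_top)
  rw [mul_zero] at hlim
  obtain ⟨n, hn⟩ := (hlim.eventually (gt_mem_nhds hε)).exists
  obtain ⟨B, h1, h2, h3, h4⟩ := key n
  exact ⟨B, h1, h2, h3, h4.trans hn.le⟩

/-- Sierpiński's theorem by exhaustion. Each `C (n + 1)` covers at least half of the distance from
`μ (C n)` to the supremum over admissible enlargements. If the union fell short of `a`, a small set
`D` could be added to it, and the union with `D` would be admissible at every stage; in the limit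
this forces `μ D = 0`. -/
theorem Nonatomic.exists_subset_eq (h : Nonatomic μ) {a : ℝ≥0∞} (ha : a < ∞) {B : Set Ω}
    (hB : MeasurableSet B) (haB : a ≤ μ B) : ∃ C ⊆ B, MeasurableSet C ∧ μ C = a := by
  have hstep : ∀ (n : ℕ) (C : Set Ω), (MeasurableSet C ∧ C ⊆ B ∧ μ C ≤ a) →
      ∃ C', (MeasurableSet C' ∧ C' ⊆ B ∧ μ C' ≤ a) ∧ (C ⊆ C' ∧
        ∀ D, MeasurableSet D → C ⊆ D → D ⊆ B → μ D ≤ a → μ D + μ C ≤ 2 * μ C') := by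
    rintro - C ⟨hC, hCB, hCa⟩
    set S : ℝ≥0∞ := ⨆ (D : {D : Set Ω // MeasurableSet D ∧ C ⊆ D ∧ D ⊆ B ∧ μ D ≤ a}), μ D.1
    have hCS : μ C ≤ S := le_iSup
      (fun D : {D : Set Ω // MeasurableSet D ∧ C ⊆ D ∧ D ⊆ B ∧ μ D ≤ a} => μ D.1)
      ⟨C, hC, subset_rfl, hCB, hCa⟩
    have hle : ∀ D, MeasurableSet D → C ⊆ D → D ⊆ B → μ D ≤ a → μ D ≤ S := fun D h1 h2 h3 h4 =>
      le_iSup (fun D : {D : Set Ω // MeasurableSet D ∧ C ⊆ D ∧ D ⊆ B ∧ μ D ≤ a} => μ D.1)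
        ⟨D, h1, h2, h3, h4⟩
    have hSa : S ≤ a := iSup_le fun D => D.2.2.2.2
    rcases hCS.eq_or_lt with heq | hlt
    · refine ⟨C, ⟨hC, hCB, hCa⟩, subset_rfl, fun D h1 h2 h3 h4 => ?_⟩
      rw [two_mul]; exact add_le_add_left ((hle D h1 h2 h3 h4).trans heq.ge) _
    · have hS : S ≠ ∞ := (hSa.trans_lt ha).ne
      have hmid : (S + μ C) / 2 < S := by
        rw [ENNReal.div_lt_iff (Or.inl (by norm_num)) (Or.inl (by norm_num)), mul_two]
        exact ENNReal.add_lt_add_left hS hlt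
      obtain ⟨⟨D, hD1, hD2, hD3, hD4⟩, hD⟩ := lt_iSup_iff.1 hmid
      refine ⟨D, ⟨hD1, hD3, hD4⟩, hD2, fun D' h1 h2 h3 h4 => ?_⟩
      calc μ D' + μ C ≤ S + μ C := by gcongr; exact hle D' h1 h2 h3 h4
        _ = 2 * ((S + μ C) / 2) := by
          rw [ENNReal.mul_div_cancel (by norm_num) (by norm_num)]
        _ ≤ 2 * μ D := by gcongr
  obtain ⟨C, hC⟩ := exists_seq_dep (P := fun _ C => MeasurableSet C ∧ C ⊆ B ∧ μ C ≤ a)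
    ⟨∅, MeasurableSet.empty, Set.empty_subset _, by simp⟩ hstep
  have hmono : Monotone C := monotone_nat_of_le_succ fun n => (hC n).2.1
  have hU : MeasurableSet (⋃ n, C n) := MeasurableSet.iUnion fun n => (hC n).1.1
  have hUB : (⋃ n, C n) ⊆ B := Set.iUnion_subset fun n => (hC n).1.2.1
  have hlim := tendsto_measure_iUnion_atTop (μ := μ) hmono
  have hUa : μ (⋃ n, C n) ≤ a := le_of_tendsto' hlim fun n => (hC n).1.2.2
  refine ⟨_, hUB, hU, hUa.eq_or_lt.resolve_right fun hlt => ?_⟩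
  have hUt : μ (⋃ n, C n) ≠ ∞ := (hUa.trans_lt ha).ne
  have hpos : 0 < μ (B \ ⋃ n, C n) := by
    rw [measure_sdiff hUB hU.nullMeasurableSet hUt]
    exact tsub_pos_of_lt (hlt.trans_le haB)
  obtain ⟨D, hDB, hD, hD0, hDle⟩ := h.exists_small (hB.diff hU) hpos (tsub_pos_of_lt hlt)
  have hdisj : Disjoint (⋃ n, C n) D :=
    (Set.disjoint_sdiff_left.mono_left hDB).symm
  have hUD : μ ((⋃ n, C n) ∪ D) = μ (⋃ n, C n) + μ D := measure_union hdisj hD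
  have h1 : ∀ n, μ ((⋃ n, C n) ∪ D) + μ (C n) ≤ 2 * μ (⋃ n, C n) := fun n =>
    ((hC n).2.2 _ (hU.union hD) ((Set.subset_iUnion C n).trans Set.subset_union_left)
      (Set.union_subset hUB (hDB.trans Set.sdiff_subset))
      (by rw [hUD]; exact (add_le_add_right hDle _).trans (add_tsub_cancel_of_le hUa).le)).trans
      (by gcongr; exact Set.subset_iUnion C _)
  have h2 : μ ((⋃ n, C n) ∪ D) + μ (⋃ n, C n) ≤ 2 * μ (⋃ n, C n) :=
    le_of_tendsto' (hlim.const_add _) h1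
  rw [hUD, two_mul] at h2
  have h3 := (ENNReal.add_le_add_iff_right hUt).1 h2
  have h4 : μ (⋃ n, C n) + μ D ≤ μ (⋃ n, C n) + 0 := by simpa using h3
  exact hD0.ne' (le_zero_iff.1 ((ENNReal.add_le_add_iff_left hUt).1 h4))

theorem measure_finset_of_discrete (h : ∀ ω : Ω, MeasurableSet ({ω} : Set Ω) ∧ μ {ω} = 1)
    (s : Finset Ω) : μ (s : Set Ω) = s.card := by
  have : MeasurableSingletonClass Ω := ⟨fun ω => (h ω).1⟩
  rw [← sum_measure_singleton]
  simp [h]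

theorem finite_of_discrete (h : ∀ ω : Ω, MeasurableSet ({ω} : Set Ω) ∧ μ {ω} = 1) {A : Set Ω}
    (hA : μ A < ∞) : A.Finite := by
  by_contra hinf
  obtain ⟨n, hn⟩ := ENNReal.exists_nat_gt hA.ne
  obtain ⟨s, hs, hc⟩ := Set.Infinite.exists_subset_card_eq hinf n
  have := measure_finset_of_discrete h s
  rw [hc] at this
  exact (hn.trans_le (this.symm.le.trans (measure_mono hs))).false

theorem cuts_of_discrete (h : ∀ ω : Ω, MeasurableSet ({ω} : Set Ω) ∧ μ {ω} = 1)
    (h' : ∀ ω : Ω', MeasurableSet ({ω} : Set Ω') ∧ ν {ω} = 1) : Cuts μ ν := by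
  intro A _ hAf B _ hAB
  have : MeasurableSingletonClass Ω' := ⟨fun ω => (h' ω).1⟩
  obtain ⟨s, rfl⟩ := (finite_of_discrete h hAf).exists_finset_coe
  rw [measure_finset_of_discrete h] at hAB ⊢
  obtain ⟨t, htB, ht⟩ : ∃ t : Finset Ω', (t : Set Ω') ⊆ B ∧ t.card = s.card := by
    by_cases hB : B.Finite
    · obtain ⟨b, rfl⟩ := hB.exists_finset_coe
      rw [measure_finset_of_discrete h'] at hAB
      obtain ⟨t, ht, hc⟩ := Finset.exists_subset_card_eq (Nat.cast_le.1 hAB)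
      exact ⟨t, Finset.coe_subset.2 ht, hc⟩
    · exact Set.Infinite.exists_subset_card_eq hB _
  exact ⟨t, htB, t.measurableSet, by rw [measure_finset_of_discrete h', ht]⟩

theorem hasUnits_of_discrete (h : ∀ ω : Ω, MeasurableSet ({ω} : Set Ω) ∧ μ {ω} = 1) :
    HasUnits μ := by
  intro B _ hB
  obtain ⟨ω, hω⟩ : B.Nonempty := by
    by_contra hne
    rw [Set.not_nonempty_iff_eq_empty] at hne
    simp [hne] at hB
  exact ⟨{ω}, by simpa using hω, (h ω).1, (h ω).2⟩

theorem Nonatomic.cuts (h : Nonatomic ν) : Cuts μ ν :=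
  fun _ _ hAf _ hB hAB => h.exists_subset_eq hAf hB hAB

theorem Nonatomic.hasUnits (h : Nonatomic μ) : HasUnits μ :=
  fun _ hB hBi => h.exists_subset_eq ENNReal.one_lt_top hB (by simp [hBi])

/-- The comparison properties of two measures of the same type. -/
structure Compatible (μ : Measure Ω) (ν : Measure Ω') : Prop where
  cuts : Cuts μ ν
  units : HasUnits μ
  units' : HasUnits ν
  univ : μ Set.univ = ν Set.univ

theorem SpaceType.Holds.compatible {τ : SpaceType} (h : τ.Holds μ) (h' : τ.Holds ν) :
    Compatible μ ν := by
  cases τ with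
  | probability => exact ⟨h'.1.cuts, h.1.hasUnits, h'.1.hasUnits, h.2.trans h'.2.symm⟩
  | infinite => exact ⟨h'.1.cuts, h.1.hasUnits, h'.1.hasUnits, h.2.trans h'.2.symm⟩
  | discrete =>
    refine ⟨cuts_of_discrete h.2 h'.2, hasUnits_of_discrete h.2, hasUnits_of_discrete h'.2, ?_⟩
    have := h.1
    have := h'.1
    rw [not_lt_top_iff.1 fun hlt => Set.infinite_univ (finite_of_discrete h.2 hlt),
      not_lt_top_iff.1 fun hlt => Set.infinite_univ (finite_of_discrete h'.2 hlt)]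

/-- The sets are chosen one after another along an enumeration of `ι × ℕ`. Finitely many of them
have finite total measure, so removing them leaves infinite measure in `G n`, where `HasUnits`
applies again. -/
theorem HasUnits.exists_disjoint (h : HasUnits μ) {ι : Type*} [Countable ι] [Nonempty ι]
    (G : ι → Set Ω) (hG : ∀ n, MeasurableSet (G n)) (hGi : ∀ n, μ (G n) = ∞) :
    ∃ U : ι → ℕ → Set Ω, (∀ n m, U n m ⊆ G n) ∧ (∀ n m, MeasurableSet (U n m)) ∧
      (∀ n m, μ (U n m) = 1) ∧ ∀ n m n' m', (n, m) ≠ (n', m') → Disjoint (U n m) (U n' m') := by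
  obtain ⟨e, he⟩ := exists_surjective_nat (ι × ℕ)
  obtain ⟨V, hV⟩ := exists_seq_dep
    -- The first component is the new set, the second the union of all earlier ones.
    (P := fun n (p : Set Ω × Set Ω) => MeasurableSet p.1 ∧ MeasurableSet p.2 ∧ μ p.2 < ∞ ∧
      p.1 ⊆ G (e n).1 ∧ μ p.1 = 1 ∧ Disjoint p.1 p.2)
    (Q := fun n p q => q.2 = p.1 ∪ p.2)
    (by
      obtain ⟨C, h1, h2, h3⟩ := h _ (hG (e 0).1) (hGi _)
      exact ⟨(C, ∅), h2, MeasurableSet.empty, by simp, h1, h3, by simp⟩)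
    (by
      rintro n ⟨C, R⟩ ⟨h1, h2, h3, h4, h5, h6⟩
      have hlt : μ (C ∪ R) < ∞ := by
        refine (measure_union_le _ _).trans_lt (ENNReal.add_lt_top.2 ⟨?_, h3⟩)
        simp only at h5; rw [h5]; exact ENNReal.one_lt_top
      obtain ⟨D, hD1, hD2, hD3⟩ := h (G (e (n + 1)).1 \ (C ∪ R)) ((hG _).diff (h1.union h2))
        (by rw [measure_sdiff_eq_top (hGi _) hlt.ne])
      exact ⟨(D, C ∪ R), ⟨hD2, h1.union h2, hlt, hD1.trans Set.sdiff_subset, hD3,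
        Set.disjoint_sdiff_left.mono_left hD1⟩, rfl⟩)
  have hsub : ∀ n m, n < m → (V n).1 ⊆ (V m).2 := by
    intro n m hnm
    induction m with
    | zero => omega
    | succ m ih =>
      rw [(hV m).2]
      rcases Nat.lt_succ_iff_lt_or_eq.1 hnm with h | rfl
      · exact (ih h).trans Set.subset_union_right
      · exact Set.subset_union_left
  have hdisj : ∀ n m, n ≠ m → Disjoint (V n).1 (V m).1 := by
    intro n m hnm
    rcases hnm.lt_or_gt with h | h
    · exact ((hV m).1.2.2.2.2.2.mono_right (hsub _ _ h)).symm
    · exact (hV n).1.2.2.2.2.2.mono_right (hsub _ _ h)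
  choose r hr using he
  refine ⟨fun n m => (V (r (n, m))).1, fun n m => ?_, fun n m => (hV _).1.1,
    fun n m => (hV _).1.2.2.2.2.1, fun n m n' m' hne => hdisj _ _ fun heq => hne ?_⟩
  · have := (hV (r (n, m))).1.2.2.2.1
    rwa [hr] at this
  · rw [← hr (n, m), heq, hr]

theorem HasUnits.exists_disjoint_top (h : HasUnits μ) {ι : Type*} [Countable ι] [Nonempty ι]
    (G : ι → Set Ω) (hG : ∀ n, MeasurableSet (G n)) (hGi : ∀ n, μ (G n) = ∞) :
    ∃ C : ι → Set Ω, (∀ n, C n ⊆ G n) ∧ (∀ n, MeasurableSet (C n)) ∧ (∀ n, μ (C n) = ∞) ∧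
      Pairwise (Function.onFun Disjoint C) := by
  obtain ⟨U, h1, h2, h3, h4⟩ := h.exists_disjoint G hG hGi
  refine ⟨fun n => ⋃ m, U n m, fun n => Set.iUnion_subset (h1 n),
    fun n => MeasurableSet.iUnion (h2 n), fun n => ?_, fun n n' hne => ?_⟩
  · rw [measure_iUnion (fun m m' hne => h4 _ _ _ _ (by simpa using hne)) (h2 n)]
    simp [h3]
  · refine Set.disjoint_iUnion_left.2 fun m => Set.disjoint_iUnion_right.2 fun m' => ?_
    exact h4 _ _ _ _ (by simp [hne])

/-- Every measurable set contains a countable union of sets of finite measure of the same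
measure. -/
theorem HasUnits.exists_sigmaFinite (h : HasUnits μ) {A : Set Ω} (hA : MeasurableSet A) :
    ∃ D : ℕ → Set Ω, (∀ n, MeasurableSet (D n)) ∧ (∀ n, D n ⊆ A) ∧ (∀ n, μ (D n) < ∞) ∧
      μ (⋃ n, D n) = μ A := by
  rcases (le_top : μ A ≤ ∞).lt_or_eq with hlt | htop
  · exact ⟨fun _ => A, fun _ => hA, fun _ => subset_rfl, fun _ => hlt, by simp [Set.iUnion_const]⟩
  · obtain ⟨U, h1, h2, h3, h4⟩ := h.exists_disjoint (fun _ : Unit => A) (fun _ => hA) fun _ => htop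
    refine ⟨U (), h2 (), h1 (), fun n => by simp [h3], ?_⟩
    rw [measure_iUnion (fun m m' hne => h4 _ _ _ _ (by simpa using hne)) (h2 _), htop]
    simp [h3]

/-- `Cuts` only attains finite values. If one of the two parts of `A` is finite, a copy of it is cut
out of `B` and the rest follows by subtraction. If both are infinite, subtraction says nothing, and
two disjoint subsets of `B` of infinite measure are used. -/
theorem Compatible.split (h : Compatible μ ν) {A S : Set Ω} {B : Set Ω'} (hA : MeasurableSet A)
    (hS : MeasurableSet S) (hB : MeasurableSet B) (hAB : ν B = μ A) :
    ∃ T ⊆ B, MeasurableSet T ∧ ν T = μ (A ∩ S) ∧ ν (B \ T) = μ (A \ S) := by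
  have hsum : μ (A ∩ S) + μ (A \ S) = μ A := measure_inter_add_sdiff A hS
  have cancel : ∀ T ⊆ B, MeasurableSet T → ∀ a b : ℝ≥0∞, a < ∞ → a + b = μ A → ν T = a →
      ν (B \ T) = b := by
    intro T hTB hT a b ha hab hTa
    rw [measure_sdiff hTB hT.nullMeasurableSet (hTa.trans_lt ha).ne, hTa, hAB, ← hab,
      ENNReal.add_sub_cancel_left ha.ne]
  rcases (le_top : μ (A ∩ S) ≤ ∞).lt_or_eq with h1 | h1
  · obtain ⟨T, hTB, hT, hTe⟩ := h.cuts _ (hA.inter hS) h1 B hB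
      (by rw [hAB]; exact measure_mono Set.inter_subset_left)
    exact ⟨T, hTB, hT, hTe, cancel T hTB hT _ _ h1 hsum hTe⟩
  rcases (le_top : μ (A \ S) ≤ ∞).lt_or_eq with h2 | h2
  · obtain ⟨T, hTB, hT, hTe⟩ := h.cuts _ (hA.diff hS) h2 B hB
      (by rw [hAB]; exact measure_mono Set.sdiff_subset)
    refine ⟨B \ T, Set.sdiff_subset, hB.diff hT, ?_, ?_⟩
    · exact cancel T hTB hT _ _ h2 ((add_comm _ _).trans hsum) hTe
    · rw [Set.sdiff_sdiff_cancel_left hTB, hTe]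
  · have hBi : ν B = ∞ := by rw [hAB, ← hsum, h1, top_add]
    obtain ⟨C, c1, c2, c3, c4⟩ := h.units'.exists_disjoint_top (fun _ : Bool => B) (fun _ => hB)
      fun _ => hBi
    refine ⟨C true, c1 _, c2 _, (c3 _).trans h1.symm, h2 ▸ top_le_iff.1 ?_⟩
    rw [← c3 false]
    exact measure_mono (Set.subset_sdiff.2 ⟨c1 _, c4 (by simp)⟩)

/-- Countably many disjoint subsets of `A` have disjoint copies of the same measures inside each
set `B` with the measure of `A`. -/
theorem Compatible.embed (h : Compatible μ ν) {A : Set Ω} {B : Set Ω'} (hA : MeasurableSet A)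
    (hB : MeasurableSet B) (hAB : ν B = μ A) (D : ℕ → Set Ω) (hD : ∀ n, MeasurableSet (D n))
    (hDA : ∀ n, D n ⊆ A) (hdisj : Pairwise (Function.onFun Disjoint D)) :
    ∃ E : ℕ → Set Ω', (∀ n, MeasurableSet (E n)) ∧ (∀ n, E n ⊆ B) ∧ (∀ n, ν (E n) = μ (D n)) ∧
      Pairwise (Function.onFun Disjoint E) := by
  -- `R n` is what is left of `B` after the copies of the first `n` sets are removed; its measure is
  -- that of the corresponding rest of `A`, so that `split` applies again.
  obtain ⟨R, hR⟩ := exists_seq_dep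
    (P := fun n (R : Set Ω') => MeasurableSet R ∧ R ⊆ B ∧ ν R = μ (A \ ⋃ i < n, D i))
    (Q := fun n R R' => ∃ T ⊆ R, MeasurableSet T ∧ ν T = μ (D n) ∧ R' = R \ T)
    ⟨B, hB, subset_rfl, by simpa using hAB⟩
    (by
      rintro n R ⟨h1, h2, h3⟩
      obtain ⟨T, t1, t2, t3, t4⟩ := h.split (hA.diff (MeasurableSet.iUnion fun i =>
        MeasurableSet.iUnion fun _ => hD i)) (hD n) h1 h3
      refine ⟨R \ T, ⟨h1.diff t2, Set.sdiff_subset.trans h2, ?_⟩, T, t1, t2, ?_, rfl⟩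
      · rw [t4, Set.sdiff_sdiff, Set.biUnion_lt_succ]
      · rw [t3]
        congr 1
        rw [Set.inter_eq_right]
        refine Set.subset_sdiff.2 ⟨hDA n, ?_⟩
        simp only [Set.disjoint_iUnion_right]
        exact fun i hi => hdisj hi.ne')
  choose T t1 t2 t3 t4 using fun n => (hR n).2
  have hanti : Antitone R := antitone_nat_of_succ_le fun n => by
    rw [t4 n]; exact Set.sdiff_subset
  refine ⟨T, t2, fun n => (t1 n).trans (hR n).1.2.1, t3, ?_⟩
  refine (pairwise_disjoint_on T).2 fun m n hmn => ?_
  have : T n ⊆ R (m + 1) := (t1 n).trans (hanti hmn)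
  rw [t4 m] at this
  exact (Set.disjoint_sdiff_left.mono_left this).symm

end Sets

/-! ### Copying measurable maps from one measure space to another -/

section Transfer

variable {Ω : Type u} [MeasurableSpace Ω] {μ : Measure Ω}
variable {Ω' : Type v} [MeasurableSpace Ω'] {ν : Measure Ω'}

open Classical in
/-- The set of the first `n` indices `i` with `ω ∈ S i`. -/
noncomputable def code (S : ℕ → Set Ω) (n : ℕ) (ω : Ω) : Finset ℕ :=
  (Finset.range n).filter fun i => ω ∈ S i

open Classical in
/-- The sequence of the indicators of the sets `S i`. -/
noncomputable def bits (S : ℕ → Set Ω) (ω : Ω) (i : ℕ) : Bool := decide (ω ∈ S i)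

theorem code_congr {S T : ℕ → Set Ω} {n : ℕ} (h : ∀ i < n, S i = T i) : code S n = code T n := by
  ext ω i
  simp only [code, Finset.mem_filter, Finset.mem_range]
  constructor <;> rintro ⟨h1, h2⟩ <;> simpa [h1, h i h1] using h2

theorem code_succ_eq_iff (S : ℕ → Set Ω) (n : ℕ) (l : Finset ℕ) :
    {ω | code S (n + 1) ω = l} = {ω | code S n ω = l.erase n} ∩ {ω | ω ∈ S n ↔ n ∈ l} := by
  ext ω
  simp only [Set.mem_ofPred_eq, Set.mem_inter_iff, code]
  constructor
  · rintro rfl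
    constructor
    · ext i
      simp only [Finset.mem_filter, Finset.mem_range, Finset.mem_erase]
      constructor
      · rintro ⟨h1, h2⟩; exact ⟨h1.ne, by omega, h2⟩
      · rintro ⟨h1, h2, h3⟩; exact ⟨by omega, h3⟩
    · simp
  · rintro ⟨h1, h2⟩
    ext i
    have := congrArg (i ∈ ·) h1
    simp only [Finset.mem_filter, Finset.mem_range, Finset.mem_erase, eq_iff_iff] at this
    simp only [Finset.mem_filter, Finset.mem_range]
    rcases eq_or_ne i n with rfl | hne
    · simpa using h2
    · constructor
      · rintro ⟨h3, h4⟩; exact (this.1 ⟨by omega, h4⟩).2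
      · intro h3
        have := this.2 ⟨hne, h3⟩
        exact ⟨by omega, this.2⟩

theorem measurableSet_iff_mem {S : Set Ω} (hS : MeasurableSet S) (p : Prop) :
    MeasurableSet {ω | ω ∈ S ↔ p} := by
  by_cases hp : p
  · simpa [hp] using hS
  · have : {ω | ω ∈ S ↔ p} = Sᶜ := by ext; simp [hp]
    rw [this]; exact hS.compl

theorem measurableSet_code {S : ℕ → Set Ω} (hS : ∀ n, MeasurableSet (S n)) (n : ℕ)
    (l : Finset ℕ) : MeasurableSet {ω | code S n ω = l} := by
  induction n generalizing l with
  | zero => simp [code]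
  | succ n ih => rw [code_succ_eq_iff]; exact (ih _).inter (measurableSet_iff_mem (hS n) _)

theorem measurable_bits {S : ℕ → Set Ω} (hS : ∀ n, MeasurableSet (S n)) : Measurable (bits S) :=
  measurable_pi_lambda _ fun n => measurable_to_bool (by
    have : (fun ω => bits S ω n) ⁻¹' {true} = S n := by ext; simp [bits]
    rw [this]; exact hS n)

/-- Reduces the law of `bits S` on cylinders to the measures of the events `code S n = l`, which are
what the inductive construction controls. -/
theorem map_bits_cylinder {S : ℕ → Set Ω} (hS : ∀ n, MeasurableSet (S n)) (s : Finset ℕ)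
    (U : Set (s → Bool)) (hU : MeasurableSet U) :
    μ.map (bits S) (cylinder s U) =
      ∑' l : {l : Finset ℕ | (fun i : s => decide (i.1 ∈ l)) ∈ U},
        μ {ω | code S (s.sup id + 1) ω = l} := by
  classical
  rw [Measure.map_apply (measurable_bits hS) (.cylinder s hU), ← measure_iUnion
    (fun l l' hne => Set.disjoint_left.2 fun ω h1 h2 => hne (Subtype.ext (h1.symm.trans h2)))
    (fun l => measurableSet_code hS _ _)]
  congr 1
  ext ω
  simp only [Set.mem_preimage, mem_cylinder, Set.mem_iUnion, Set.mem_ofPred_eq, Subtype.exists,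
    exists_prop, exists_eq_right']
  -- All coordinates in `s` lie below `s.sup id + 1`, so the code of that length determines them.
  have : s.restrict (bits S ω) = fun i : s => decide (i.1 ∈ code S (s.sup id + 1) ω) := by
    ext i
    have hi : i.1 < s.sup id + 1 := Nat.lt_succ_of_le (Finset.le_sup (f := id) i.2)
    simp [bits, code, hi]
  rw [this]

/-- The sets are copied one at a time: each atom `code T n = l` is divided in the way `S n` divides
its counterpart, and the chosen parts together form the new set `T n`. -/
theorem Compatible.exists_code (h : Compatible μ ν) {A : Set Ω} {B : Set Ω'}
    (hA : MeasurableSet A) (hB : MeasurableSet B) (hAB : ν B = μ A) {S : ℕ → Set Ω}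
    (hS : ∀ n, MeasurableSet (S n)) :
    ∃ T : ℕ → Set Ω', (∀ n, MeasurableSet (T n)) ∧
      ∀ n l, ν (B ∩ {ω | code T n ω = l}) = μ (A ∩ {ω | code S n ω = l}) := by
  obtain ⟨T, hT⟩ := exists_seq_dep
    (P := fun n (T : ℕ → Set Ω') => (∀ n, MeasurableSet (T n)) ∧
      ∀ l, ν (B ∩ {ω | code T n ω = l}) = μ (A ∩ {ω | code S n ω = l}))
    (Q := fun n T T' => ∀ i < n, T' i = T i)
    ⟨fun _ => ∅, fun _ => MeasurableSet.empty, fun l => by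
      by_cases hl : ∅ = l
      · subst hl; simp [code, hAB]
      · simp [code, hl]⟩
    (by
      rintro n T ⟨hT, hl⟩
      choose D hD1 hD2 hD3 hD4 using fun l => h.split (hA.inter (measurableSet_code hS n l)) (hS n)
        (hB.inter (measurableSet_code hT n l)) (hl l)
      have hU : MeasurableSet (⋃ l, D l) := MeasurableSet.iUnion hD2
      have hUl : ∀ l, (B ∩ {ω | code T n ω = l}) ∩ (⋃ l, D l) = D l := by
        intro l
        refine Set.Subset.antisymm ?_ fun ω hω => ⟨hD1 l hω, Set.mem_iUnion.2 ⟨l, hω⟩⟩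
        rintro ω ⟨⟨_, h1⟩, h2⟩
        obtain ⟨l', hl'⟩ := Set.mem_iUnion.1 h2
        have : l' = l := (hD1 l' hl').2.symm.trans h1
        rwa [this] at hl'
      have hT' : ∀ i, MeasurableSet (Function.update T n (⋃ l, D l) i) := by
        intro i
        rcases eq_or_ne i n with rfl | hne
        · simpa using hU
        · simpa [hne] using hT i
      refine ⟨Function.update T n (⋃ l, D l), ⟨hT', fun l => ?_⟩, fun i hi => by simp [hi.ne]⟩
      rw [code_succ_eq_iff, code_succ_eq_iff, ← Set.inter_assoc, ← Set.inter_assoc,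
        code_congr (T := T) fun i hi => by simp [hi.ne], Function.update_self]
      by_cases hn : n ∈ l
      · simp only [hn, iff_true, Set.ofPred_mem_eq]
        rw [hUl, hD3]
      · simp only [hn, iff_false]
        change ν ((B ∩ {ω | code T n ω = l.erase n}) \ ⋃ l, D l) = μ (_ \ S n)
        rw [← hD4, ← hUl (l.erase n), Set.sdiff_self_inter])
  -- The set with index `i` is fixed from stage `i + 1` on, so the diagonal sequence has all the
  -- required codes.
  have hst : ∀ n i, i < n → T n i = T (i + 1) i := by
    intro n i hi
    induction n with
    | zero => omega
    | succ n ih =>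
      rcases Nat.lt_succ_iff_lt_or_eq.1 hi with hlt | rfl
      · rw [(hT n).2 i hlt, ih hlt]
      · rfl
  refine ⟨fun n => T (n + 1) n, fun n => (hT _).1.1 _, fun n l => ?_⟩
  rw [← (hT n).1.2 l, code_congr fun i hi => (hst n i hi).symm]

/-- A standard Borel space embeds measurably into the sequences of bits. Copying the coordinate sets
gives a sequence of bits with the same law, as finite measures that agree on cylinders coincide. A
measurable left inverse of the embedding then returns to `X`. -/
theorem Compatible.exists_map_eq (h : Compatible μ ν) {A : Set Ω} {B : Set Ω'}
    (hA : MeasurableSet A) (hB : MeasurableSet B) (hAB : ν B = μ A) (hfin : μ A < ∞)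
    {X : Type*} [MeasurableSpace X] [StandardBorelSpace X] [Nonempty X] {F : Ω → X}
    (hF : Measurable F) :
    ∃ G : Ω' → X, Measurable G ∧ (ν.restrict B).map G = (μ.restrict A).map F := by
  have hmb := MeasurableSpace.measurable_mapNatBool X
  let S : ℕ → Set Ω := fun n => {ω | MeasurableSpace.mapNatBool X (F ω) n = true}
  have hS : ∀ n, MeasurableSet (S n) := fun n =>
    (measurable_pi_apply n).comp (hmb.comp hF) (measurableSet_singleton true)
  have hbS : bits S = MeasurableSpace.mapNatBool X ∘ F := by
    ext ω n; simp [bits, S]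
  obtain ⟨T, hT, hTS⟩ := h.exists_code hA hB hAB hS
  have : IsFiniteMeasure (ν.restrict B) := ⟨by rw [Measure.restrict_apply_univ, hAB]; exact hfin⟩
  have : IsFiniteMeasure (μ.restrict A) := ⟨by rwa [Measure.restrict_apply_univ]⟩
  have hcode : ∀ n l, ν.restrict B {ω | code T n ω = l} = μ.restrict A {ω | code S n ω = l} := by
    intro n l
    rw [Measure.restrict_apply (measurableSet_code hT n l),
      Measure.restrict_apply (measurableSet_code hS n l), Set.inter_comm, hTS, Set.inter_comm]
  have hlaw : (ν.restrict B).map (bits T) = (μ.restrict A).map (bits S) := by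
    refine ext_of_generate_finite _ generateFrom_measurableCylinders.symm
      isPiSystem_measurableCylinders (fun t ht => ?_) ?_
    · obtain ⟨s, U, hU, rfl⟩ := (mem_measurableCylinders t).1 ht
      rw [map_bits_cylinder hT s U hU, map_bits_cylinder hS s U hU]
      simp only [hcode]
    · rw [Measure.map_apply (measurable_bits hT) .univ, Measure.map_apply (measurable_bits hS) .univ]
      simpa using hAB
  have hemb : MeasurableEmbedding (MeasurableSpace.mapNatBool X) :=
    hmb.measurableEmbedding (MeasurableSpace.injective_mapNatBool X)
  obtain ⟨g, hg, hgc⟩ := hemb.exists_measurable_extend measurable_id fun _ => inferInstance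
  refine ⟨g ∘ bits T, hg.comp (measurable_bits hT), ?_⟩
  rw [← Measure.map_map hg (measurable_bits hT), hlaw, Measure.map_map hg (measurable_bits hS),
    hbS, ← Function.comp_assoc, hgc, Function.id_comp]

/-- **Transfer theorem.** A measurable map can be carried over from disjoint sets `A k` to disjoint
sets `B k` of the same measures in such a way that countably many given events away from a base
point keep their measures. -/
theorem Compatible.transfer (h : Compatible μ ν) {κ : Type*} [Countable κ] {A : κ → Set Ω}
    {B : κ → Set Ω'} (hA : ∀ k, MeasurableSet (A k)) (hB : ∀ k, MeasurableSet (B k))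
    (hBd : Pairwise (Function.onFun Disjoint B))
    (hAB : ∀ k, ν (B k) = μ (A k)) {X : Type*} [MeasurableSpace X] [StandardBorelSpace X]
    (x₀ : X) {F : Ω → X} (hF : Measurable F) {ι : Type*} [Countable ι] {S : ι → Set X}
    (hS : ∀ i, MeasurableSet (S i)) (hS0 : ∀ i, x₀ ∉ S i) :
    ∃ G : Ω' → X, Measurable G ∧ (∀ ω, (∀ k, ω ∉ B k) → G ω = x₀) ∧
      ∀ i k, ν (B k ∩ G ⁻¹' S i) = μ (A k ∩ F ⁻¹' S i) := by
  have : Nonempty X := ⟨x₀⟩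
  rcases isEmpty_or_nonempty ι with hι | hι
  · exact ⟨fun _ => x₀, measurable_const, fun _ _ => rfl, fun i => (IsEmpty.false i).elim⟩
  -- Inside `A k` there are countably many disjoint sets of finite measure whose union meets each
  -- event in its full measure, infinite values included. What `F` does on the rest of `A k` is
  -- discarded.
  have cell : ∀ k, ∃ D : ℕ → Set Ω, ∃ E : ℕ → Set Ω', (∀ n, MeasurableSet (D n)) ∧
      (∀ n, MeasurableSet (E n)) ∧ (∀ n, E n ⊆ B k) ∧ (∀ n, ν (E n) = μ (D n)) ∧
      (∀ n, μ (D n) < ∞) ∧ Pairwise (Function.onFun Disjoint D) ∧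
      Pairwise (Function.onFun Disjoint E) ∧
      ∀ i, μ ((⋃ n, D n) ∩ F ⁻¹' S i) = μ (A k ∩ F ⁻¹' S i) := by
    intro k
    choose C hC1 hC2 hC3 hC4 using fun i => h.units.exists_sigmaFinite ((hA k).inter (hF (hS i)))
    obtain ⟨e, he⟩ := exists_surjective_nat (ι × ℕ)
    let C' : ℕ → Set Ω := fun n => C (e n).1 (e n).2
    have hUn : ∀ i n, C i n ⊆ ⋃ n, disjointed C' n := by
      intro i n
      rw [iUnion_disjointed]
      obtain ⟨m, hm⟩ := he (i, n)
      refine Set.Subset.trans ?_ (Set.subset_iUnion C' m)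
      simp [C', hm]
    have hDm : ∀ n, MeasurableSet (disjointed C' n) :=
      MeasurableSet.disjointed fun n => hC1 _ _
    have hDs : ∀ n, disjointed C' n ⊆ A k := fun n =>
      (disjointed_subset C' n).trans ((hC2 _ _).trans Set.inter_subset_left)
    obtain ⟨E, hE1, hE2, hE3, hE4⟩ := h.embed (hA k) (hB k) (hAB k) (disjointed C') hDm hDs
      (disjoint_disjointed C')
    refine ⟨disjointed C', E, hDm, hE1, hE2, hE3, fun n =>
      (measure_mono (disjointed_subset C' n)).trans_lt (hC3 _ _), disjoint_disjointed C', hE4,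
      fun i => le_antisymm ?_ ?_⟩
    · exact measure_mono (Set.inter_subset_inter_left _ (Set.iUnion_subset hDs))
    · rw [← hC4 i]
      exact measure_mono (Set.iUnion_subset fun n => Set.subset_inter (hUn i n)
        ((hC2 i n).trans Set.inter_subset_right))
  choose D E hD hE hEB hED hDf hDd hEd hDS using cell
  choose g hg hgm using fun (p : κ × ℕ) =>
    h.exists_map_eq (hD p.1 p.2) (hE p.1 p.2) (hED p.1 p.2) (hDf p.1 p.2) hF
  -- The index `none` stands for the complement of all copies, where the new map takes the value
  -- `x₀`.
  let t : Option (κ × ℕ) → Set Ω' := fun o => o.elim (⋃ p : κ × ℕ, E p.1 p.2)ᶜ fun p => E p.1 p.2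
  have hEdisj : ∀ p q : κ × ℕ, p ≠ q → Disjoint (E p.1 p.2) (E q.1 q.2) := by
    rintro ⟨k, n⟩ ⟨k', n'⟩ hne
    rcases eq_or_ne k k' with rfl | hk
    · exact hEd k (by simpa using hne)
    · exact (hBd hk).mono (hEB _ _) (hEB _ _)
  have htd : ∀ o o', o ≠ o' → Disjoint (t o) (t o') := by
    rintro (_ | p) (_ | q) hne
    · exact (hne rfl).elim
    · exact Set.disjoint_compl_left_iff_subset.2
        (Set.subset_iUnion (fun p : κ × ℕ => E p.1 p.2) q)
    · exact Set.disjoint_compl_right_iff_subset.2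
        (Set.subset_iUnion (fun p : κ × ℕ => E p.1 p.2) p)
    · exact hEdisj p q fun heq => hne (by rw [heq])
  have htm : ∀ o, MeasurableSet (t o) := by
    rintro (_ | p)
    · exact (MeasurableSet.iUnion fun p : κ × ℕ => hE p.1 p.2).compl
    · exact hE _ _
  let g' : Option (κ × ℕ) → Ω' → X := fun o => o.elim (fun _ => x₀) g
  have hgm' : ∀ o, Measurable (g' o) := by
    rintro (_ | p)
    · exact measurable_const
    · exact hg p
  obtain ⟨G, hG, hGt⟩ := exists_measurable_piecewise t htm g' hgm'
    (fun o o' hne ω hω => (Set.disjoint_left.1 (htd o o' hne) hω.1 hω.2).elim)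
  have hG0 : ∀ ω, (∀ k n, ω ∉ E k n) → G ω = x₀ := fun ω hω =>
    hGt none (show ω ∈ (⋃ p : κ × ℕ, E p.1 p.2)ᶜ by simpa using fun a b => hω a b)
  refine ⟨G, hG, fun ω hω => hG0 ω fun k n hE => hω k (hEB k n hE), fun i k => ?_⟩
  have h1 : B k ∩ G ⁻¹' S i = ⋃ n, E k n ∩ G ⁻¹' S i := by
    ext ω
    simp only [Set.mem_inter_iff, Set.mem_preimage, Set.mem_iUnion]
    constructor
    · rintro ⟨hω, hS⟩
      -- Off the copies the map equals `x₀`, which belongs to none of the events, so an event within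
      -- `B k` is covered by the sets `E k n`.
      by_contra! hcon
      refine hS0 i ?_
      rw [← hG0 ω fun k' n hE => ?_]
      · exact hS
      · rcases eq_or_ne k' k with rfl | hk
        · exact hcon n hE hS
        · exact Set.disjoint_left.1 (hBd hk) (hEB _ _ hE) hω
    · rintro ⟨n, hn, hS⟩
      exact ⟨hEB k n hn, hS⟩
  have h2 : ∀ n, ν (E k n ∩ G ⁻¹' S i) = μ (D k n ∩ F ⁻¹' S i) := by
    intro n
    have h3 : E k n ∩ G ⁻¹' S i = E k n ∩ g (k, n) ⁻¹' S i := by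
      ext ω
      simp only [Set.mem_inter_iff, Set.mem_preimage]
      refine and_congr_right fun hω => ?_
      rw [hGt (some (k, n)) hω]
      rfl
    have h4 := congrArg (fun m => m (S i)) (hgm (k, n))
    simp only [Measure.map_apply (hg (k, n)) (hS i), Measure.map_apply hF (hS i),
      Measure.restrict_apply (hg (k, n) (hS i)), Measure.restrict_apply (hF (hS i))] at h4
    rw [h3, Set.inter_comm, h4, Set.inter_comm]
  rw [h1, measure_iUnion (fun n n' hne => (hEd k hne).mono Set.inter_subset_left
    Set.inter_subset_left) fun n => (hE k n).inter (hG (hS i)), ← hDS k i, Set.iUnion_inter,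
    measure_iUnion (fun n n' hne => (hDd k hne).mono Set.inter_subset_left
    Set.inter_subset_left) fun n => (hD k n).inter (hF (hS i))]
  simp only [h2]

end Transfer

/-! ### Distribution functions and comparable cells -/

section Distribution

variable {Ω : Type u} [MeasurableSpace Ω] {μ : Measure Ω}
variable {Ω' : Type v} [MeasurableSpace Ω'] {ν : Measure Ω'}

theorem tendsto_measure_lt {f : Ω → ℝ} {s : ℝ} {v : ℕ → ℝ} (hv : Antitone v)
    (hvs : ∀ n, s < v n) (hlim : Tendsto v atTop (𝓝 s)) :
    Tendsto (fun n => μ {ω | v n < f ω}) atTop (𝓝 (μ {ω | s < f ω})) := by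
  have h : {ω | s < f ω} = ⋃ n, {ω | v n < f ω} := by
    ext ω
    simp only [Set.mem_ofPred_eq, Set.mem_iUnion]
    exact ⟨fun hω => (hlim.eventually (gt_mem_nhds hω)).exists, fun ⟨n, hn⟩ => (hvs n).trans hn⟩
  rw [h]
  exact tendsto_measure_iUnion_atTop fun m n hmn ω hω => (hv hmn).trans_lt hω

/-- By right continuity, rational levels determine the whole distribution. This is why preserving
countably many events preserves distributions. -/
theorem measure_lt_eq_of_rat {f : Ω → ℝ} {g : Ω' → ℝ} {A : Set Ω} {B : Set Ω'}
    (h : ∀ q : {q : ℚ // 0 ≤ q}, ν (B ∩ {ω | (q : ℝ) < g ω}) = μ (A ∩ {ω | (q : ℝ) < f ω}))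
    (hA : MeasurableSet A) (hB : MeasurableSet B) (s : ℝ≥0) :
    ν (B ∩ {ω | (s : ℝ) < g ω}) = μ (A ∩ {ω | (s : ℝ) < f ω}) := by
  obtain ⟨q, hq, hqs, hlim⟩ := Real.exists_seq_rat_strictAnti_tendsto (s : ℝ)
  have hq' : Antitone fun n => (q n : ℝ) := fun m n hmn =>
    Rat.cast_le.2 (hq.antitone hmn)
  have h1 := tendsto_measure_lt (μ := μ.restrict A) (f := f) hq' hqs hlim
  have h2 := tendsto_measure_lt (μ := ν.restrict B) (f := g) hq' hqs hlim
  simp only [Measure.restrict_apply' hA, Measure.restrict_apply' hB] at h1 h2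
  simp only [Set.inter_comm _ A, Set.inter_comm _ B] at h1 h2
  refine tendsto_nhds_unique h2 (h1.congr fun n => (h ⟨q n, ?_⟩).symm)
  exact_mod_cast (NNReal.coe_nonneg s).trans (hqs n).le

theorem distrib_eq_of_ae {x : Ω →ₘ[μ] ℝ} {f : Ω → ℝ} (h : x =ᵐ[μ] f) (s : ℝ≥0) :
    distrib x s = μ {ω | (s : ℝ) < |f ω|} :=
  measure_congr (by filter_upwards [h] with ω hω; exact congrArg (fun t => (s : ℝ) < |t|) hω)

theorem distrib_mk {f : Ω → ℝ} (hf : AEStronglyMeasurable f μ) (s : ℝ≥0) :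
    distrib (AEEqFun.mk f hf) s = μ {ω | (s : ℝ) < |f ω|} :=
  distrib_eq_of_ae (AEEqFun.coeFn_mk _ _) s

theorem distrib_antitone (x : Ω →ₘ[μ] ℝ) : Antitone (distrib x) := fun _ _ hst =>
  measure_mono fun _ hω => lt_of_le_of_lt (NNReal.coe_le_coe.2 hst) hω

theorem abs_le_abs_iff_ae {x y : Ω →ₘ[μ] ℝ} : |x| ≤ |y| ↔ ∀ᵐ ω ∂μ, |x ω| ≤ |y ω| := by
  rw [← AEEqFun.coeFn_le]
  constructor <;> intro h <;>
    filter_upwards [h, AEEqFun.coeFn_abs x, AEEqFun.coeFn_abs y] with ω h1 h2 h3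
  · rwa [h2, h3] at h1
  · rwa [h2, h3]

theorem rearr_le_of_distrib_lt {x : Ω →ₘ[μ] ℝ} {s t : ℝ≥0} (h : distrib x s < t) :
    rearr x t ≤ s := iInf₂_le s h

/-- The infimum in `rearr` need not be attained; right continuity of the distribution function
replaces attainment, at the price of a weak inequality. -/
theorem distrib_le_of_rearr_le {x : Ω →ₘ[μ] ℝ} {s t : ℝ≥0} (h : rearr x t ≤ s) :
    distrib x s ≤ t := by
  obtain ⟨q, hq, hqs, hlim⟩ := exists_seq_strictAnti_tendsto s
  have h1 := tendsto_measure_lt (μ := μ) (f := fun ω => |x ω|) (s := (s : ℝ))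
    (v := fun n => (q n : ℝ)) (fun m n hmn => NNReal.coe_le_coe.2 (hq.antitone hmn))
    (fun n => NNReal.coe_lt_coe.2 (hqs n)) ((NNReal.tendsto_coe).2 hlim)
  refine le_of_tendsto' h1 fun n => ?_
  have h2 : rearr x t < q n := h.trans_lt (ENNReal.coe_lt_coe.2 (hqs n))
  obtain ⟨r, hr⟩ := iInf_lt_iff.1 h2
  obtain ⟨hrt, hrq⟩ := iInf_lt_iff.1 hr
  exact (distrib_antitone x (ENNReal.coe_lt_coe.1 hrq).le).trans hrt.le

theorem rearr_eq_iff {x : Ω →ₘ[μ] ℝ} {y : Ω' →ₘ[ν] ℝ} :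
    rearr x = rearr y ↔ ∀ s, distrib x s = distrib y s := by
  constructor
  · intro h s
    have key : ∀ {a b : ℝ≥0∞}, (∀ t : ℝ≥0, a < t → b ≤ t) → b ≤ a := fun {a b} hab => by
      by_contra! hlt
      obtain ⟨t, h1, h2⟩ := ENNReal.lt_iff_exists_nnreal_btwn.1 hlt
      exact (hab t h1).not_gt h2
    refine le_antisymm (key fun t ht => ?_) (key fun t ht => ?_)
    · exact distrib_le_of_rearr_le (h ▸ rearr_le_of_distrib_lt ht)
    · exact distrib_le_of_rearr_le (h ▸ rearr_le_of_distrib_lt ht)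
  · intro h
    funext t
    simp only [rearr, h]

/-- Layer cake formula. -/
theorem lintegral_enorm_eq_of_distribution {f : Ω → ℝ} {g : Ω' → ℝ} (hf : Measurable f)
    (hg : Measurable g) (h : ∀ s : ℝ≥0, μ {ω | (s : ℝ) < |f ω|} = ν {ω | (s : ℝ) < |g ω|}) :
    ∫⁻ ω, ‖f ω‖ₑ ∂μ = ∫⁻ ω, ‖g ω‖ₑ ∂ν := by
  simp only [Real.enorm_eq_ofReal_abs]
  rw [lintegral_eq_lintegral_meas_lt μ (ae_of_all _ fun ω => abs_nonneg (f ω)) (by fun_prop),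
    lintegral_eq_lintegral_meas_lt ν (ae_of_all _ fun ω => abs_nonneg (g ω)) (by fun_prop)]
  refine setLIntegral_congr_fun measurableSet_Ioi fun t ht => ?_
  exact h ⟨t, (Set.mem_Ioi.1 ht).le⟩

/-- A version of the transfer theorem for functions: the distributions of countably many functions
of `F` and the measures of countably many events are kept. -/
theorem Compatible.transfer_fun (h : Compatible μ ν) {X : Type*} [MeasurableSpace X]
    [StandardBorelSpace X] (x₀ : X) {F : Ω → X} (hF : Measurable F) {ι κ : Type*} [Countable ι]
    [Countable κ] {H : ι → X → ℝ} (hH : ∀ i, Measurable (H i)) (hH0 : ∀ i, H i x₀ = 0)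
    {S : κ → Set X} (hS : ∀ k, MeasurableSet (S k)) (hS0 : ∀ k, x₀ ∉ S k) :
    ∃ G : Ω' → X, Measurable G ∧
      (∀ i (s : ℝ≥0), ν {ω | (s : ℝ) < |H i (G ω)|} = μ {ω | (s : ℝ) < |H i (F ω)|}) ∧
      ∀ k, ν (G ⁻¹' S k) = μ (F ⁻¹' S k) := by
  let S' : (ι × {q : ℚ // 0 ≤ q}) ⊕ κ → Set X :=
    Sum.elim (fun p => {x | (p.2 : ℝ) < |H p.1 x|}) S
  obtain ⟨G, hG, -, hGS⟩ := h.transfer (κ := Unit) (A := fun _ => Set.univ)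
    (B := fun _ => Set.univ) (fun _ => .univ) (fun _ => .univ)
    (fun i j hij => (hij rfl).elim) (fun _ => h.univ.symm) x₀ hF (S := S')
    (by rintro (⟨i, q⟩ | k)
        · exact measurableSet_lt measurable_const ((hH i).abs)
        · exact hS k)
    (by rintro (⟨i, q⟩ | k)
        · simpa [S', hH0] using q.2
        · exact hS0 k)
  refine ⟨G, hG, fun i s => ?_, fun k => by simpa [S'] using hGS (.inr k) ()⟩
  have := measure_lt_eq_of_rat (μ := μ) (ν := ν) (f := fun ω => |H i (F ω)|)
    (g := fun ω => |H i (G ω)|) (A := Set.univ) (B := Set.univ)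
    (fun q => hGS (.inl (i, q)) ()) .univ .univ s
  simpa using this

theorem Compatible.transfer_cells (h : Compatible μ ν) {κ : Type*} [Countable κ] {A : κ → Set Ω}
    {B : κ → Set Ω'} (hA : ∀ k, MeasurableSet (A k)) (hB : ∀ k, MeasurableSet (B k))
    (hBd : Pairwise (Function.onFun Disjoint B)) (hAB : ∀ k, ν (B k) = μ (A k))
    {f : Ω → ℝ} (hf : Measurable f) :
    ∃ g : Ω' → ℝ, Measurable g ∧ (∀ ω, (∀ k, ω ∉ B k) → g ω = 0) ∧
      ∀ k (s : ℝ≥0), ν (B k ∩ {ω | (s : ℝ) < |g ω|}) = μ (A k ∩ {ω | (s : ℝ) < |f ω|}) := by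
  obtain ⟨G, hG, h0, hGS⟩ := h.transfer hA hB hBd hAB (0 : ℝ) hf
    (S := fun q : {q : ℚ // 0 ≤ q} => {x | (q : ℝ) < |x|})
    (fun q => measurableSet_lt measurable_const measurable_id.abs)
    (fun q => by simpa using q.2)
  exact ⟨G, hG, h0, fun k s => measure_lt_eq_of_rat (f := fun ω => |f ω|) (g := fun ω => |G ω|)
    (fun q => hGS q k) (hA k) (hB k) s⟩

theorem _root_.Antitone.pairwise_disjoint_sdiff {α : Type*} {N : ℤ → Set α} (hN : Antitone N) :
    Pairwise (Function.onFun Disjoint fun k => N k \ N (k + 1)) :=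
  (pairwise_disjoint_on _).2 fun _ _ hij =>
    Set.disjoint_sdiff_left.mono_right (Set.sdiff_subset.trans (hN hij))

/-- Two functions of the same distribution are comparable, up to a factor, along disjoint cells of
equal measures. -/
theorem Compatible.exists_cells (h : Compatible μ ν) {f : Ω → ℝ} {g : Ω' → ℝ} (hf : Measurable f)
    (hg : Measurable g) (hfg : ∀ s : ℝ≥0, μ {ω | (s : ℝ) < |f ω|} = ν {ω | (s : ℝ) < |g ω|})
    {c : ℝ} (hc : 1 < c) :
    ∃ (A : ℤ → Set Ω) (B : ℤ → Set Ω'), (∀ k, MeasurableSet (A k)) ∧ (∀ k, MeasurableSet (B k)) ∧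
      Pairwise (Function.onFun Disjoint A) ∧ Pairwise (Function.onFun Disjoint B) ∧
      (∀ k, ν (B k) = μ (A k)) ∧ (∀ ω, f ω ≠ 0 → ∃ k, ω ∈ A k) ∧
      (∀ k, ∀ ω ∈ A k, |f ω| ≤ c * c ^ k) ∧ ∀ k, ∀ ω ∈ B k, c ^ k ≤ |g ω| := by
  have hc0 : 0 < c := by linarith
  let L : ℤ → Set Ω := fun k => {ω | c ^ k < |f ω|}
  let M : ℤ → Set Ω' := fun k => {ω | c ^ k < |g ω|}
  have hL : ∀ k, MeasurableSet (L k) := fun k => measurableSet_lt measurable_const hf.abs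
  have hM : ∀ k, MeasurableSet (M k) := fun k => measurableSet_lt measurable_const hg.abs
  have hLM : ∀ k, ν (M k) = μ (L k) := fun k => (hfg ⟨c ^ k, (zpow_pos hc0 k).le⟩).symm
  have hLa : Antitone L := fun i j hij ω hω => (zpow_le_zpow_right₀ hc.le hij).trans_lt hω
  have hMa : Antitone M := fun i j hij ω hω => (zpow_le_zpow_right₀ hc.le hij).trans_lt hω
  have hlev : ∀ ω, f ω ≠ 0 → ∃ k, ω ∈ L k ∧ ω ∉ L (k + 1) := fun ω hω => by
    obtain ⟨n, h1, h2⟩ := exists_mem_Ioc_zpow (abs_pos.2 hω) hc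
    exact ⟨n, h1, not_lt.2 h2⟩
  have hbound : ∀ k ω, ω ∉ L (k + 1) → |f ω| ≤ c * c ^ k := fun k ω hω => by
    have : |f ω| ≤ c ^ (k + 1) := not_lt.1 hω
    rwa [zpow_add_one₀ hc0.ne', mul_comm] at this
  by_cases hfin : ∃ n, μ (L n) < ∞
  -- Where `μ (L k)` is finite, the layers of `f` and `g` have equal measures by subtraction. At the
  -- greatest `k` with `μ (L k) = ∞` subtraction still gives an infinite layer of `g`, and this one
  -- cell takes all points with `|f| ≤ c ^ (k + 1)`; the cells below it are empty. Lower layers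
  -- could have different measures for `f` and `g`.
  · obtain ⟨N, hN⟩ := hfin
    classical
    let A : ℤ → Set Ω := fun k => if μ (L k) < ∞ then L k \ L (k + 1) else
      if μ (L (k + 1)) < ∞ then (L (k + 1))ᶜ else ∅
    let B : ℤ → Set Ω' := fun k => if μ (L (k + 1)) < ∞ then M k \ M (k + 1) else ∅
    have hmono : ∀ {i j}, i ≤ j → μ (L i) < ∞ → μ (L j) < ∞ := fun hij hi =>
      (measure_mono (hLa hij)).trans_lt hi
    have hAc : ∀ k, A k ⊆ (L (k + 1))ᶜ := by
      intro k
      simp only [A]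
      split_ifs
      · exact Set.sdiff_subset_compl _ _
      · exact subset_rfl
      · exact Set.empty_subset _
    have hBs : ∀ k, B k ⊆ M k \ M (k + 1) := by
      intro k
      simp only [B]
      split_ifs
      · exact subset_rfl
      · exact Set.empty_subset _
    refine ⟨A, B, fun k => ?_, fun k => ?_, ?_, ?_, fun k => ?_, fun ω hω => ?_,
      fun k ω hω => hbound k ω (hAc k hω), fun k ω hω => (hBs k hω).1.le⟩
    · simp only [A]
      split_ifs
      exacts [(hL _).diff (hL _), (hL _).compl, .empty]
    · simp only [B]
      split_ifs
      exacts [(hM _).diff (hM _), .empty]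
    · refine (pairwise_disjoint_on _).2 fun i j hij => Set.disjoint_left.2 fun ω hi hj => ?_
      have h1 : μ (L (i + 1)) < ∞ := by
        by_contra hcon
        have : ¬ μ (L i) < ∞ := fun h => hcon (hmono (by omega) h)
        simp [A, hcon, this] at hi
      have h2 : μ (L j) < ∞ := hmono hij h1
      have h3 : ω ∈ L j := by
        simp only [A, h2, if_true] at hj
        exact hj.1
      exact hAc i hi (hLa hij h3)
    · exact fun i j hij => (hMa.pairwise_disjoint_sdiff hij).mono (hBs i) (hBs j)
    · by_cases h1 : μ (L k) < ∞
      · have h2 : μ (L (k + 1)) < ∞ := hmono (by omega) h1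
        simp only [A, B, h1, h2, if_true]
        rw [measure_sdiff (hMa (by omega)) (hM _).nullMeasurableSet (by rw [hLM]; exact h2.ne),
          measure_sdiff (hLa (by omega)) (hL _).nullMeasurableSet h2.ne, hLM, hLM]
      · by_cases h2 : μ (L (k + 1)) < ∞
        · simp only [A, B, h1, h2, if_true, if_false]
          rw [not_lt_top_iff] at h1
          rw [measure_sdiff_eq_top (by rw [hLM, h1]) (by rw [hLM]; exact h2.ne)]
          refine (top_le_iff.1 ?_).symm
          rw [← measure_sdiff_eq_top h1 h2.ne]
          exact measure_mono (Set.sdiff_subset_compl _ _)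
        · simp [A, B, h1, h2]
    · obtain ⟨n, hn1, hn2⟩ := hlev ω hω
      by_cases h2 : μ (L (n + 1)) < ∞
      · refine ⟨n, ?_⟩
        by_cases h1 : μ (L n) < ∞
        · simp only [A, h1, if_true]; exact ⟨hn1, hn2⟩
        · simp only [A, h1, h2, if_true, if_false]; exact hn2
      · obtain ⟨k, hk1, hk2⟩ := Int.exists_greatest_of_bdd (P := fun k => ¬ μ (L k) < ∞)
          ⟨N, fun z hz => by by_contra! hcon; exact hz (hmono hcon.le hN)⟩ ⟨n + 1, h2⟩
        refine ⟨k, ?_⟩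
        have h3 : μ (L (k + 1)) < ∞ := by
          by_contra hcon
          have := hk2 _ hcon
          omega
        simp only [A, hk1, h3, if_true, if_false]
        exact fun hmem => hn2 (hLa (by have := hk2 _ h2; omega) hmem)
  -- If all level sets are infinite, the measures of the layers of `g` are unknown. Disjoint sets of
  -- infinite measure inside the sets `M k` provide room for copies of the layers of `f`; only the
  -- lower bound for `|g|` on them matters.
  · have htop : ∀ k, ν (M k) = ∞ := fun k => by
      rw [hLM]; exact not_lt_top_iff.1 fun hlt => hfin ⟨k, hlt⟩
    obtain ⟨C, c1, c2, c3, c4⟩ := h.units'.exists_disjoint_top M hM htop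
    have : ∀ k, ∃ B ⊆ C k, MeasurableSet B ∧ ν B = μ (L k \ L (k + 1)) := by
      intro k
      rcases (le_top : μ (L k \ L (k + 1)) ≤ ∞).lt_or_eq with hlt | heq
      · exact h.cuts _ ((hL _).diff (hL _)) hlt _ (c2 k) (by rw [c3]; exact le_top)
      · exact ⟨C k, subset_rfl, c2 k, by rw [c3, heq]⟩
    choose B b1 b2 b3 using this
    refine ⟨fun k => L k \ L (k + 1), B, fun k => (hL _).diff (hL _), b2, hLa.pairwise_disjoint_sdiff,
      fun i j hij => (c4 hij).mono (b1 i) (b1 j), b3, hlev, fun k ω hω => hbound k ω hω.2,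
      fun k ω hω => (c1 k (b1 k hω)).le⟩

/-- The largest label is split off by `split`, and induction handles the rest. -/
theorem Compatible.exists_partition (h : Compatible μ ν) (n : ℕ) {A : Set Ω} {B : Set Ω'}
    (hA : MeasurableSet A) (hB : MeasurableSet B) (hAB : ν B = μ A) {c : Ω → ℕ}
    (hc : Measurable c) (hcn : ∀ ω ∈ A, c ω ≤ n) :
    ∃ d : Ω' → ℕ, Measurable d ∧ (∀ ω, d ω ≤ n) ∧
      ∀ i, ν (B ∩ d ⁻¹' {i}) = μ (A ∩ c ⁻¹' {i}) := by
  induction n generalizing A B with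
  | zero =>
    refine ⟨fun _ => 0, measurable_const, fun _ => le_rfl, fun i => ?_⟩
    rcases eq_or_ne i 0 with rfl | hi
    · have : A ∩ c ⁻¹' {0} = A := Set.inter_eq_left.2 fun ω hω => Nat.le_zero.1 (hcn ω hω)
      rw [this, ← hAB]
      simp
    · have : A ∩ c ⁻¹' {i} = ∅ := Set.eq_empty_of_forall_notMem fun ω hω => hi (by
        have h1 := hcn ω hω.1
        have h2 : c ω = i := hω.2
        omega)
      rw [this]
      simp [hi.symm]
  | succ n ih =>
    have hS : MeasurableSet (c ⁻¹' {n + 1}) := hc (measurableSet_singleton _)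
    obtain ⟨T, t1, t2, t3, t4⟩ := h.split hA hS hB hAB
    obtain ⟨d, hd, hdn, hdi⟩ := ih (hA.diff hS) (hB.diff t2) t4 (fun ω hω => by
      have h1 := hcn ω hω.1
      have h2 : c ω ≠ n + 1 := hω.2
      omega)
    classical
    refine ⟨T.piecewise (fun _ => n + 1) d, Measurable.piecewise t2 measurable_const hd,
      fun ω => ?_, fun i => ?_⟩
    · by_cases hω : ω ∈ T
      · simp [hω]
      · simpa [hω] using (hdn ω).trans (Nat.le_succ n)
    · rcases eq_or_ne i (n + 1) with rfl | hi
      · rw [← t3]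
        congr 1
        ext ω
        by_cases hω : ω ∈ T
        · simp [hω, t1 hω]
        · simpa [hω] using fun _ => ((hdn ω).trans_lt (Nat.lt_succ_self n)).ne
      · have h1 : A ∩ c ⁻¹' {i} = (A \ c ⁻¹' {n + 1}) ∩ c ⁻¹' {i} := by
          ext ω
          simp only [Set.mem_inter_iff, Set.mem_preimage, Set.mem_singleton_iff, Set.mem_sdiff]
          constructor
          · rintro ⟨h1, h2⟩; exact ⟨⟨h1, by omega⟩, h2⟩
          · rintro ⟨h1, h2⟩; exact ⟨h1.1, h2⟩
        rw [h1, ← hdi i]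
        congr 1
        ext ω
        by_cases hω : ω ∈ T
        · simp [hω, hi.symm]
        · simp [hω]

theorem exists_step {J : Type*} [Countable J] {E : J → Set Ω} (hE : ∀ j, MeasurableSet (E j))
    (hEd : Pairwise (Function.onFun Disjoint E)) (a : J → ℝ) :
    ∃ f : Ω → ℝ, Measurable f ∧ (∀ j, ∀ ω ∈ E j, f ω = a j) ∧ ∀ ω, (∀ j, ω ∉ E j) → f ω = 0 := by
  let t : Option J → Set Ω := fun o => o.elim (⋃ j, E j)ᶜ E
  obtain ⟨f, hf, hft⟩ := exists_measurable_piecewise t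
    (by rintro (_ | j)
        · exact (MeasurableSet.iUnion hE).compl
        · exact hE j)
    (fun o _ => o.elim 0 a) (fun o => measurable_const)
    (by
      rintro (_ | i) (_ | j) hne ω ⟨h1, h2⟩
      · rfl
      · exact (h1 (Set.mem_iUnion.2 ⟨j, h2⟩)).elim
      · exact (h2 (Set.mem_iUnion.2 ⟨i, h1⟩)).elim
      · exact (Set.disjoint_left.1 (hEd fun h => hne (by rw [h])) h1 h2).elim)
  refine ⟨f, hf, fun j ω hω => hft (some j) hω, fun ω hω => hft none ?_⟩
  simpa [t] using hω

/-- The distribution of a step function depends only on its values and the measures of its cells, so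
cells of equal measures give equimeasurable functions. -/
theorem measure_lt_abs_step {J : Type*} [Countable J] {E : J → Set Ω}
    (hE : ∀ j, MeasurableSet (E j)) (hEd : Pairwise (Function.onFun Disjoint E)) {a : J → ℝ}
    {f : Ω → ℝ} (hf : ∀ j, ∀ ω ∈ E j, f ω = a j) (hf0 : ∀ ω, (∀ j, ω ∉ E j) → f ω = 0) (s : ℝ≥0) :
    μ {ω | (s : ℝ) < |f ω|} = ∑' j : {j // (s : ℝ) < |a j|}, μ (E j) := by
  rw [← measure_iUnion (f := fun j : {j // (s : ℝ) < |a j|} => E j)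
    (fun i j hij => hEd fun h => hij (Subtype.ext h)) fun j => hE j]
  congr 1
  ext ω
  simp only [Set.mem_ofPred_eq, Set.mem_iUnion, Subtype.exists, exists_prop]
  constructor
  · intro hs
    by_cases hω : ∃ j, ω ∈ E j
    · obtain ⟨j, hj⟩ := hω
      exact ⟨j, by rwa [hf j ω hj] at hs, hj⟩
    · push Not at hω
      rw [hf0 ω hω, abs_zero] at hs
      exact absurd hs (not_lt.2 s.2)
  · rintro ⟨j, hj, hω⟩
    rwa [hf j ω hω]

end Distribution

/-! ### Completeness and the Riesz–Fischer property -/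

section Ideal

variable {Ω : Type u} [MeasurableSpace Ω] {μ : Measure Ω}

instance : IsOrderedAddMonoid (Ω →ₘ[μ] ℝ) where
  add_le_add_left x y h z := by
    rw [← AEEqFun.coeFn_le] at h ⊢
    filter_upwards [h, AEEqFun.coeFn_add x z, AEEqFun.coeFn_add y z] with ω h1 h2 h3
    rw [h2, h3]
    exact add_le_add_left h1 _

/-- All the properties of a Banach ideal norm but completeness. -/
structure IsIdealNorm (N : (Ω →ₘ[μ] ℝ) → ℝ≥0∞) : Prop where
  eq_zero_iff : ∀ x, N x = 0 ↔ x = 0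
  smul : ∀ (c : ℝ) (x), N (c • x) = ‖c‖ₑ * N x
  add_le : ∀ x y, N (x + y) ≤ N x + N y
  mono : ∀ x y, |x| ≤ |y| → N x ≤ N y

/-- The Riesz–Fischer property: an absolutely summable series has a majorant. -/
def RieszFischer (N : (Ω →ₘ[μ] ℝ) → ℝ≥0∞) : Prop :=
  ∀ (w : ℕ → Ω →ₘ[μ] ℝ) (c : ℝ≥0∞), ∑' n, N (w n) < c →
    ∃ g, (∀ n, ∑ i ∈ Finset.range n, |w i| ≤ g) ∧ N g ≤ c

variable {N M : (Ω →ₘ[μ] ℝ) → ℝ≥0∞}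

namespace IsIdealNorm

theorem map_zero (hN : IsIdealNorm N) : N 0 = 0 := (hN.eq_zero_iff 0).2 rfl

theorem congr_abs (hN : IsIdealNorm N) {x y : Ω →ₘ[μ] ℝ} (h : |x| = |y|) : N x = N y :=
  le_antisymm (hN.mono _ _ h.le) (hN.mono _ _ h.ge)

theorem map_abs (hN : IsIdealNorm N) (x : Ω →ₘ[μ] ℝ) : N |x| = N x := hN.congr_abs (abs_abs x)

theorem map_neg (hN : IsIdealNorm N) (x : Ω →ₘ[μ] ℝ) : N (-x) = N x := hN.congr_abs (abs_neg x)

theorem map_sub_comm (hN : IsIdealNorm N) (x y : Ω →ₘ[μ] ℝ) : N (x - y) = N (y - x) := by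
  rw [← hN.map_neg, neg_sub]

theorem mono_of_nonneg (hN : IsIdealNorm N) {x y : Ω →ₘ[μ] ℝ} (hx : 0 ≤ x) (h : x ≤ y) :
    N x ≤ N y := hN.mono _ _ (by rwa [abs_of_nonneg hx, abs_of_nonneg (hx.trans h)])

theorem sub_le (hN : IsIdealNorm N) (x y z : Ω →ₘ[μ] ℝ) : N (x - z) ≤ N (x - y) + N (y - z) := by
  rw [← sub_add_sub_cancel x y z]; exact hN.add_le _ _

theorem sum_le (hN : IsIdealNorm N) {ι : Type*} (s : Finset ι) (w : ι → Ω →ₘ[μ] ℝ) :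
    N (∑ i ∈ s, w i) ≤ ∑ i ∈ s, N (w i) :=
  Finset.le_sum_of_subadditive N hN.map_zero.le hN.add_le s w

/-- The partial sums of the absolute values form a Cauchy sequence. Its limit is a majorant, because
the positive part of `s n - y` is dominated by `|s k - y|` for all `k ≥ n`, and the norm of the
latter tends to zero. -/
theorem rieszFischer (hN : IsIdealNorm N) (hc : ∀ x : ℕ → (Ω →ₘ[μ] ℝ), (∀ n, N (x n) < ∞) →
    (∀ ε : ℝ≥0∞, 0 < ε → ∃ K : ℕ, ∀ m, K ≤ m → ∀ n, K ≤ n → N (x m - x n) < ε) →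
    ∃ y, N y < ∞ ∧ Tendsto (fun n => N (x n - y)) atTop (𝓝 0)) : RieszFischer N := by
  intro w c hw
  set s : ℕ → Ω →ₘ[μ] ℝ := fun n => ∑ i ∈ Finset.range n, |w i| with hs
  have hsum : ∀ n, N (s n) ≤ ∑' i, N (w i) := fun n =>
    (hN.sum_le _ _).trans ((Finset.sum_congr rfl fun i _ => hN.map_abs _).le.trans
      (ENNReal.sum_le_tsum _))
  have hmono : Monotone s := monotone_nat_of_le_succ fun n => by
    simp only [hs, Finset.sum_range_succ]
    exact le_add_of_nonneg_right (abs_nonneg _)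
  have htail : ∀ K n, K ≤ n → N (s n - s K) ≤ ∑' i, N (w (i + K)) := by
    intro K n hKn
    obtain ⟨m, rfl⟩ := Nat.exists_eq_add_of_le hKn
    have : s (K + m) - s K = ∑ i ∈ Finset.range m, |w (i + K)| := by
      simp only [hs, Finset.sum_range_add, add_sub_cancel_left]
      exact Finset.sum_congr rfl fun i _ => by rw [add_comm]
    rw [this]
    exact (hN.sum_le _ _).trans ((Finset.sum_congr rfl fun i _ => hN.map_abs _).le.trans
      (ENNReal.sum_le_tsum _))
  obtain ⟨y, -, hy⟩ := hc s (fun n => (hsum n).trans_lt (hw.trans_le le_top)) (by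
    intro ε hε
    have h1 := ENNReal.tendsto_sum_nat_add (fun i => N (w i)) (hw.trans_le le_top).ne
    obtain ⟨K, hK⟩ := (h1.eventually (gt_mem_nhds (ENNReal.half_pos hε.ne'))).exists
    refine ⟨K, fun m hm n hn => ?_⟩
    calc N (s m - s n) ≤ N (s m - s K) + N (s K - s n) := hN.sub_le _ _ _
      _ < ε / 2 + ε / 2 := by
        rw [hN.map_sub_comm (s K)]
        exact ENNReal.add_lt_add ((htail K m hm).trans_lt hK) ((htail K n hn).trans_lt hK)
      _ = ε := ENNReal.add_halves ε)
  have hle : ∀ n, s n ≤ y := by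
    intro n
    have h0 : N ((s n - y) ⊔ 0) ≤ 0 := by
      refine ge_of_tendsto hy ((eventually_ge_atTop n).mono fun k hk => ?_)
      rw [← hN.map_abs (s k - y)]
      exact hN.mono_of_nonneg le_sup_right
        (sup_le ((sub_le_sub_right (hmono hk) _).trans (le_abs_self _)) (abs_nonneg _))
    have := (hN.eq_zero_iff _).1 (le_zero_iff.1 h0)
    exact sub_nonpos.1 (le_sup_left.trans this.le)
  refine ⟨y, hle, ?_⟩
  refine le_trans ?_ hw.le
  have h1 : ∀ n, N y ≤ N (s n - y) + ∑' i, N (w i) := fun n => by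
    calc N y = N ((y - s n) + s n) := by rw [sub_add_cancel]
      _ ≤ N (y - s n) + N (s n) := hN.add_le _ _
      _ ≤ _ := by rw [hN.map_sub_comm]; exact add_le_add_right (hsum n) _
  simpa using ge_of_tendsto' (hy.add_const (∑' i, N (w i))) h1

/-- Along a rapidly Cauchy subsequence the increments have a majorant, hence converge absolutely
almost everywhere. The majorants `g n` of the tails dominate the distance to the pointwise limit, so
the convergence also holds in norm. -/
theorem complete_of_rieszFischer (hN : IsIdealNorm N) (hR : RieszFischer N)
    (x : ℕ → Ω →ₘ[μ] ℝ) (hx : ∀ n, N (x n) < ∞)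
    (hcau : ∀ ε : ℝ≥0∞, 0 < ε → ∃ K : ℕ, ∀ m, K ≤ m → ∀ n, K ≤ n → N (x m - x n) < ε) :
    ∃ y, N y < ∞ ∧ Tendsto (fun n => N (x n - y)) atTop (𝓝 0) := by
  have hpos : ∀ j : ℕ, 0 < (2⁻¹ : ℝ≥0∞) ^ j := fun j => ENNReal.pow_pos (by norm_num) j
  choose K hK using fun j : ℕ => hcau (2⁻¹ ^ j) (hpos j)
  -- Partial sums of `K` are monotone and dominate `K j`.
  let φ : ℕ → ℕ := fun j => ∑ i ∈ Finset.range (j + 1), K i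
  have hφK : ∀ j, K j ≤ φ j := fun j =>
    Finset.single_le_sum (f := K) (fun i _ => Nat.zero_le _) (by simp)
  have hφ : ∀ j, φ j ≤ φ (j + 1) := fun j => by
    simp only [φ, Finset.sum_range_succ _ (j + 1)]; omega
  let w : ℕ → Ω →ₘ[μ] ℝ := fun j => x (φ (j + 1)) - x (φ j)
  have hw : ∀ j, N (w j) ≤ 2⁻¹ ^ j := fun j =>
    (hK j _ ((hφK j).trans (hφ j)) _ (hφK j)).le
  -- The geometric bound has the constant `2`; the constant `4` leaves room for the strict
  -- inequality in `RieszFischer`.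
  have htail : ∀ n, ∑' i, N (w (i + n)) < 2⁻¹ ^ n * 4 := fun n => by
    calc ∑' i, N (w (i + n)) ≤ ∑' i, (2⁻¹ : ℝ≥0∞) ^ n * 2⁻¹ ^ i :=
          ENNReal.tsum_le_tsum fun i => (hw _).trans (by rw [pow_add, mul_comm])
      _ = 2⁻¹ ^ n * 2 := by
        rw [ENNReal.tsum_mul_left, ENNReal.tsum_geometric]
        congr 1
        rw [ENNReal.one_sub_inv_two, inv_inv]
      _ < 2⁻¹ ^ n * 4 := by
        gcongr
        · exact (hpos n).ne'
        · exact ENNReal.pow_ne_top (by norm_num)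
        · norm_num
  choose g hg hgN using fun n => hR (fun i => w (i + n)) _ (htail n)
  have hdiff : ∀ n m, x (φ (m + n)) - x (φ n) = ∑ i ∈ Finset.range m, w (i + n) := by
    intro n m
    have := Finset.sum_range_sub (fun i => x (φ (i + n))) m
    simp only [zero_add] at this
    rw [← this]
    refine Finset.sum_congr rfl fun i _ => ?_
    simp only [w]
    congr 3; ring
  have hbd : ∀ n m, |x (φ (m + n)) - x (φ n)| ≤ g n := fun n m => by
    rw [hdiff]
    exact (Finset.le_sum_of_subadditive (fun z : Ω →ₘ[μ] ℝ => |z|) abs_zero.le abs_add_le _ _).trans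
      (hg n m)
  have hae1 : ∀ᵐ ω ∂μ, ∀ n m, |x (φ (m + n)) ω - x (φ n) ω| ≤ g n ω := by
    rw [ae_all_iff]; intro n
    rw [ae_all_iff]; intro m
    filter_upwards [AEEqFun.coeFn_le.2 (hbd n m), AEEqFun.coeFn_abs (x (φ (m + n)) - x (φ n)),
      AEEqFun.coeFn_sub (x (φ (m + n))) (x (φ n))] with ω h1 h2 h3
    rw [h2, h3] at h1
    exact h1
  have hae2 : ∀ᵐ ω ∂μ, ∀ n, ∑ i ∈ Finset.range n, |w i ω| ≤ g 0 ω := by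
    rw [ae_all_iff]; intro n
    have h4 : ∀ᵐ ω ∂μ, ∀ i, |w i| ω = |w i ω| := ae_all_iff.2 fun i => AEEqFun.coeFn_abs (w i)
    have h5 : ∀ n, ((∑ i ∈ Finset.range n, |w i| : Ω →ₘ[μ] ℝ)) =ᵐ[μ]
        fun ω => ∑ i ∈ Finset.range n, |w i| ω := by
      intro n
      induction n with
      | zero =>
        simp only [Finset.range_zero, Finset.sum_empty]
        exact AEEqFun.coeFn_zero
      | succ n ih =>
        simp only [Finset.sum_range_succ]
        filter_upwards [ih, AEEqFun.coeFn_add (∑ i ∈ Finset.range n, |w i|) |w n|] with ω h1 h2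
        rw [h2, Pi.add_apply, h1]
    filter_upwards [AEEqFun.coeFn_le.2 (hg 0 n), h4, h5 n] with ω h1 h2 h3
    simp only [add_zero] at h1
    rw [h3] at h1
    simpa only [h2] using h1
  have hae3 : ∀ᵐ ω ∂μ, ∀ j, w j ω = x (φ (j + 1)) ω - x (φ j) ω :=
    ae_all_iff.2 fun j => AEEqFun.coeFn_sub _ _
  have hconv : ∀ᵐ ω ∂μ, ∃ l, Tendsto (fun j => x (φ j) ω) atTop (𝓝 l) := by
    filter_upwards [hae2, hae3] with ω h1 h2
    have hs : Summable fun j => w j ω :=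
      (summable_of_sum_range_le (fun i => abs_nonneg (w i ω)) h1).of_abs
    refine ⟨∑' j, w j ω + x (φ 0) ω, ?_⟩
    refine (hs.hasSum.tendsto_sum_nat.add_const (x (φ 0) ω)).congr fun n => ?_
    simp only [h2]
    rw [Finset.sum_range_sub (fun j => x (φ j) ω), sub_add_cancel]
  obtain ⟨f, hf, hlim⟩ := exists_stronglyMeasurable_limit_of_tendsto_ae
    (fun j => (x (φ j)).aestronglyMeasurable) hconv
  let y : Ω →ₘ[μ] ℝ := AEEqFun.mk f hf.aestronglyMeasurable
  have hy : ∀ n, N (x (φ n) - y) ≤ 2⁻¹ ^ n * 4 := by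
    intro n
    refine le_trans (hN.mono _ (g n) (abs_le_abs_iff_ae.2 ?_)) (hgN n)
    filter_upwards [hae1, hlim, AEEqFun.coeFn_sub (x (φ n)) y,
      AEEqFun.coeFn_mk f hf.aestronglyMeasurable] with ω h1 h2 h3 h4
    rw [h3, Pi.sub_apply, h4, abs_sub_comm]
    refine le_trans ?_ (le_abs_self _)
    refine le_of_tendsto (((h2.comp (tendsto_add_atTop_nat n)).sub_const (x (φ n) ω)).abs)
      (Eventually.of_forall fun m => h1 n m)
  refine ⟨y, ?_, ?_⟩
  · calc N y = N (x (φ 0) - (x (φ 0) - y)) := by rw [sub_sub_cancel]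
      _ ≤ N (x (φ 0)) + N (x (φ 0) - y) := by
        rw [← hN.map_neg (x (φ 0) - y), sub_eq_add_neg]; exact hN.add_le _ _
      _ < ∞ := ENNReal.add_lt_top.2 ⟨hx _, (hy 0).trans_lt (by norm_num)⟩
  · rw [ENNReal.tendsto_atTop_zero]
    intro ε hε
    have hlim2 : Tendsto (fun j : ℕ => (2⁻¹ : ℝ≥0∞) ^ j + 2⁻¹ ^ j * 4) atTop (𝓝 0) := by
      have h1 : Tendsto (fun j : ℕ => (2⁻¹ : ℝ≥0∞) ^ j) atTop (𝓝 0) :=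
        ENNReal.tendsto_pow_atTop_nhds_zero_of_lt_one (by norm_num)
      simpa using h1.add (ENNReal.Tendsto.mul_const h1 (Or.inr (by norm_num)))
    obtain ⟨j, hj⟩ := (hlim2.eventually (gt_mem_nhds hε)).exists
    refine ⟨K j, fun n hn => (hN.sub_le _ (x (φ j)) _).trans (le_trans ?_ hj.le)⟩
    exact add_le_add (hK j _ hn _ (hφK j)).le (hy j)

end IsIdealNorm

theorem IsBanachIdealNorm.isIdealNorm (hN : IsBanachIdealNorm N) : IsIdealNorm N :=
  ⟨hN.eq_zero_iff, hN.smul, hN.add_le, hN.mono⟩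

theorem IsBanachIdealNorm.rieszFischer (hN : IsBanachIdealNorm N) : RieszFischer N :=
  hN.isIdealNorm.rieszFischer hN.complete

theorem IsIdealNorm.isBanachIdealNorm (hN : IsIdealNorm N) (hR : RieszFischer N) :
    IsBanachIdealNorm N :=
  ⟨hN.eq_zero_iff, hN.smul, hN.add_le, hN.mono, hN.complete_of_rieszFischer hR⟩

/-- Norm smallness of the `u n` forces `u n → 0` almost everywhere at the rate `1 / (n + 1)`, since
the elements `(n + 1) • u n` are still absolutely summable and so have a common majorant. -/
theorem IsIdealNorm.exists_bound (hN : IsIdealNorm N) (hR : RieszFischer N)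
    {u : ℕ → Ω →ₘ[μ] ℝ} (hu : ∀ n : ℕ, N (u n) ≤ 2⁻¹ ^ n / (n + 1)) :
    ∃ g : Ω →ₘ[μ] ℝ, ∀ n : ℕ, ∀ᵐ ω ∂μ, (n + 1) * |u n ω| ≤ g ω := by
  have hw : ∀ n : ℕ, N ((n + 1 : ℝ) • u n) ≤ 2⁻¹ ^ n := fun n => by
    rw [hN.smul]
    calc ‖(n + 1 : ℝ)‖ₑ * N (u n) ≤ (n + 1) * (2⁻¹ ^ n / (n + 1)) := by
          gcongr
          · rw [Real.enorm_eq_ofReal (by positivity)]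
            refine le_of_eq ?_
            rw [ENNReal.ofReal_add (by positivity) (by positivity)]; simp
          · exact hu n
      _ = 2⁻¹ ^ n := ENNReal.mul_div_cancel (by simp) (by simp)
  obtain ⟨g, hg, -⟩ := hR (fun n : ℕ => (n + 1 : ℝ) • u n) ∞ (by
    refine (ENNReal.tsum_le_tsum hw).trans_lt ?_
    rw [ENNReal.tsum_geometric, ENNReal.one_sub_inv_two]
    simp)
  refine ⟨g, fun n => ?_⟩
  have h1 : |(n + 1 : ℝ) • u n| ≤ g :=
    (Finset.single_le_sum (f := fun i : ℕ => |(i + 1 : ℝ) • u i|) (fun i _ => abs_nonneg _)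
      (Finset.self_mem_range_succ n)).trans (hg (n + 1))
  filter_upwards [AEEqFun.coeFn_le.2 h1, AEEqFun.coeFn_abs ((n + 1 : ℝ) • u n),
    AEEqFun.coeFn_smul (n + 1 : ℝ) (u n)] with ω h2 h3 h4
  rw [h3, h4, Pi.smul_apply, smul_eq_mul, abs_mul, abs_of_pos (by positivity)] at h2
  exact h2

/-- An element which is a sum of an arbitrarily small element of `E` and one of `F` vanishes. -/
theorem eq_zero_of_small_decomposition (hN : IsIdealNorm N) (hR : RieszFischer N)
    (hM : IsIdealNorm M) (hR' : RieszFischer M) {x : Ω →ₘ[μ] ℝ}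
    (h : ∀ ε : ℝ≥0∞, 0 < ε → ∃ u v, u + v = x ∧ N u + M v < ε) : x = 0 := by
  choose u v huv hlt using fun n : ℕ => h (2⁻¹ ^ n / (n + 1))
    (ENNReal.div_pos (ENNReal.pow_pos (by norm_num) n).ne' (by simp))
  obtain ⟨g, hg⟩ := hN.exists_bound hR fun n => le_self_add.trans (hlt n).le
  obtain ⟨k, hk⟩ := hM.exists_bound hR' fun n => le_add_self.trans (hlt n).le
  refine AEEqFun.ext ?_
  filter_upwards [ae_all_iff.2 hg, ae_all_iff.2 hk, AEEqFun.coeFn_zero (β := ℝ) (μ := μ),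
    ae_all_iff.2 fun n => AEEqFun.coeFn_add (u n) (v n)] with ω h1 h2 h3 h4
  rw [h3, Pi.zero_apply]
  by_contra hne
  -- Here `(n + 1) |x ω| ≤ g ω + k ω` for all `n`, which fails for large `n` unless `x ω = 0`.
  obtain ⟨n, hn⟩ := exists_nat_gt ((g ω + k ω) / |x ω|)
  rw [div_lt_iff₀ (abs_pos.2 hne)] at hn
  have h5 := h4 n
  rw [huv n] at h5
  have h6 : |x ω| ≤ |u n ω| + |v n ω| := by rw [h5]; exact abs_add_le _ _
  nlinarith [h1 n, h2 n, abs_nonneg (x ω), abs_nonneg (u n ω), abs_nonneg (v n ω)]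

end Ideal

/-! ### Indicators, symmetry and maximal width -/

section Indicator

variable {Ω : Type u} [MeasurableSpace Ω] {μ : Measure Ω}
variable {Ω' : Type v} [MeasurableSpace Ω'] {ν : Measure Ω'}

/-- The class of the indicator function of a measurable set. -/
noncomputable def chi (μ : Measure Ω) {e : Set Ω} (he : MeasurableSet e) : Ω →ₘ[μ] ℝ :=
  AEEqFun.mk (e.indicator 1) (measurable_one.indicator he).aestronglyMeasurable

theorem coeFn_chi {e : Set Ω} (he : MeasurableSet e) : chi μ he =ᵐ[μ] e.indicator 1 :=
  AEEqFun.coeFn_mk _ _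

theorem chi_nonneg {e : Set Ω} (he : MeasurableSet e) : 0 ≤ chi μ he := by
  rw [← AEEqFun.coeFn_le]
  filter_upwards [coeFn_chi (μ := μ) he, AEEqFun.coeFn_zero (β := ℝ) (μ := μ)] with ω h1 h2
  rw [h1, h2]
  exact Set.indicator_nonneg (fun _ _ => zero_le_one) ω

theorem distrib_chi {e : Set Ω} (he : MeasurableSet e) (s : ℝ≥0) :
    distrib (chi μ he) s = if s < 1 then μ e else 0 := by
  rw [distrib_eq_of_ae (coeFn_chi he)]
  have h1 : ∀ ω, |e.indicator (1 : Ω → ℝ) ω| = e.indicator 1 ω := fun ω =>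
    abs_of_nonneg (Set.indicator_nonneg (fun _ _ => zero_le_one) ω)
  simp only [h1]
  have hs0 : ¬ (s : ℝ) < 0 := not_lt.2 s.2
  split_ifs with hs
  · congr 1
    ext ω
    have hs' : (s : ℝ) < 1 := by exact_mod_cast hs
    by_cases hω : ω ∈ e <;> simp [hω, hs', hs0]
  · convert measure_empty (μ := μ)
    ext ω
    have hs' : ¬ (s : ℝ) < 1 := by exact_mod_cast hs
    by_cases hω : ω ∈ e <;> simp [hω, hs', hs0]

theorem smul_nonneg_ae {c : ℝ} (hc : 0 ≤ c) {x : Ω →ₘ[μ] ℝ} (hx : 0 ≤ x) : 0 ≤ c • x := by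
  rw [← AEEqFun.coeFn_le] at hx ⊢
  filter_upwards [hx, AEEqFun.coeFn_smul c x, AEEqFun.coeFn_zero (β := ℝ) (μ := μ)] with ω h1 h2 h3
  rw [h3] at h1 ⊢
  rw [h2]
  exact mul_nonneg hc h1

theorem chi_mono {e e' : Set Ω} (he : MeasurableSet e) (he' : MeasurableSet e') (h : e ⊆ e') :
    chi μ he ≤ chi μ he' := by
  rw [← AEEqFun.coeFn_le]
  filter_upwards [coeFn_chi (μ := μ) he, coeFn_chi (μ := μ) he'] with ω h1 h2
  rw [h1, h2]
  exact Set.indicator_le_indicator_of_subset h (fun _ => zero_le_one) ω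

theorem eq_zero_iff_distrib {x : Ω →ₘ[μ] ℝ} : x = 0 ↔ distrib x 0 = 0 := by
  have h : distrib x 0 = μ {ω | ¬ x ω = 0} := by simp [distrib]
  rw [h]
  constructor
  · rintro rfl
    exact AEEqFun.coeFn_zero (β := ℝ) (μ := μ)
  · intro h
    refine AEEqFun.ext (EventuallyEq.trans ?_ AEEqFun.coeFn_zero.symm)
    exact h

theorem HasUnits.exists_finite (hu : HasUnits μ) {A : Set Ω} (hA : MeasurableSet A)
    (h0 : μ A ≠ 0) : ∃ e ⊆ A, MeasurableSet e ∧ μ e ≠ 0 ∧ μ e < ∞ := by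
  rcases (le_top : μ A ≤ ∞).lt_or_eq with hlt | htop
  · exact ⟨A, subset_rfl, hA, h0, hlt⟩
  · obtain ⟨C, h1, h2, h3⟩ := hu A hA htop
    exact ⟨C, h1, h2, by simp [h3], by simp [h3]⟩

/-- As the levels decrease to `0`, the measures of the level sets tend to that of the support, so
some level set has positive measure; `HasUnits` supplies a part of finite positive measure. -/
theorem HasUnits.exists_chi_le (hu : HasUnits μ) {x : Ω →ₘ[μ] ℝ} (hx : x ≠ 0) :
    ∃ (η : ℝ) (e : Set Ω) (he : MeasurableSet e), 0 < η ∧ μ e ≠ 0 ∧ μ e < ∞ ∧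
      η • chi μ he ≤ |x| := by
  have h0 : distrib x 0 ≠ 0 := fun h => hx (eq_zero_iff_distrib.2 h)
  obtain ⟨v, hv, hvs, hlim⟩ := exists_seq_strictAnti_tendsto (0 : ℝ)
  have h1 := tendsto_measure_lt (μ := μ) (f := fun ω => |x ω|) hv.antitone hvs hlim
  obtain ⟨n, hn⟩ := (h1.eventually (lt_mem_nhds (pos_iff_ne_zero.2 h0))).exists
  obtain ⟨e, he1, he2, he3, he4⟩ := hu.exists_finite
    (measurableSet_lt measurable_const x.measurable.abs) hn.ne'
  refine ⟨v n, e, he2, hvs n, he3, he4, ?_⟩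
  rw [← AEEqFun.coeFn_le]
  filter_upwards [coeFn_chi (μ := μ) he2, AEEqFun.coeFn_smul (v n) (chi μ he2),
    AEEqFun.coeFn_abs x] with ω h1 h2 h3
  rw [h2, h3, Pi.smul_apply, h1]
  by_cases hω : ω ∈ e
  · simpa [hω] using (show v n < |x ω| from he1 hω).le
  · simp [hω]

/-- Equimeasurable elements have the same norms. -/
def Related (N : (Ω →ₘ[μ] ℝ) → ℝ≥0∞) (M : (Ω' →ₘ[ν] ℝ) → ℝ≥0∞) : Prop :=
  ∀ x y, (∀ s, distrib x s = distrib y s) → N x = M y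

variable {N N' : (Ω →ₘ[μ] ℝ) → ℝ≥0∞} {M M' : (Ω' →ₘ[ν] ℝ) → ℝ≥0∞}

/-- Equimeasurability is symmetric, so the equality of norms extends to elements of infinite norm.
-/
theorem isSymmetricNorm_iff : IsSymmetricNorm N ↔ Related N N := by
  constructor
  · intro h x y hxy
    by_cases hx : N x < ∞
    · exact (h x y hx fun s => (hxy s).symm).symm
    · by_cases hy : N y < ∞
      · exact h y x hy hxy
      · rw [not_lt_top_iff.1 hx, not_lt_top_iff.1 hy]
  · exact fun h x y _ hxy => (h x y fun s => (hxy s).symm).symm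

theorem Related.symm (h : Related N M) : Related M N := fun x y hxy =>
  (h y x fun s => (hxy s).symm).symm

theorem Related.map_chi (h : Related N M) {e : Set Ω} {e' : Set Ω'} (he : MeasurableSet e)
    (he' : MeasurableSet e') (hee : μ e = ν e') : N (chi μ he) = M (chi ν he') :=
  h _ _ fun s => by rw [distrib_chi, distrib_chi, hee]

theorem isMaximalWidth_of_chi (hu : HasUnits μ)
    (h : ∀ (e : Set Ω) (he : MeasurableSet e), μ e < ∞ → N (chi μ he) < ∞) : IsMaximalWidth N := by
  intro z hz
  by_contra hne
  obtain ⟨η, e, he, hη, he0, hef, hle⟩ := hu.exists_chi_le hne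
  have h1 := hz _ (h e he hef)
  have h2 : ∀ᵐ ω ∂μ, ω ∉ e := by
    filter_upwards [AEEqFun.coeFn_le.2 hle, AEEqFun.coeFn_mul z (chi μ he),
      coeFn_chi (μ := μ) he, AEEqFun.coeFn_smul η (chi μ he), AEEqFun.coeFn_abs z,
      AEEqFun.coeFn_zero (β := ℝ) (μ := μ)] with ω h2 h3 h4 h5 h6 h7 hω
    rw [h1, h7, Pi.mul_apply, h4] at h3
    rw [h5, Pi.smul_apply, h4, h6] at h2
    simp only [Set.indicator_of_mem hω, Pi.one_apply, Pi.zero_apply, mul_one, smul_eq_mul] at h2 h3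
    rw [← h3, abs_zero] at h2
    exact absurd h2 (not_le.2 hη)
  exact he0 (by simpa [ae_iff] using h2)

/-- One nonzero element dominates a multiple of some `chi μ hA`. A set of measure at most `μ A` has
an equimeasurable copy inside `A`, and a set of finite measure is a finite union of such sets. Hence
one nonzero element already gives maximal width. -/
theorem IsIdealNorm.chi_lt_top (hN : IsIdealNorm N) (hS : Related N N) (hu : HasUnits μ)
    (hc : Cuts μ μ) (hx : ∃ x, x ≠ 0 ∧ N x < ∞) (e : Set Ω) (he : MeasurableSet e)
    (hef : μ e < ∞) : N (chi μ he) < ∞ := by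
  obtain ⟨x, hx0, hxN⟩ := hx
  obtain ⟨η, A, hA, hη, hA0, hAf, hle⟩ := hu.exists_chi_le hx0
  have hNA : N (chi μ hA) < ∞ := by
    have h1 : N (η • chi μ hA) < ∞ := by
      refine lt_of_le_of_lt (hN.mono_of_nonneg (smul_nonneg_ae hη.le (chi_nonneg hA)) hle) ?_
      rwa [hN.map_abs]
    rw [hN.smul] at h1
    exact ENNReal.lt_top_of_mul_ne_top_right h1.ne (by simpa using hη.ne')
  have key : ∀ n : ℕ, ∀ (e : Set Ω) (he : MeasurableSet e), μ e ≤ n * μ A → N (chi μ he) < ∞ := by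
    intro n
    induction n with
    | zero =>
      intro e he h
      have h0 : μ e = 0 := by simpa using h
      have : chi μ he = 0 := eq_zero_iff_distrib.2 (by rw [distrib_chi]; simp [h0])
      rw [this, hN.map_zero]
      exact ENNReal.zero_lt_top
    | succ n ih =>
      intro e he h
      have small : ∀ (d : Set Ω) (hd : MeasurableSet d), μ d ≤ μ A → N (chi μ hd) < ∞ := by
        intro d hd hdA
        obtain ⟨C, hCA, hC, hCd⟩ := hc d hd (hdA.trans_lt hAf) A hA hdA
        rw [hS.map_chi hd hC hCd.symm]
        exact (hN.mono_of_nonneg (chi_nonneg hC) (chi_mono hC hA hCA)).trans_lt hNA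
      rcases le_total (μ e) (μ A) with hle | hle
      · exact small e he hle
      · obtain ⟨C, hCe, hC, hCA⟩ := hc A hA hAf e he hle
        have hd : μ (e \ C) ≤ n * μ A := by
          rw [measure_sdiff hCe hC.nullMeasurableSet (hCA ▸ hAf.ne), hCA]
          refine tsub_le_iff_right.2 (h.trans (le_of_eq ?_))
          push_cast; ring
        have hsum : chi μ he = chi μ hC + chi μ (he.diff hC) := by
          refine AEEqFun.ext ?_
          filter_upwards [coeFn_chi (μ := μ) he, coeFn_chi (μ := μ) hC,
            coeFn_chi (μ := μ) (he.diff hC), AEEqFun.coeFn_add (chi μ hC) (chi μ (he.diff hC))]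
            with ω h1 h2 h3 h4
          rw [h4, Pi.add_apply, h1, h2, h3]
          by_cases hω : ω ∈ C
          · simp [hω, hCe hω]
          · by_cases hω' : ω ∈ e <;> simp [hω, hω']
        rw [hsum]
        exact (hN.add_le _ _).trans_lt (ENNReal.add_lt_top.2 ⟨small C hC hCA.le, ih _ _ hd⟩)
  obtain ⟨n, hn⟩ := ENNReal.exists_nat_mul_gt hA0 hef.ne
  exact key n e he hn.le

/-- If the space were trivial, the constant `1` would be disjoint from it. -/
theorem exists_ne_zero_of_isMaximalWidth (hμ : μ Set.univ ≠ 0) (h : IsMaximalWidth N) :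
    ∃ x, x ≠ 0 ∧ N x < ∞ := by
  by_contra! hcon
  have h1 : (1 : Ω →ₘ[μ] ℝ) = 0 := h 1 fun y hy => by
    rw [one_mul]
    by_contra hne
    exact (hcon y hne).not_gt hy
  refine hμ ?_
  have h2 : ∀ᵐ ω ∂μ, (1 : ℝ) = 0 := by
    filter_upwards [AEEqFun.coeFn_one (β := ℝ) (μ := μ), AEEqFun.coeFn_zero (β := ℝ) (μ := μ)]
      with ω h3 h4
    rw [h1, h4] at h3
    exact h3.symm
  simpa [ae_iff] using h2

theorem isNormed_iff : IsNormed N ↔ ∀ (e : Set Ω) (he : MeasurableSet e), μ e = 1 →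
    N (chi μ he) = 1 := by
  constructor
  · exact fun h e he h1 => h e he h1 _ (coeFn_chi he)
  · intro h e he h1 x hx
    rw [show x = chi μ he from AEEqFun.ext (hx.trans (coeFn_chi he).symm)]
    exact h e he h1

end Indicator

/-! ### Transfer of norm axioms between related norms -/

section Related

variable {Ω : Type u} [MeasurableSpace Ω] {μ : Measure Ω}
variable {Ω' : Type v} [MeasurableSpace Ω'] {ν : Measure Ω'}
variable {N N' : (Ω →ₘ[μ] ℝ) → ℝ≥0∞} {M M' : (Ω' →ₘ[ν] ℝ) → ℝ≥0∞}

theorem Related.transfer (hR : Related N M) (h : Compatible ν μ) {X : Type*} [MeasurableSpace X]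
    [StandardBorelSpace X] (x₀ : X) {F : Ω' → X} (hF : Measurable F) {ι κ : Type*} [Countable ι]
    [Countable κ] {H : ι → X → ℝ} (hH : ∀ i, Measurable (H i)) (hH0 : ∀ i, H i x₀ = 0)
    {S : κ → Set X} (hS : ∀ k, MeasurableSet (S k)) (hS0 : ∀ k, x₀ ∉ S k) :
    ∃ G : Ω → X, Measurable G ∧
      (∀ i (x : Ω →ₘ[μ] ℝ) (y : Ω' →ₘ[ν] ℝ), x =ᵐ[μ] H i ∘ G → y =ᵐ[ν] H i ∘ F → N x = M y) ∧
      ∀ k, μ (G ⁻¹' S k) = ν (F ⁻¹' S k) := by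
  obtain ⟨G, hG, hd, hm⟩ := h.transfer_fun x₀ hF hH hH0 hS hS0
  refine ⟨G, hG, fun i x y hx hy => hR x y fun s => ?_, hm⟩
  rw [distrib_eq_of_ae hx, distrib_eq_of_ae hy]
  exact hd i s

theorem Compatible.exists_equimeasurable (h : Compatible μ ν) (x : Ω →ₘ[μ] ℝ) :
    ∃ y : Ω' →ₘ[ν] ℝ, ∀ s, distrib x s = distrib y s := by
  obtain ⟨G, hG, hd, -⟩ := h.transfer_fun (ι := Unit) (κ := Empty) (0 : ℝ) x.measurable
    (H := fun _ => id) (fun _ => measurable_id) (fun _ => rfl) (S := fun _ => ∅)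
    (fun _ => .empty) (fun _ => id)
  exact ⟨AEEqFun.mk G hG.aestronglyMeasurable, fun s => by
    rw [distrib_mk]; exact (hd () s).symm⟩

/-- Each axiom concerns at most two functions over `ν`. They are copied jointly to `μ` together with
the derived functions whose norms occur, the axiom is applied there, and relatedness returns the
norms. -/
theorem Related.isIdealNorm (hR : Related N M) (h : Compatible ν μ) (hN : IsIdealNorm N) :
    IsIdealNorm M where
  eq_zero_iff y := by
    obtain ⟨x, hx⟩ := h.exists_equimeasurable y
    rw [← hR x y fun s => (hx s).symm, hN.eq_zero_iff, eq_zero_iff_distrib, ← hx,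
      ← eq_zero_iff_distrib]
  smul c y := by
    obtain ⟨G, hG, hd, -⟩ := hR.transfer h (ι := Bool) (κ := Empty) (0 : ℝ) y.measurable
      (H := fun b t => if b then c * t else t) (fun b => by cases b <;> simp <;> fun_prop)
      (fun b => by simp) (S := fun _ => ∅) (fun _ => .empty) (fun _ => id)
    let x : Ω →ₘ[μ] ℝ := AEEqFun.mk G hG.aestronglyMeasurable
    have hx : x =ᵐ[μ] G := AEEqFun.coeFn_mk _ _
    rw [← hd false x y hx (ae_of_all _ fun _ => rfl), ← hd true (c • x) (c • y) ?_ ?_, hN.smul]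
    · filter_upwards [AEEqFun.coeFn_smul c x, hx] with ω h1 h2
      simp [h1, h2]
    · filter_upwards [AEEqFun.coeFn_smul c y] with ω h1
      simp [h1]
  add_le y y' := by
    obtain ⟨G, hG, hd, -⟩ := hR.transfer h (κ := Empty) (0 : ℝ × ℝ)
      (F := fun ω => (y ω, y' ω)) (y.measurable.prodMk y'.measurable)
      (H := fun (b : Fin 3) p => if b = 0 then p.1 else if b = 1 then p.2 else p.1 + p.2)
      (fun b => by split_ifs <;> fun_prop)
      (fun b => by simp) (S := fun _ => ∅) (fun _ => .empty) (fun _ => id)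
    let x : Ω →ₘ[μ] ℝ := AEEqFun.mk (fun ω => (G ω).1) hG.fst.aestronglyMeasurable
    let x' : Ω →ₘ[μ] ℝ := AEEqFun.mk (fun ω => (G ω).2) hG.snd.aestronglyMeasurable
    have hx : x =ᵐ[μ] fun ω => (G ω).1 := AEEqFun.coeFn_mk _ _
    have hx' : x' =ᵐ[μ] fun ω => (G ω).2 := AEEqFun.coeFn_mk _ _
    rw [← hd 0 x y hx (ae_of_all _ fun _ => rfl), ← hd 1 x' y' hx' (ae_of_all _ fun _ => rfl),
      ← hd 2 (x + x') (y + y') ?_ ?_]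
    · exact hN.add_le _ _
    · filter_upwards [AEEqFun.coeFn_add x x', hx, hx'] with ω h1 h2 h3
      simp [h1, h2, h3]
    · filter_upwards [AEEqFun.coeFn_add y y'] with ω h1
      simp [h1]
  mono y y' hyy := by
    -- Copying the event `|p.2| < |p.1|`, a null set over `ν`, preserves the order almost
    -- everywhere; the base point `0` lies outside it.
    obtain ⟨G, hG, hd, hm⟩ := hR.transfer h (κ := Unit) (0 : ℝ × ℝ)
      (F := fun ω => (y ω, y' ω)) (y.measurable.prodMk y'.measurable)
      (H := fun (b : Bool) p => if b then p.1 else p.2)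
      (fun b => by split_ifs <;> fun_prop)
      (fun b => by simp) (S := fun _ => {p | |p.2| < |p.1|})
      (fun _ => measurableSet_lt (by fun_prop) (by fun_prop)) (fun _ => by simp)
    let x : Ω →ₘ[μ] ℝ := AEEqFun.mk (fun ω => (G ω).1) hG.fst.aestronglyMeasurable
    let x' : Ω →ₘ[μ] ℝ := AEEqFun.mk (fun ω => (G ω).2) hG.snd.aestronglyMeasurable
    have hx : x =ᵐ[μ] fun ω => (G ω).1 := AEEqFun.coeFn_mk _ _
    have hx' : x' =ᵐ[μ] fun ω => (G ω).2 := AEEqFun.coeFn_mk _ _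
    rw [← hd true x y hx (ae_of_all _ fun _ => rfl), ← hd false x' y' hx' (ae_of_all _ fun _ => rfl)]
    refine hN.mono _ _ (abs_le_abs_iff_ae.2 ?_)
    have h1 : ∀ᵐ ω ∂ν, ¬ |y' ω| < |y ω| := by simpa using abs_le_abs_iff_ae.1 hyy
    have h2 := hm ()
    rw [show ν _ = 0 from by simpa [ae_iff] using h1] at h2
    have h3 : ∀ᵐ ω ∂μ, ¬ |(G ω).2| < |(G ω).1| := by simpa [ae_iff] using h2
    filter_upwards [hx, hx', h3] with ω h4 h5 h6
    rw [h4, h5]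
    exact not_lt.1 h6

theorem coeFn_sum_abs (w : ℕ → Ω →ₘ[μ] ℝ) : ∀ᵐ ω ∂μ, ∀ n,
    (∑ i ∈ Finset.range n, |w i| : Ω →ₘ[μ] ℝ) ω = ∑ i ∈ Finset.range n, |w i ω| := by
  rw [ae_all_iff]
  intro n
  induction n with
  | zero =>
    simp only [Finset.range_zero, Finset.sum_empty]
    exact AEEqFun.coeFn_zero
  | succ n ih =>
    simp only [Finset.sum_range_succ]
    filter_upwards [ih, AEEqFun.coeFn_add (∑ i ∈ Finset.range n, |w i|) |w n|,
      AEEqFun.coeFn_abs (w n)] with ω h1 h2 h3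
    rw [h2, Pi.add_apply, h1, h3]

theorem sum_abs_le_iff {w : ℕ → Ω →ₘ[μ] ℝ} {g : Ω →ₘ[μ] ℝ} :
    (∀ n, ∑ i ∈ Finset.range n, |w i| ≤ g) ↔
      ∀ᵐ ω ∂μ, ∑' i, ‖w i ω‖ₑ ≤ ENNReal.ofReal (g ω) ∧ 0 ≤ g ω := by
  have hE : ∀ ω n, ∑ i ∈ Finset.range n, ‖w i ω‖ₑ =
      ENNReal.ofReal (∑ i ∈ Finset.range n, |w i ω|) := fun ω n => by
    rw [ENNReal.ofReal_sum_of_nonneg fun i _ => abs_nonneg _]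
    simp only [Real.enorm_eq_ofReal_abs]
  constructor
  · intro h
    filter_upwards [ae_all_iff.2 fun n => AEEqFun.coeFn_le.2 (h n), coeFn_sum_abs w] with ω h1 h2
    have h0 : 0 ≤ g ω := by
      have := h1 0
      rwa [h2, Finset.sum_range_zero] at this
    refine ⟨?_, h0⟩
    rw [ENNReal.tsum_eq_iSup_nat]
    refine iSup_le fun n => ?_
    rw [hE, ← h2]
    exact ENNReal.ofReal_le_ofReal (h1 n)
  · intro h n
    rw [← AEEqFun.coeFn_le]
    filter_upwards [h, coeFn_sum_abs w] with ω h1 h2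
    rw [h2]
    refine (ENNReal.ofReal_le_ofReal_iff h1.2).1 ?_
    rw [← hE]
    exact (ENNReal.sum_le_tsum _).trans h1.1

/-- The whole sequence is copied as one map into `ℕ → ℝ`. The majorant over `μ` need not be a
function of the sequence, so it cannot be carried back; it is replaced by the sum of the series,
which is smaller and has an equimeasurable counterpart. -/
theorem Related.rieszFischer (hR : Related N M) (h : Compatible ν μ) (hN : IsIdealNorm N)
    (hRF : RieszFischer N) : RieszFischer M := by
  intro w c hw
  have htm : Measurable fun a : ℕ → ℝ => ∑' i, ‖a i‖ₑ :=
    Measurable.tsum fun i => (measurable_pi_apply i).enorm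
  let H : Option ℕ → (ℕ → ℝ) → ℝ := fun o a => o.elim (∑' i, ‖a i‖ₑ).toReal a
  have hH : ∀ o, Measurable (H o) := by
    rintro (_ | n)
    · exact htm.ennreal_toReal
    · exact measurable_pi_apply n
  -- The event that the series diverges is copied too: it is null over `μ` because of the majorant,
  -- hence null over `ν`, so the default value of `toReal` at `∞` does no harm.
  obtain ⟨G, hG, hd, hm⟩ := hR.transfer h (κ := Unit) (0 : ℕ → ℝ) (F := fun ω n => w n ω)
    (measurable_pi_lambda _ fun n => (w n).measurable) hH
    (by rintro (_ | n) <;> simp [H])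
    (S := fun _ => {a | ∑' i, ‖a i‖ₑ = ∞}) (fun _ => htm (measurableSet_singleton ∞))
    (fun _ => by simp)
  let x : ℕ → Ω →ₘ[μ] ℝ := fun n => AEEqFun.mk (fun ω => G ω n)
    ((measurable_pi_apply n).comp hG).aestronglyMeasurable
  have hx : ∀ᵐ ω ∂μ, ∀ n, x n ω = G ω n := ae_all_iff.2 fun n => AEEqFun.coeFn_mk _ _
  have hxw : ∀ n, N (x n) = M (w n) := fun n =>
    hd (some n) (x n) (w n) (AEEqFun.coeFn_mk _ _) (ae_of_all _ fun _ => rfl)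
  obtain ⟨g, hg, hgc⟩ := hRF x c (by simpa only [hxw] using hw)
  have hg' : ∀ᵐ ω ∂μ, ∑' i, ‖G ω i‖ₑ ≤ ENNReal.ofReal (g ω) ∧ 0 ≤ g ω := by
    filter_upwards [sum_abs_le_iff.1 hg, hx] with ω h1 h2
    simpa only [h2] using h1
  let k : Ω' →ₘ[ν] ℝ := AEEqFun.mk (fun ω => (∑' i, ‖w i ω‖ₑ).toReal)
    (Measurable.tsum fun i => (w i).measurable.enorm).ennreal_toReal.aestronglyMeasurable
  let k' : Ω →ₘ[μ] ℝ := AEEqFun.mk (fun ω => (∑' i, ‖G ω i‖ₑ).toReal)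
    (htm.comp hG).ennreal_toReal.aestronglyMeasurable
  have hkk : N k' = M k := hd none k' k (AEEqFun.coeFn_mk _ _) (AEEqFun.coeFn_mk _ _)
  refine ⟨k, sum_abs_le_iff.2 ?_, ?_⟩
  · have h1 : ∀ᵐ ω ∂ν, ∑' i, ‖w i ω‖ₑ ≠ ∞ := by
      have h2 := (hm ()).symm
      have h3 : ∀ᵐ ω ∂μ, ∑' i, ‖G ω i‖ₑ ≠ ∞ := hg'.mono fun ω hω =>
        (hω.1.trans_lt ENNReal.ofReal_lt_top).ne
      rw [show μ _ = 0 from by simpa [ae_iff] using h3] at h2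
      simpa [ae_iff] using h2
    filter_upwards [h1, AEEqFun.coeFn_mk (fun ω => (∑' i, ‖w i ω‖ₑ).toReal)
      (Measurable.tsum fun i =>
        (w i).measurable.enorm).ennreal_toReal.aestronglyMeasurable] with ω h2 h3
    rw [h3, ENNReal.ofReal_toReal h2]
    exact ⟨le_rfl, ENNReal.toReal_nonneg⟩
  · rw [← hkk]
    refine (hN.mono _ g (abs_le_abs_iff_ae.2 ?_)).trans hgc
    filter_upwards [hg', AEEqFun.coeFn_mk (fun ω => (∑' i, ‖G ω i‖ₑ).toReal)
      (htm.comp hG).ennreal_toReal.aestronglyMeasurable] with ω h1 h2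
    rw [h2, abs_of_nonneg ENNReal.toReal_nonneg, abs_of_nonneg h1.2]
    exact ENNReal.toReal_le_of_le_ofReal h1.2 h1.1

theorem Related.related_right (hR : Related N M) (h : Compatible ν μ) : Related M M := by
  intro y y' hyy
  obtain ⟨x, hx⟩ := h.exists_equimeasurable y
  rw [← hR x y fun s => (hx s).symm, ← hR x y' fun s => (hx s).symm.trans (hyy s)]

theorem Related.map_chi_lt_top (hR : Related N M) (h : Compatible ν μ)
    (hN : ∀ (e : Set Ω) (he : MeasurableSet e), μ e < ∞ → N (chi μ he) < ∞)
    (e : Set Ω') (he : MeasurableSet e) (hef : ν e < ∞) : M (chi ν he) < ∞ := by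
  obtain ⟨d, -, hd, hde⟩ := h.cuts e he hef Set.univ .univ
    (by rw [← h.univ]; exact measure_mono (Set.subset_univ _))
  rw [← hR.map_chi hd he hde]
  exact hN d hd (hde ▸ hef)

theorem Related.inter (hR : Related N M) (hR' : Related N' M') :
    Related (interNorm N N') (interNorm M M') := fun x y hxy => by
  simp only [interNorm, hR x y hxy, hR' x y hxy]

theorem Related.isNormed (hR : Related N M) (h : Compatible ν μ) (hN : IsNormed N) :
    IsNormed M := by
  rw [isNormed_iff] at hN ⊢
  intro e he h1
  obtain ⟨d, -, hd, hde⟩ := h.cuts e he (by simp [h1]) Set.univ .univ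
    (by rw [← h.univ]; exact measure_mono (Set.subset_univ _))
  rw [← hR.map_chi hd he hde]
  exact hN d hd (hde.trans h1)

end Related

/-! ### Intersections and sums -/

section Sum

variable {Ω : Type u} [MeasurableSpace Ω] {μ : Measure Ω}
variable {Ω' : Type v} [MeasurableSpace Ω'] {ν : Measure Ω'}
variable {N N' : (Ω →ₘ[μ] ℝ) → ℝ≥0∞} {M M' : (Ω' →ₘ[ν] ℝ) → ℝ≥0∞}

theorem IsIdealNorm.inter (hN : IsIdealNorm N) (hN' : IsIdealNorm N') :
    IsIdealNorm (interNorm N N') where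
  eq_zero_iff x := by
    simp only [interNorm, ← bot_eq_zero, max_eq_bot]
    simp only [bot_eq_zero, hN.eq_zero_iff, hN'.eq_zero_iff, and_self]
  smul c x := by simp only [interNorm, hN.smul, hN'.smul, mul_max]
  add_le x y := max_le
    ((hN.add_le x y).trans (add_le_add (le_max_left _ _) (le_max_left _ _)))
    ((hN'.add_le x y).trans (add_le_add (le_max_right _ _) (le_max_right _ _)))
  mono x y h := max_le_max (hN.mono x y h) (hN'.mono x y h)

theorem IsIdealNorm.rieszFischer_inter (hN : IsIdealNorm N) (hN' : IsIdealNorm N')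
    (hR : RieszFischer N) (hR' : RieszFischer N') : RieszFischer (interNorm N N') := by
  intro w c hw
  obtain ⟨g, hg, hgc⟩ := hR w c ((ENNReal.tsum_le_tsum fun n => le_max_left _ _).trans_lt hw)
  obtain ⟨k, hk, hkc⟩ := hR' w c ((ENNReal.tsum_le_tsum fun n => le_max_right _ _).trans_lt hw)
  have h0 : 0 ≤ g ⊓ k := le_inf (by simpa using hg 0) (by simpa using hk 0)
  exact ⟨g ⊓ k, fun n => le_inf (hg n) (hk n), max_le
    ((hN.mono_of_nonneg h0 inf_le_left).trans hgc)
    ((hN'.mono_of_nonneg h0 inf_le_right).trans hkc)⟩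

theorem sumNorm_le_of_eq {u v x : Ω →ₘ[μ] ℝ} (h : u + v = x) : sumNorm N N' x ≤ N u + N' v :=
  (iInf₂_le u v).trans (iInf_le _ h)

theorem sumNorm_lt_iff {x : Ω →ₘ[μ] ℝ} {c : ℝ≥0∞} :
    sumNorm N N' x < c ↔ ∃ u v, u + v = x ∧ N u + N' v < c := by
  simp [sumNorm, iInf_lt_iff]

/-- The Riesz decomposition property. -/
theorem exists_decomposition {x y u v : Ω →ₘ[μ] ℝ} (h : |x| ≤ |y|) (huv : u + v = y) :
    ∃ u' v' : Ω →ₘ[μ] ℝ, u' + v' = x ∧ |u'| ≤ |u| ∧ |v'| ≤ |v| := by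
  let u' : Ω →ₘ[μ] ℝ := AEEqFun.mk (fun ω => max (-|u ω|) (min |u ω| (x ω)))
    (u.measurable.abs.neg.max (u.measurable.abs.min x.measurable)).aestronglyMeasurable
  have hu' : u' =ᵐ[μ] fun ω => max (-|u ω|) (min |u ω| (x ω)) := AEEqFun.coeFn_mk _ _
  refine ⟨u', x - u', add_sub_cancel _ _, abs_le_abs_iff_ae.2 ?_, abs_le_abs_iff_ae.2 ?_⟩
  · filter_upwards [hu'] with ω h1
    rw [h1]
    have := abs_nonneg (u ω)
    exact abs_le.2 ⟨le_max_left _ _, max_le (by linarith) (min_le_left _ _)⟩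
  · filter_upwards [hu', AEEqFun.coeFn_sub x u', abs_le_abs_iff_ae.1 h,
      AEEqFun.coeFn_add u v] with ω h1 h2 h3 h4
    rw [h2, Pi.sub_apply, h1]
    rw [huv, Pi.add_apply] at h4
    have h5 : |x ω| ≤ |u ω| + |v ω| := h3.trans (h4 ▸ abs_add_le _ _)
    have h6 := abs_le.1 h5
    have h7 := abs_nonneg (u ω)
    have h8 := abs_nonneg (v ω)
    rcases le_total |u ω| (x ω) with h | h
    · rw [min_eq_left h, max_eq_right (by linarith)]
      exact abs_le.2 ⟨by linarith, by linarith⟩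
    · rw [min_eq_right h]
      rcases le_total (-|u ω|) (x ω) with h' | h'
      · rw [max_eq_right h', sub_self, abs_zero]; exact h8
      · rw [max_eq_left h']
        exact abs_le.2 ⟨by linarith, by linarith⟩

theorem IsIdealNorm.sumNorm_smul_le (hN : IsIdealNorm N) (hN' : IsIdealNorm N') {c : ℝ}
    (hc : c ≠ 0) (x : Ω →ₘ[μ] ℝ) : sumNorm N N' (c • x) ≤ ‖c‖ₑ * sumNorm N N' x := by
  simp only [sumNorm, ENNReal.mul_iInf_of_ne (enorm_ne_zero.2 hc) enorm_ne_top]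
  refine le_iInf fun u => le_iInf fun v => le_iInf fun h => ?_
  rw [mul_add, ← hN.smul, ← hN'.smul]
  exact sumNorm_le_of_eq (by rw [← smul_add, h])

/-- Definiteness is the only axiom that needs completeness (through
`eq_zero_of_small_decomposition`); monotonicity is the Riesz decomposition property. -/
theorem IsIdealNorm.sum (hN : IsIdealNorm N) (hN' : IsIdealNorm N') (hR : RieszFischer N)
    (hR' : RieszFischer N') : IsIdealNorm (sumNorm N N') := by
  have hz : sumNorm N N' 0 = 0 := le_zero_iff.1
    ((sumNorm_le_of_eq (add_zero 0)).trans (by rw [hN.map_zero, hN'.map_zero, add_zero]))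
  refine ⟨fun x => ⟨fun h => ?_, fun h => h ▸ hz⟩, fun c x => ?_, fun x y => ?_, fun x y h => ?_⟩
  · exact eq_zero_of_small_decomposition hN hR hN' hR' fun ε hε => sumNorm_lt_iff.1 (h ▸ hε)
  · rcases eq_or_ne c 0 with rfl | hc
    · simp [hz]
    · refine le_antisymm (hN.sumNorm_smul_le hN' hc x) ?_
      calc ‖c‖ₑ * sumNorm N N' x = ‖c‖ₑ * sumNorm N N' (c⁻¹ • c • x) := by
            rw [inv_smul_smul₀ hc]
        _ ≤ ‖c‖ₑ * (‖c⁻¹‖ₑ * sumNorm N N' (c • x)) := by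
            gcongr; exact hN.sumNorm_smul_le hN' (inv_ne_zero hc) _
        _ = sumNorm N N' (c • x) := by
            rw [← mul_assoc, ← enorm_mul, mul_inv_cancel₀ hc, enorm_one, one_mul]
  · refine ENNReal.le_of_forall_pos_le_add fun ε hε hlt => ?_
    have hε2 : (ε : ℝ≥0∞) / 2 ≠ 0 := (ENNReal.half_pos (by exact_mod_cast hε.ne')).ne'
    rw [ENNReal.add_lt_top] at hlt
    obtain ⟨u, v, huv, h1⟩ := sumNorm_lt_iff.1 (ENNReal.lt_add_right hlt.1.ne hε2)
    obtain ⟨u', v', huv', h2⟩ := sumNorm_lt_iff.1 (ENNReal.lt_add_right hlt.2.ne hε2)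
    calc sumNorm N N' (x + y) ≤ N (u + u') + N' (v + v') :=
          sumNorm_le_of_eq (by rw [← huv, ← huv']; abel)
      _ ≤ (N u + N u') + (N' v + N' v') := add_le_add (hN.add_le _ _) (hN'.add_le _ _)
      _ = (N u + N' v) + (N u' + N' v') := by ring
      _ ≤ (sumNorm N N' x + ε / 2) + (sumNorm N N' y + ε / 2) := add_le_add h1.le h2.le
      _ = sumNorm N N' x + sumNorm N N' y + (ε / 2 + ε / 2) := by ring
      _ = _ := by rw [ENNReal.add_halves]
  · refine le_iInf fun u => le_iInf fun v => le_iInf fun huv => ?_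
    obtain ⟨u', v', h1, h2, h3⟩ := exists_decomposition h huv
    exact (sumNorm_le_of_eq h1).trans (add_le_add (hN.mono _ _ h2) (hN'.mono _ _ h3))

/-- Nearly optimal decompositions with summable errors reduce the claim to the two summands. The
intermediate number `d` leaves one margin for these errors and another, `c - d`, for the two
majorants. -/
theorem RieszFischer.sum (hR : RieszFischer N) (hR' : RieszFischer N') : RieszFischer (sumNorm N N') := by
  intro w c hw
  obtain ⟨d, hd1, hd2⟩ := exists_between hw
  have hwt : ∑' n, sumNorm N N' (w n) ≠ ∞ := (hw.trans_le le_top).ne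
  obtain ⟨δ, hδ, hδs⟩ := ENNReal.exists_pos_sum_of_countable' (tsub_pos_of_lt hd1).ne' ℕ
  choose u v huv hlt using fun n => sumNorm_lt_iff.1
    (ENNReal.lt_add_right (ne_top_of_le_ne_top hwt (ENNReal.le_tsum n)) (hδ n).ne')
  have hsum : ∑' n, N (u n) + ∑' n, N' (v n) < d := by
    rw [← ENNReal.tsum_add]
    calc ∑' n, (N (u n) + N' (v n)) ≤ ∑' n, (sumNorm N N' (w n) + δ n) :=
          ENNReal.tsum_le_tsum fun n => (hlt n).le
      _ = ∑' n, sumNorm N N' (w n) + ∑' n, δ n := ENNReal.tsum_add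
      _ < ∑' n, sumNorm N N' (w n) + (d - ∑' n, sumNorm N N' (w n)) :=
          ENNReal.add_lt_add_left hwt hδs
      _ = d := add_tsub_cancel_of_le hd1.le
  have hdt : d ≠ ∞ := (hd2.trans_le le_top).ne
  have h1 : ∑' n, N (u n) ≠ ∞ := ((le_self_add.trans_lt hsum).trans_le le_top).ne
  have h2 : ∑' n, N' (v n) ≠ ∞ := ((le_add_self.trans_lt hsum).trans_le le_top).ne
  have hε : (c - d) / 2 ≠ 0 := (ENNReal.half_pos (tsub_pos_of_lt hd2).ne').ne'
  obtain ⟨g, hg, hgc⟩ := hR u _ (ENNReal.lt_add_right h1 hε)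
  obtain ⟨k, hk, hkc⟩ := hR' v _ (ENNReal.lt_add_right h2 hε)
  refine ⟨g + k, fun n => ?_, ?_⟩
  · calc ∑ i ∈ Finset.range n, |w i| ≤ ∑ i ∈ Finset.range n, (|u i| + |v i|) :=
          Finset.sum_le_sum fun i _ => by rw [← huv]; exact abs_add_le _ _
      _ ≤ g + k := by rw [Finset.sum_add_distrib]; exact add_le_add (hg n) (hk n)
  · calc sumNorm N N' (g + k) ≤ N g + N' k := sumNorm_le_of_eq rfl
      _ ≤ (∑' n, N (u n) + (c - d) / 2) + (∑' n, N' (v n) + (c - d) / 2) := add_le_add hgc hkc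
      _ = (∑' n, N (u n) + ∑' n, N' (v n)) + ((c - d) / 2 + (c - d) / 2) := by ring
      _ ≤ d + (c - d) := by rw [ENNReal.add_halves]; gcongr
      _ = c := add_tsub_cancel_of_le hd2.le

theorem le_of_forall_one_lt_sq_mul {a b : ℝ≥0∞}
    (h : ∀ c : ℝ, 1 < c → a ≤ ENNReal.ofReal (c * c) * b) : a ≤ b := by
  rcases eq_or_ne b ∞ with rfl | hb
  · exact le_top
  have h1 : Tendsto (fun n : ℕ => (1 + 1 / ((n : ℝ) + 1)) * (1 + 1 / ((n : ℝ) + 1))) atTop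
      (𝓝 ((1 + 0) * (1 + 0))) :=
    (tendsto_one_div_add_atTop_nhds_zero_nat.const_add 1).mul
      (tendsto_one_div_add_atTop_nhds_zero_nat.const_add 1)
  have h2 := ENNReal.Tendsto.mul_const (ENNReal.tendsto_ofReal h1) (Or.inr hb)
  simp only [add_zero, mul_one, ENNReal.ofReal_one, one_mul] at h2
  exact ge_of_tendsto' h2 fun n => h _ (by
    have : (0 : ℝ) < 1 / ((n : ℝ) + 1) := by positivity
    linarith)

/-- A decomposition of `x` has to be imitated for the prescribed `y`. On paired cells `|x| ≥ c ^ k`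
and `|y| ≤ c * c ^ k`. Within a cell `u` and `v` are replaced by smaller step functions according to
the size of `|u| / c ^ k`, and the corresponding cell of `y` is partitioned in the same proportions.
The copied step functions add up to `|y|` within the factor `c * c`. -/
theorem sumNorm_le_of_equimeasurable (hR : Related N M) (hR' : Related N' M')
    (hμν : Compatible μ ν) (hνμ : Compatible ν μ) (hN : IsIdealNorm N) (hN' : IsIdealNorm N')
    (hRF : RieszFischer N) (hRF' : RieszFischer N') {x : Ω →ₘ[μ] ℝ} {y : Ω' →ₘ[ν] ℝ}
    (hxy : ∀ s, distrib x s = distrib y s) : sumNorm M M' y ≤ sumNorm N N' x := by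
  have hM := hR.isIdealNorm hνμ hN
  have hM' := hR'.isIdealNorm hνμ hN'
  have hMM := hM.sum hM' (hR.rieszFischer hνμ hN hRF) (hR'.rieszFischer hνμ hN' hRF')
  refine le_iInf fun u => le_iInf fun v => le_iInf fun huv => ?_
  refine le_of_forall_one_lt_sq_mul fun c hc => ?_
  have hc0 : 0 < c := by linarith
  obtain ⟨A, B, hA, hB, hAd, hBd, hAB, hcov, hyA, hxB⟩ := hνμ.exists_cells y.measurable x.measurable
    (fun s => (hxy s).symm) hc
  -- This `n` gives `c * (1 - 1 / n) ≥ 1`: rounding to multiples of `1 / n` costs at most a factor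
  -- `c`.
  obtain ⟨n, hn1⟩ := exists_nat_gt (c / (c - 1))
  have hn0 : (0 : ℝ) < n := (div_pos hc0 (by linarith)).trans hn1
  have hcn : 1 ≤ c * (1 - 1 / n) := by
    rw [div_lt_iff₀ (by linarith)] at hn1
    have : c * (1 - 1 / n) = (c * n - c) / n := by field_simp
    rw [this, le_div_iff₀ hn0]; linarith
  -- The label `i` rounds `|u| / c ^ k` down to `i / n`. It is capped at `n`, since where `|u| ≥ c ^
  -- k` nothing is required of `v`.
  let lab : ℤ → Ω → ℕ := fun k ω => min n ⌊n * |u ω| / c ^ k⌋₊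
  have hlab : ∀ k, Measurable (lab k) := fun k => measurable_const.min
    (Nat.measurable_floor.comp ((measurable_const.mul u.measurable.abs).div_const _))
  choose d hd hdn hdi using fun k => hμν.exists_partition n (hB k) (hA k) (hAB k).symm (hlab k)
    (fun ω _ => min_le_left _ _)
  let E : ℤ × ℕ → Set Ω := fun p => B p.1 ∩ lab p.1 ⁻¹' {p.2}
  let E' : ℤ × ℕ → Set Ω' := fun p => A p.1 ∩ d p.1 ⁻¹' {p.2}
  have hE : ∀ p, MeasurableSet (E p) := fun p => (hB _).inter (hlab _ (measurableSet_singleton _))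
  have hE' : ∀ p, MeasurableSet (E' p) := fun p => (hA _).inter (hd _ (measurableSet_singleton _))
  have hEE : ∀ p, ν (E' p) = μ (E p) := fun p => hdi p.1 p.2
  have hEd : Pairwise (Function.onFun Disjoint E) := by
    rintro ⟨k, i⟩ ⟨l, j⟩ hne
    refine Set.disjoint_left.2 ?_
    rintro ω ⟨h1, h2⟩ ⟨h3, h4⟩
    rcases eq_or_ne k l with rfl | hkl
    · exact hne (Prod.ext rfl (h2.symm.trans h4))
    · exact Set.disjoint_left.1 (hBd hkl) h1 h3
  have hEd' : Pairwise (Function.onFun Disjoint E') := by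
    rintro ⟨k, i⟩ ⟨l, j⟩ hne
    refine Set.disjoint_left.2 ?_
    rintro ω ⟨h1, h2⟩ ⟨h3, h4⟩
    rcases eq_or_ne k l with rfl | hkl
    · exact hne (Prod.ext rfl (h2.symm.trans h4))
    · exact Set.disjoint_left.1 (hAd hkl) h1 h3
  let a : ℤ × ℕ → ℝ := fun p => c ^ p.1 * (p.2 / n)
  -- For `i < n` one has `|u| < c ^ k * (i + 1) / n`, hence `|v| ≥ c ^ k * (1 - (i + 1) / n)`; at
  -- the cap the maximum is `0`.
  let b : ℤ × ℕ → ℝ := fun p => c ^ p.1 * max 0 (1 - ((p.2 : ℝ) + 1) / n)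
  have hck : ∀ k : ℤ, 0 < c ^ k := fun k => zpow_pos hc0 k
  have ha0 : ∀ p, 0 ≤ a p := fun p => mul_nonneg (hck _).le (by positivity)
  have hb0 : ∀ p, 0 ≤ b p := fun p => mul_nonneg (hck _).le (le_max_left _ _)
  obtain ⟨fu, hfu, hfuE, hfu0⟩ := exists_step hE hEd a
  obtain ⟨fv, hfv, hfvE, hfv0⟩ := exists_step hE hEd b
  obtain ⟨gu, hgu, hguE, hgu0⟩ := exists_step hE' hEd' a
  obtain ⟨gv, hgv, hgvE, hgv0⟩ := exists_step hE' hEd' b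
  let u₁ : Ω →ₘ[μ] ℝ := AEEqFun.mk fu hfu.aestronglyMeasurable
  let v₁ : Ω →ₘ[μ] ℝ := AEEqFun.mk fv hfv.aestronglyMeasurable
  let u₂ : Ω' →ₘ[ν] ℝ := AEEqFun.mk gu hgu.aestronglyMeasurable
  let v₂ : Ω' →ₘ[ν] ℝ := AEEqFun.mk gv hgv.aestronglyMeasurable
  have hu12 : N u₁ = M u₂ := hR _ _ fun s => by
    rw [distrib_mk, distrib_mk, measure_lt_abs_step hE hEd hfuE hfu0,
      measure_lt_abs_step hE' hEd' hguE hgu0]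
    simp only [hEE]
  have hv12 : N' v₁ = M' v₂ := hR' _ _ fun s => by
    rw [distrib_mk, distrib_mk, measure_lt_abs_step hE hEd hfvE hfv0,
      measure_lt_abs_step hE' hEd' hgvE hgv0]
    simp only [hEE]
  have hu1 : N u₁ ≤ N u := by
    refine hN.mono _ _ (abs_le_abs_iff_ae.2 ?_)
    filter_upwards [AEEqFun.coeFn_mk fu hfu.aestronglyMeasurable] with ω h1
    rw [h1]
    by_cases hω : ∃ p, ω ∈ E p
    · obtain ⟨p, hp⟩ := hω
      rw [hfuE p ω hp, abs_of_nonneg (ha0 p)]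
      have h2 : (p.2 : ℝ) ≤ n * |u ω| / c ^ p.1 := by
        have h3 : p.2 ≤ ⌊n * |u ω| / c ^ p.1⌋₊ := hp.2.symm.le.trans (min_le_right _ _)
        exact (Nat.cast_le.2 h3).trans (Nat.floor_le (by have := hck p.1; positivity))
      rw [le_div_iff₀ (hck _)] at h2
      simp only [a]
      rw [← mul_div_assoc, div_le_iff₀ hn0]
      linarith
    · push Not at hω
      rw [hfu0 ω hω, abs_zero]
      exact abs_nonneg _
  have hv1 : N' v₁ ≤ N' v := by
    refine hN'.mono _ _ (abs_le_abs_iff_ae.2 ?_)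
    filter_upwards [AEEqFun.coeFn_mk fv hfv.aestronglyMeasurable, AEEqFun.coeFn_add u v]
      with ω h1 h2
    rw [h1]
    by_cases hω : ∃ p, ω ∈ E p
    · obtain ⟨⟨k, i⟩, hp⟩ := hω
      rw [hfvE _ ω hp, abs_of_nonneg (hb0 _)]
      have h3 : c ^ k ≤ |u ω| + |v ω| := by
        refine (hxB k ω hp.1).trans ?_
        rw [← huv, h2]
        exact abs_add_le _ _
      have hi : min n ⌊n * |u ω| / c ^ k⌋₊ = i := hp.2
      simp only [b]
      rcases le_total (1 - ((i : ℝ) + 1) / n) 0 with h4 | h4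
      · rw [max_eq_left h4, mul_zero]; exact abs_nonneg _
      · rw [max_eq_right h4]
        have h5 : i < n := by
          by_contra! hcon
          have h6 : (n : ℝ) ≤ i := by exact_mod_cast hcon
          have h7 : ((i : ℝ) + 1) / n ≤ 1 := by linarith
          rw [div_le_one hn0] at h7
          linarith
        have h6 : ⌊n * |u ω| / c ^ k⌋₊ = i := by omega
        have h7 := Nat.lt_floor_add_one (n * |u ω| / c ^ k)
        rw [h6, div_lt_iff₀ (hck k)] at h7
        have h8 : |u ω| ≤ c ^ k * ((i + 1) / n) := by
          rw [← mul_div_assoc, le_div_iff₀ hn0]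
          linarith
        linarith
    · push Not at hω
      rw [hfv0 ω hω, abs_zero]
      exact abs_nonneg _
  have hyuv : |y| ≤ |(c * c) • u₂ + (c * c) • v₂| := by
    refine abs_le_abs_iff_ae.2 ?_
    filter_upwards [AEEqFun.coeFn_mk gu hgu.aestronglyMeasurable,
      AEEqFun.coeFn_mk gv hgv.aestronglyMeasurable, AEEqFun.coeFn_smul (c * c) u₂,
      AEEqFun.coeFn_smul (c * c) v₂, AEEqFun.coeFn_add ((c * c) • u₂) ((c * c) • v₂)]
      with ω h1 h2 h3 h4 h5
    rw [h5, Pi.add_apply, h3, h4, Pi.smul_apply, Pi.smul_apply, h1, h2]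
    by_cases hω : y ω = 0
    · rw [hω, abs_zero]; exact abs_nonneg _
    · obtain ⟨k, hk⟩ := hcov ω hω
      have hp : ω ∈ E' (k, d k ω) := ⟨hk, rfl⟩
      rw [hguE _ ω hp, hgvE _ ω hp]
      refine le_trans ?_ (le_abs_self _)
      have h6 : c ^ k * (1 - 1 / n) ≤ a (k, d k ω) + b (k, d k ω) := by
        simp only [a, b]
        rw [← mul_add]
        refine mul_le_mul_of_nonneg_left ?_ (hck k).le
        have h7 := le_max_right 0 (1 - ((d k ω : ℝ) + 1) / n)
        have h8 : ((d k ω : ℝ) + 1) / n = d k ω / n + 1 / n := add_div _ _ _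
        linarith
      calc |y ω| ≤ c * c ^ k := hyA k ω hk
        _ ≤ (c * c ^ k) * (c * (1 - 1 / n)) :=
          le_mul_of_one_le_right (mul_pos hc0 (hck k)).le hcn
        _ = (c * c) * (c ^ k * (1 - 1 / n)) := by ring
        _ ≤ (c * c) * (a (k, d k ω) + b (k, d k ω)) := by gcongr
        _ = _ := by simp only [smul_eq_mul]; ring
  have hcc : ‖c * c‖ₑ = ENNReal.ofReal (c * c) := Real.enorm_eq_ofReal (by positivity)
  calc sumNorm M M' y ≤ sumNorm M M' ((c * c) • u₂ + (c * c) • v₂) := hMM.mono _ _ hyuv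
    _ ≤ M ((c * c) • u₂) + M' ((c * c) • v₂) := sumNorm_le_of_eq rfl
    _ = ENNReal.ofReal (c * c) * (N u₁ + N' v₁) := by
      rw [hM.smul, hM'.smul, hcc, hu12, hv12, mul_add]
    _ ≤ ENNReal.ofReal (c * c) * (N u + N' v) := by gcongr

theorem Related.sum (hR : Related N M) (hR' : Related N' M')
    (hμν : Compatible μ ν) (hνμ : Compatible ν μ) (hN : IsIdealNorm N) (hN' : IsIdealNorm N')
    (hRF : RieszFischer N) (hRF' : RieszFischer N') :
    Related (sumNorm N N') (sumNorm M M') := fun _ _ hxy =>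
  le_antisymm
    (sumNorm_le_of_equimeasurable hR.symm hR'.symm hνμ hμν (hR.isIdealNorm hνμ hN)
      (hR'.isIdealNorm hνμ hN') (hR.rieszFischer hνμ hN hRF) (hR'.rieszFischer hνμ hN' hRF')
      fun s => (hxy s).symm)
    (sumNorm_le_of_equimeasurable hR hR' hμν hνμ hN hN' hRF hRF' hxy)

end Sum

/-! ### Averaging over cells of equal measure -/

section Averaging

variable {Ω : Type u} [MeasurableSpace Ω] {μ : Measure Ω} {N : (Ω →ₘ[μ] ℝ) → ℝ≥0∞}

/-- Cyclic averaging of a step function over cells of equal measures. -/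
theorem IsIdealNorm.average_le (hN : IsIdealNorm N) (hS : Related N N) {n : ℕ}
    {E : Fin n → Set Ω} (hE : ∀ i, MeasurableSet (E i))
    (hEd : Pairwise (Function.onFun Disjoint E)) {h : ℝ≥0∞} (hEh : ∀ i, μ (E i) = h)
    {a : Fin n → ℝ} (ha : ∀ i, 0 ≤ a i) {x : Ω →ₘ[μ] ℝ} (hx : ∀ i, ∀ ω ∈ E i, a i ≤ |x ω|) :
    ENNReal.ofReal (∑ i, a i) * N (chi μ (MeasurableSet.iUnion hE)) ≤ n * N x := by
  rcases n with _ | m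
  · simp
  -- The function `f k` has the values `a` shifted cyclically by `k`. All shifts are equimeasurable,
  -- and on each cell they add up to `∑ i, a i`.
  choose f hf hfE hf0 using fun k : Fin (m + 1) =>
    exists_step (E := fun j => E (j - k)) (fun j => hE _)
      (fun i j hij => hEd fun h => hij (sub_left_injective h)) a
  let y : Fin (m + 1) → Ω →ₘ[μ] ℝ := fun k => AEEqFun.mk (f k) (hf k).aestronglyMeasurable
  have hy : ∀ᵐ ω ∂μ, ∀ k, y k ω = f k ω := ae_all_iff.2 fun k => AEEqFun.coeFn_mk _ _
  have hy0 : N (y 0) ≤ N x := by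
    refine hN.mono _ _ (abs_le_abs_iff_ae.2 ?_)
    filter_upwards [hy] with ω h1
    rw [h1]
    by_cases hω : ∃ j, ω ∈ E (j - 0)
    · obtain ⟨j, hj⟩ := hω
      rw [hfE 0 j ω hj, abs_of_nonneg (ha j)]
      exact hx j ω (by simpa using hj)
    · push Not at hω
      rw [hf0 0 ω hω, abs_zero]
      exact abs_nonneg _
  have hyk : ∀ k, N (y k) = N (y 0) := fun k => hS _ _ fun s => by
    rw [distrib_mk, distrib_mk,
      measure_lt_abs_step (fun j => hE (j - k)) (fun i j hij => hEd fun h =>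
        hij (sub_left_injective h)) (hfE k) (hf0 k),
      measure_lt_abs_step (fun j => hE (j - 0)) (fun i j hij => hEd fun h =>
        hij (sub_left_injective h)) (hfE 0) (hf0 0)]
    simp only [hEh]
  have hsum : ∀ s : Finset (Fin (m + 1)), ∀ᵐ ω ∂μ, (∑ k ∈ s, y k : Ω →ₘ[μ] ℝ) ω =
      ∑ k ∈ s, f k ω := by
    intro s
    induction s using Finset.induction_on with
    | empty =>
      simp only [Finset.sum_empty]
      exact AEEqFun.coeFn_zero
    | insert k s hk ih =>
      simp only [Finset.sum_insert hk]
      filter_upwards [ih, hy, AEEqFun.coeFn_add (y k) (∑ k ∈ s, y k)] with ω h1 h2 h3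
      rw [h3, Pi.add_apply, h1, h2]
  have hle : |(∑ i, a i) • chi μ (MeasurableSet.iUnion hE)| ≤ |∑ k, y k| := by
    refine abs_le_abs_iff_ae.2 ?_
    filter_upwards [hsum Finset.univ, coeFn_chi (μ := μ) (MeasurableSet.iUnion hE),
      AEEqFun.coeFn_smul (∑ i, a i) (chi μ (MeasurableSet.iUnion hE))] with ω h1 h2 h3
    rw [h1, h3, Pi.smul_apply, h2]
    by_cases hω : ω ∈ ⋃ i, E i
    · obtain ⟨i, hi⟩ := Set.mem_iUnion.1 hω
      have h4 : ∀ k, f k ω = a (i + k) := fun k => hfE k (i + k) ω (by simpa using hi)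
      simp only [h4, Set.indicator_of_mem hω, Pi.one_apply, smul_eq_mul, mul_one]
      rw [show ∑ k, a (i + k) = ∑ k, a k from Equiv.sum_comp (Equiv.addLeft i) a]
    · simp [hω]
  calc ENNReal.ofReal (∑ i, a i) * N (chi μ (MeasurableSet.iUnion hE))
      = N ((∑ i, a i) • chi μ (MeasurableSet.iUnion hE)) := by
        rw [hN.smul, Real.enorm_eq_ofReal (Finset.sum_nonneg fun i _ => ha i)]
    _ ≤ N (∑ k, y k) := hN.mono _ _ hle
    _ ≤ ∑ k, N (y k) := hN.sum_le _ _
    _ = (m + 1 : ℕ) * N (y 0) := by simp [hyk]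
    _ ≤ (m + 1 : ℕ) * N x := by gcongr

/-- Integrals over sets of finite measure are approximated from below by step functions on
partitions into sets of equal measures. -/
def HasTilings (μ : Measure Ω) : Prop :=
  ∀ e, MeasurableSet e → μ e < ∞ → ∀ f : Ω → ℝ, Measurable f → ∀ c < ∫⁻ ω in e, ‖f ω‖ₑ ∂μ,
    ∃ (n : ℕ) (E : Fin n → Set Ω) (a : Fin n → ℝ) (h : ℝ≥0∞), (∀ i, MeasurableSet (E i)) ∧
      (∀ i, E i ⊆ e) ∧ Pairwise (Function.onFun Disjoint E) ∧ (∀ i, μ (E i) = h) ∧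
      n * h = μ e ∧ (∀ i, 0 ≤ a i) ∧ (∀ i, ∀ ω ∈ E i, a i ≤ |f ω|) ∧
      c ≤ h * ENNReal.ofReal (∑ i, a i)

theorem hasTilings_of_discrete (hd : ∀ ω : Ω, MeasurableSet ({ω} : Set Ω) ∧ μ {ω} = 1) :
    HasTilings μ := by
  intro e _ hef f _ c hc
  have : MeasurableSingletonClass Ω := ⟨fun ω => (hd ω).1⟩
  obtain ⟨s, rfl⟩ := (finite_of_discrete hd hef).exists_finset_coe
  refine ⟨s.card, fun i => {((s.equivFin.symm i : s) : Ω)}, fun i => |f (s.equivFin.symm i : s)|, 1,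
    fun i => measurableSet_singleton _, fun i => by simp, fun i j hij => ?_, fun i => (hd _).2,
    by rw [measure_finset_of_discrete hd, mul_one], fun i => abs_nonneg _, fun i ω hω => ?_, ?_⟩
  · simpa [Function.onFun, Subtype.ext_iff] using hij
  · rw [Set.mem_singleton_iff.1 hω]
  · refine hc.le.trans (le_of_eq ?_)
    rw [lintegral_finset, one_mul, s.equivFin.symm.sum_comp (fun ω : s => |f ω|),
      Finset.sum_coe_sort s fun ω => |f ω|, ENNReal.ofReal_sum_of_nonneg fun i _ => abs_nonneg _]
    simp [hd, Real.enorm_eq_ofReal_abs]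

theorem Nonatomic.exists_tiles (hμ : Nonatomic μ) {h : ℝ≥0∞} (hh : h < ∞) (k : ℕ) {C : Set Ω}
    (hC : MeasurableSet C) (hk : k * h ≤ μ C) :
    ∃ T : Fin k → Set Ω, (∀ i, MeasurableSet (T i)) ∧ (∀ i, T i ⊆ C) ∧
      Pairwise (Function.onFun Disjoint T) ∧ ∀ i, μ (T i) = h := by
  induction k generalizing C with
  | zero => exact ⟨fun i => i.elim0, fun i => i.elim0, fun i => i.elim0, fun i => i.elim0,
      fun i => i.elim0⟩
  | succ k ih =>
    push_cast at hk
    obtain ⟨D, hDC, hD, hDh⟩ := hμ.exists_subset_eq hh hC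
      (le_trans (by rw [add_mul, one_mul]; exact le_add_self) hk)
    obtain ⟨T, h1, h2, h3, h4⟩ := ih (hC.diff hD) (by
      rw [measure_sdiff hDC hD.nullMeasurableSet (hDh ▸ hh.ne), hDh]
      refine ENNReal.le_sub_of_add_le_right hh.ne ?_
      rwa [add_mul, one_mul] at hk)
    refine ⟨Fin.cons D T, fun i => ?_, fun i => ?_, ?_, fun i => ?_⟩
    · refine Fin.cases hD h1 i
    · refine Fin.cases hDC (fun i => (h2 i).trans Set.sdiff_subset) i
    · intro i j
      refine Fin.cases ?_ (fun i => ?_) i <;> refine Fin.cases ?_ (fun j => ?_) j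
      · exact fun h => (h rfl).elim
      · exact fun _ => (Set.disjoint_sdiff_left.mono_left (h2 j)).symm
      · exact fun _ => Set.disjoint_sdiff_left.mono_left (h2 i)
      · exact fun hij => h3 fun h => hij (congrArg Fin.succ h)
    · refine Fin.cases hDh h4 i

/-- A simple function below `f` nearly gives the integral. Each of its level sets is tiled by as
many sets of measure `h = μ e / K` as fit, and the rest of `e` is tiled with the value `0`. -/
theorem Nonatomic.hasTilings (hμ : Nonatomic μ) : HasTilings μ := by
  intro e he hef f hf c hc
  have he0 : μ e ≠ 0 := fun h0 => by
    rw [Measure.restrict_zero_set h0, lintegral_zero_measure] at hc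
    exact ENNReal.not_lt_zero hc
  rw [lintegral_eq_nnreal] at hc
  obtain ⟨φ, hφ⟩ := lt_iSup_iff.1 hc
  obtain ⟨hφf, hφc⟩ := lt_iSup_iff.1 hφ
  rw [SimpleFunc.map_lintegral] at hφc
  let C : ℝ≥0 → Set Ω := fun y => φ ⁻¹' {y} ∩ e
  have hC : ∀ y, MeasurableSet (C y) := fun y => (φ.measurableSet_fiber y).inter he
  simp only [Measure.restrict_apply (φ.measurableSet_fiber _)] at hφc
  change c < ∑ y ∈ φ.range, (y : ℝ≥0∞) * μ (C y) at hφc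
  have hct : c ≠ ∞ := (hφc.trans_le le_top).ne
  -- Each level set loses at most measure `h`, so the total loss is at most `h * ∑ y`; `K` is taken
  -- so large that this fits into the gap above `c`.
  obtain ⟨K, hK0, hK⟩ : ∃ K : ℕ, 0 < K ∧
      c + μ e / K * ∑ y ∈ φ.range, (y : ℝ≥0∞) < ∑ y ∈ φ.range, (y : ℝ≥0∞) * μ (C y) := by
    have h1 : Tendsto (fun K : ℕ => c + μ e / K * ∑ y ∈ φ.range, (y : ℝ≥0∞)) atTop
        (𝓝 (c + μ e / ∞ * ∑ y ∈ φ.range, (y : ℝ≥0∞))) := by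
      refine tendsto_const_nhds.add (ENNReal.Tendsto.mul_const ?_ (Or.inr (by simp)))
      exact ENNReal.Tendsto.const_div ENNReal.tendsto_nat_nhds_top (Or.inr hef.ne)
    rw [ENNReal.div_top, zero_mul, add_zero] at h1
    obtain ⟨K, h2, h3⟩ := ((h1.eventually (gt_mem_nhds hφc)).and (eventually_gt_atTop 0)).exists
    exact ⟨K, h3, h2⟩
  set h := μ e / K with hh
  have hK0' : (K : ℝ≥0∞) ≠ 0 := by exact_mod_cast hK0.ne'
  have hKh : K * h = μ e := ENNReal.mul_div_cancel hK0' (ENNReal.natCast_ne_top K)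
  have hht : h < ∞ := ENNReal.div_lt_top hef.ne hK0'
  have hh0 : h ≠ 0 := fun h0 => he0 (by rw [← hKh, h0, mul_zero])
  have hCf : ∀ y, μ (C y) < ∞ := fun y => (measure_mono Set.inter_subset_right).trans_lt hef
  let k : ℝ≥0 → ℕ := fun y => ⌊(μ (C y) / h).toReal⌋₊
  have hdt : ∀ y, μ (C y) / h ≠ ∞ := fun y => (ENNReal.div_lt_top (hCf y).ne hh0).ne
  have hk1 : ∀ y, k y * h ≤ μ (C y) := fun y => by
    rw [← ENNReal.le_div_iff_mul_le (Or.inl hh0) (Or.inl hht.ne), ← ENNReal.ofReal_toReal (hdt y),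
      ← ENNReal.ofReal_natCast]
    exact ENNReal.ofReal_le_ofReal (Nat.floor_le ENNReal.toReal_nonneg)
  have hk2 : ∀ y, μ (C y) ≤ (k y + 1) * h := fun y => by
    rw [← ENNReal.div_le_iff hh0 hht.ne, ← ENNReal.ofReal_toReal (hdt y), ← ENNReal.ofReal_natCast,
      ← ENNReal.ofReal_one, ← ENNReal.ofReal_add (by positivity) (by positivity)]
    exact ENNReal.ofReal_le_ofReal (Nat.lt_floor_add_one _).le
  choose T hT hTC hTd hTh using fun y => hμ.exists_tiles hht (k y) (hC y) (hk1 y)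
  let σ := Σ y : φ.range, Fin (k y)
  let V : σ → Set Ω := fun p => T p.1 p.2
  have hV : ∀ p, MeasurableSet (V p) := fun p => hT _ _
  have hVe : ∀ p, V p ⊆ e := fun p => (hTC _ _).trans Set.inter_subset_right
  have hVh : ∀ p, μ (V p) = h := fun p => hTh _ _
  have hVd : Pairwise (Function.onFun Disjoint V) := by
    rintro ⟨y, i⟩ ⟨z, j⟩ hne
    by_cases hyz : y = z
    · subst hyz
      exact hTd _ fun hij => hne (congrArg (Sigma.mk y) hij)
    · refine Set.disjoint_left.2 fun ω h1 h2 => hyz (Subtype.ext ?_)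
      exact (hTC _ _ h1).1.symm.trans (hTC _ _ h2).1
  have hVU : μ (⋃ p, V p) = Fintype.card σ * h := by
    rw [measure_iUnion hVd hV, tsum_fintype]
    simp [hVh]
  have hcard : Fintype.card σ ≤ K := by
    have h1 : (Fintype.card σ : ℝ≥0∞) * h ≤ K * h := by
      rw [← hVU, hKh]; exact measure_mono (Set.iUnion_subset hVe)
    rw [ENNReal.mul_le_mul_iff_left hh0 hht.ne] at h1
    exact_mod_cast h1
  obtain ⟨r, hr⟩ := Nat.exists_eq_add_of_le hcard
  have hUm : MeasurableSet (⋃ p, V p) := MeasurableSet.iUnion hV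
  -- The untiled part of `e` has measure exactly `r * h`, so `r` more tiles bring the number of
  -- tiles to exactly `K`.
  obtain ⟨W, hW, hWe, hWd, hWh⟩ := hμ.exists_tiles hht r (he.diff hUm) (by
    rw [measure_sdiff (Set.iUnion_subset hVe) hUm.nullMeasurableSet
      (by rw [hVU]; exact ENNReal.mul_ne_top (ENNReal.natCast_ne_top _) hht.ne), hVU, ← hKh, hr]
    refine ENNReal.le_sub_of_add_le_left
      (ENNReal.mul_ne_top (ENNReal.natCast_ne_top _) hht.ne) (le_of_eq ?_)
    push_cast; ring)
  have hcardS : Fintype.card (σ ⊕ Fin r) = K := by simp [hr]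
  let eq : Fin K ≃ σ ⊕ Fin r := (finCongr hcardS.symm).trans (Fintype.equivFin _).symm
  let E : σ ⊕ Fin r → Set Ω := Sum.elim V W
  let a : σ ⊕ Fin r → ℝ := Sum.elim (fun p => ((p.1 : ℝ≥0) : ℝ)) fun _ => 0
  have hEm : ∀ p, MeasurableSet (E p) := by rintro (p | p); exacts [hV p, hW p]
  have hEe : ∀ p, E p ⊆ e := by
    rintro (p | p)
    exacts [hVe p, (hWe p).trans Set.sdiff_subset]
  have hVW : ∀ p q, Disjoint (V p) (W q) := fun p q =>
    (Set.disjoint_sdiff_left.mono (hWe q) (Set.subset_iUnion V p)).symm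
  have hEd : Pairwise (Function.onFun Disjoint E) := by
    rintro (p | p) (q | q) hne
    · exact hVd fun h => hne (by rw [h])
    · exact hVW p q
    · exact (hVW q p).symm
    · exact hWd fun h => hne (by rw [h])
  have hEh : ∀ p, μ (E p) = h := by rintro (p | p); exacts [hVh p, hWh p]
  have ha : ∀ p, 0 ≤ a p := by rintro (p | p); exacts [NNReal.coe_nonneg _, le_rfl]
  have haf : ∀ p, ∀ ω ∈ E p, a p ≤ |f ω| := by
    rintro (p | p) ω hω
    · have h1 : φ ω = p.1 := (hTC _ _ hω).1
      have h2 := hφf ω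
      rw [h1, Real.enorm_eq_ofReal_abs] at h2
      have h3 := ENNReal.toReal_mono ENNReal.ofReal_ne_top h2
      rwa [ENNReal.toReal_ofReal (abs_nonneg _)] at h3
    · exact abs_nonneg _
  refine ⟨K, E ∘ eq, a ∘ eq, h, fun i => hEm _, fun i => hEe _,
    fun i j hij => hEd fun h => hij (eq.injective h), fun i => hEh _, hKh, fun i => ha _,
    fun i => haf _, ?_⟩
  have hsum : ENNReal.ofReal (∑ i, (a ∘ eq) i) = ∑ y ∈ φ.range, (y : ℝ≥0∞) * k y := by
    rw [Function.comp_def, eq.sum_comp a, ENNReal.ofReal_sum_of_nonneg fun p _ => ha p,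
      Fintype.sum_sum_type]
    simp only [a, Sum.elim_inl, Sum.elim_inr, ENNReal.ofReal_zero, Finset.sum_const_zero, add_zero,
      ENNReal.ofReal_coe_nnreal]
    rw [Fintype.sum_sigma]
    simp only [Finset.sum_const, Finset.card_univ, Fintype.card_fin, nsmul_eq_mul]
    rw [Finset.sum_coe_sort φ.range fun y => (k y : ℝ≥0∞) * y]
    exact Finset.sum_congr rfl fun y _ => mul_comm _ _
  rw [hsum]
  have hfin : h * ∑ y ∈ φ.range, (y : ℝ≥0∞) ≠ ∞ := ENNReal.mul_ne_top hht.ne (by simp)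
  refine (ENNReal.add_le_add_iff_right hfin).1 (hK.le.trans ?_)
  calc ∑ y ∈ φ.range, (y : ℝ≥0∞) * μ (C y) ≤ ∑ y ∈ φ.range, (y : ℝ≥0∞) * ((k y + 1) * h) := by
        gcongr with y; exact hk2 y
    _ = _ := by
        rw [← mul_add, ← Finset.sum_add_distrib, Finset.mul_sum]
        exact Finset.sum_congr rfl fun y _ => by ring

theorem SpaceType.Holds.hasTilings {τ : SpaceType} (h : τ.Holds μ) : HasTilings μ := by
  cases τ with
  | probability => exact h.1.hasTilings
  | infinite => exact h.1.hasTilings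
  | discrete => exact hasTilings_of_discrete h.2

theorem SpaceType.Holds.univ_ne_zero {τ : SpaceType} (h : τ.Holds μ) : μ Set.univ ≠ 0 := by
  cases τ with
  | probability => rw [h.2]; exact one_ne_zero
  | infinite => rw [h.2]; exact ENNReal.top_ne_zero
  | discrete =>
    obtain ⟨ω⟩ := h.1.nonempty
    intro h0
    have := measure_mono_null (Set.subset_univ {ω}) h0
    rw [(h.2 ω).2] at this
    exact one_ne_zero this

/-- Replacing `|x|` on `e` by its mean does not increase the norm: this holds for step functions on
tiles by cyclic averaging, and these approximate the integral from below. -/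
theorem IsIdealNorm.setLIntegral_mul_le (hN : IsIdealNorm N) (hS : Related N N)
    (ht : HasTilings μ) {e : Set Ω} (he : MeasurableSet e) (hef : μ e < ∞) (x : Ω →ₘ[μ] ℝ) :
    (∫⁻ ω in e, ‖x ω‖ₑ ∂μ) * N (chi μ he) ≤ μ e * N x := by
  have key : ∀ c < ∫⁻ ω in e, ‖x ω‖ₑ ∂μ, c * N (chi μ he) ≤ μ e * N x := by
    intro c hc
    obtain ⟨n, E, a, h, hE, hEe, hEd, hEh, hnh, ha, hax, hca⟩ := ht e he hef x x.measurable c hc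
    have hU : μ e = μ (⋃ i, E i) := by
      rw [measure_iUnion hEd hE, tsum_fintype, ← hnh]; simp [hEh]
    calc c * N (chi μ he) ≤ h * ENNReal.ofReal (∑ i, a i) * N (chi μ he) := by gcongr
      _ = h * (ENNReal.ofReal (∑ i, a i) * N (chi μ (MeasurableSet.iUnion hE))) := by
        rw [mul_assoc, hS.map_chi he (MeasurableSet.iUnion hE) hU]
      _ ≤ h * (n * N x) := mul_le_mul' le_rfl (hN.average_le hS hE hEd hEh ha hax)
      _ = μ e * N x := by rw [← hnh]; ring
  rw [← ENNReal.iSup_lt_eq_self (∫⁻ ω in e, ‖x ω‖ₑ ∂μ)]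
  simp only [ENNReal.iSup_mul]
  exact iSup₂_le key

end Averaging

/-! ### The dual space and the norming condition -/

section Dual

variable {Ω : Type u} [MeasurableSpace Ω] {μ : Measure Ω}
variable {Ω' : Type v} [MeasurableSpace Ω'] {ν : Measure Ω'}
variable {N : (Ω →ₘ[μ] ℝ) → ℝ≥0∞} {M : (Ω' →ₘ[ν] ℝ) → ℝ≥0∞}

theorem le_dualNorm {f x : Ω →ₘ[μ] ℝ} (hx : N x = 1) :
    ∫⁻ ω, ‖f ω * x ω‖ₑ ∂μ ≤ dualNorm N f :=
  le_iSup₂ (f := fun (x : Ω →ₘ[μ] ℝ) (_ : N x = 1) => ∫⁻ ω, ‖f ω * x ω‖ₑ ∂μ) x hx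

theorem IsIdealNorm.lintegral_mul_le (hN : IsIdealNorm N) {f x : Ω →ₘ[μ] ℝ} (hx : N x < ∞) :
    ∫⁻ ω, ‖f ω * x ω‖ₑ ∂μ ≤ dualNorm N f * N x := by
  rcases eq_or_ne (N x) 0 with h0 | h0
  · have hx0 : x =ᵐ[μ] 0 := by
      rw [(hN.eq_zero_iff x).1 h0]; exact AEEqFun.coeFn_zero
    have : (fun ω => ‖f ω * x ω‖ₑ) =ᵐ[μ] 0 := by
      filter_upwards [hx0] with ω h; simp [h]
    rw [lintegral_congr_ae this]
    simp
  · set c : ℝ := (N x).toReal with hc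
    have hcpos : 0 < c := ENNReal.toReal_pos h0 hx.ne
    have hcN : ENNReal.ofReal c = N x := ENNReal.ofReal_toReal hx.ne
    have h1 : N (c⁻¹ • x) = 1 := by
      rw [hN.smul, Real.enorm_eq_ofReal (by positivity), ENNReal.ofReal_inv_of_pos hcpos, hcN,
        ENNReal.inv_mul_cancel h0 hx.ne]
    have h2 : ∫⁻ ω, ‖f ω * x ω‖ₑ ∂μ = N x * ∫⁻ ω, ‖f ω * (c⁻¹ • x) ω‖ₑ ∂μ := by
      rw [← lintegral_const_mul' _ _ hx.ne]
      refine lintegral_congr_ae ?_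
      filter_upwards [AEEqFun.coeFn_smul c⁻¹ x] with ω h
      rw [h, Pi.smul_apply, smul_eq_mul, ← hcN, ← Real.enorm_eq_ofReal hcpos.le, ← enorm_mul]
      congr 1
      field_simp
    rw [h2, mul_comm]
    exact mul_le_mul' (le_dualNorm h1) le_rfl

theorem lintegral_mul_chi (f : Ω →ₘ[μ] ℝ) {e : Set Ω} (he : MeasurableSet e) :
    ∫⁻ ω, ‖f ω * chi μ he ω‖ₑ ∂μ = ∫⁻ ω in e, ‖f ω‖ₑ ∂μ := by
  rw [← lintegral_indicator he]
  refine lintegral_congr_ae ?_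
  filter_upwards [coeFn_chi (μ := μ) he] with ω h
  rw [h]
  by_cases hω : ω ∈ e <;> simp [hω]

theorem ae_lt_top_of_setLIntegral (hu : HasUnits μ) {f : Ω → ℝ≥0∞} (hf : Measurable f)
    (h : ∀ e, MeasurableSet e → μ e < ∞ → ∫⁻ ω in e, f ω ∂μ < ∞) : ∀ᵐ ω ∂μ, f ω < ∞ := by
  by_contra hcon
  have h0 : μ {ω | f ω = ∞} ≠ 0 := fun h0 => hcon (by
    rw [ae_iff]; simpa using h0)
  obtain ⟨e, h1, h2, h3, h4⟩ := hu.exists_finite (hf (measurableSet_singleton ∞)) h0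
  have h5 := ae_lt_top hf (h e h2 h4).ne
  rw [ae_restrict_iff' h2] at h5
  refine h3 (measure_mono_null (fun ω hω => ?_) h5)
  have h6 : f ω = ∞ := h1 hω
  simp [hω, h6]

theorem IsIdealNorm.dual (hN : IsIdealNorm N) (hu : HasUnits μ)
    (hc : ∀ (e : Set Ω) (he : MeasurableSet e), μ e < ∞ → N (chi μ he) < ∞) :
    IsIdealNorm (dualNorm N) where
  eq_zero_iff f := by
    constructor
    · intro h
      by_contra hne
      obtain ⟨η, e, he, hη, he0, hef, hle⟩ := hu.exists_chi_le hne
      have h1 := hN.lintegral_mul_le (f := f) (hc e he hef)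
      rw [h, zero_mul, lintegral_mul_chi, le_zero_iff,
        lintegral_eq_zero_iff f.measurable.enorm, EventuallyEq, ae_restrict_iff' he] at h1
      refine he0 ?_
      have h2 : ∀ᵐ ω ∂μ, ω ∉ e := by
        filter_upwards [h1, AEEqFun.coeFn_le.2 hle, AEEqFun.coeFn_abs f,
          AEEqFun.coeFn_smul η (chi μ he), coeFn_chi (μ := μ) he] with ω h3 h4 h5 h6 h7 hω
        have h8 : f ω = 0 := by simpa using h3 hω
        rw [h5, h6, Pi.smul_apply, h7, h8] at h4
        simp only [Set.indicator_of_mem hω, Pi.one_apply, smul_eq_mul, mul_one, abs_zero] at h4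
        exact absurd h4 (not_le.2 hη)
      simpa [ae_iff] using h2
    · rintro rfl
      refine le_zero_iff.1 (iSup₂_le fun x _ => ?_)
      have : (fun ω => ‖(0 : Ω →ₘ[μ] ℝ) ω * x ω‖ₑ) =ᵐ[μ] 0 := by
        filter_upwards [AEEqFun.coeFn_zero (β := ℝ) (μ := μ)] with ω h; simp [h]
      rw [lintegral_congr_ae this]
      simp
  smul c f := by
    simp only [dualNorm, ENNReal.mul_iSup]
    refine iSup_congr fun x => iSup_congr fun _ => ?_
    rw [← lintegral_const_mul' _ _ enorm_ne_top]
    refine lintegral_congr_ae ?_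
    filter_upwards [AEEqFun.coeFn_smul c f] with ω h
    rw [h, Pi.smul_apply, smul_eq_mul, mul_assoc, enorm_mul]
  add_le f g := iSup₂_le fun x hx => by
    calc ∫⁻ ω, ‖(f + g) ω * x ω‖ₑ ∂μ ≤ ∫⁻ ω, (‖f ω * x ω‖ₑ + ‖g ω * x ω‖ₑ) ∂μ := by
          refine lintegral_mono_ae ?_
          filter_upwards [AEEqFun.coeFn_add f g] with ω h
          rw [h, Pi.add_apply, add_mul]
          exact enorm_add_le _ _
      _ = ∫⁻ ω, ‖f ω * x ω‖ₑ ∂μ + ∫⁻ ω, ‖g ω * x ω‖ₑ ∂μ :=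
          lintegral_add_left (f.measurable.mul x.measurable).enorm _
      _ ≤ _ := add_le_add (le_dualNorm hx) (le_dualNorm hx)
  mono f g hfg := iSup₂_le fun x hx => by
    refine le_trans (lintegral_mono_ae ?_) (le_dualNorm hx)
    filter_upwards [abs_le_abs_iff_ae.1 hfg] with ω h
    rw [enorm_mul, enorm_mul, Real.enorm_eq_ofReal_abs (f ω), Real.enorm_eq_ofReal_abs (g ω)]
    gcongr

/-- Testing against indicators shows that the sum of the `|w i|` is integrable over every set of
finite measure, hence finite almost everywhere. Interchanging sum and integral then bounds its dual
norm. -/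
theorem IsIdealNorm.rieszFischer_dual (hN : IsIdealNorm N) (hu : HasUnits μ)
    (hc : ∀ (e : Set Ω) (he : MeasurableSet e), μ e < ∞ → N (chi μ he) < ∞) :
    RieszFischer (dualNorm N) := by
  intro w c hw
  have hm : Measurable fun ω => ∑' i, ‖w i ω‖ₑ := Measurable.tsum fun i => (w i).measurable.enorm
  have hfin : ∀ᵐ ω ∂μ, ∑' i, ‖w i ω‖ₑ < ∞ := by
    refine ae_lt_top_of_setLIntegral hu hm fun e he hef => ?_
    rw [lintegral_tsum fun i => (w i).measurable.enorm.aemeasurable]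
    calc ∑' i, ∫⁻ ω in e, ‖w i ω‖ₑ ∂μ ≤ ∑' i, dualNorm N (w i) * N (chi μ he) := by
          refine ENNReal.tsum_le_tsum fun i => ?_
          rw [← lintegral_mul_chi]
          exact hN.lintegral_mul_le (hc e he hef)
      _ = (∑' i, dualNorm N (w i)) * N (chi μ he) := ENNReal.tsum_mul_right
      _ < ∞ := ENNReal.mul_lt_top (hw.trans_le le_top) (hc e he hef)
  let g : Ω →ₘ[μ] ℝ := AEEqFun.mk (fun ω => (∑' i, ‖w i ω‖ₑ).toReal)
    hm.ennreal_toReal.aestronglyMeasurable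
  have hg : ∀ᵐ ω ∂μ, ENNReal.ofReal (g ω) = ∑' i, ‖w i ω‖ₑ ∧ 0 ≤ g ω := by
    filter_upwards [hfin, AEEqFun.coeFn_mk (fun ω => (∑' i, ‖w i ω‖ₑ).toReal)
      hm.ennreal_toReal.aestronglyMeasurable] with ω h1 h2
    rw [h2, ENNReal.ofReal_toReal h1.ne]
    exact ⟨rfl, ENNReal.toReal_nonneg⟩
  refine ⟨g, sum_abs_le_iff.2 (hg.mono fun ω h => ⟨h.1.ge, h.2⟩), iSup₂_le fun x hx => ?_⟩
  calc ∫⁻ ω, ‖g ω * x ω‖ₑ ∂μ = ∫⁻ ω, ∑' i, ‖w i ω * x ω‖ₑ ∂μ := by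
        refine lintegral_congr_ae ?_
        filter_upwards [hg] with ω h
        simp only [enorm_mul]
        rw [ENNReal.tsum_mul_right, ← h.1, Real.enorm_eq_ofReal h.2]
    _ = ∑' i, ∫⁻ ω, ‖w i ω * x ω‖ₑ ∂μ :=
        lintegral_tsum fun i => ((w i).measurable.mul x.measurable).enorm.aemeasurable
    _ ≤ ∑' i, dualNorm N (w i) := ENNReal.tsum_le_tsum fun i => le_dualNorm hx
    _ ≤ c := hw.le

theorem lintegral_chi_mul (f : Ω →ₘ[μ] ℝ) {e : Set Ω} (he : MeasurableSet e) :
    ∫⁻ ω, ‖chi μ he ω * f ω‖ₑ ∂μ = ∫⁻ ω in e, ‖f ω‖ₑ ∂μ := by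
  rw [← lintegral_mul_chi f he]
  exact lintegral_congr fun ω => by rw [mul_comm]

theorem IsIdealNorm.chi_eq_zero_iff (hN : IsIdealNorm N) {e : Set Ω} (he : MeasurableSet e) :
    N (chi μ he) = 0 ↔ μ e = 0 := by
  rw [hN.eq_zero_iff, eq_zero_iff_distrib, distrib_chi, if_pos one_pos]

theorem IsIdealNorm.dual_chi_le (hN : IsIdealNorm N) (hS : Related N N) (ht : HasTilings μ)
    (hc : ∀ (e : Set Ω) (he : MeasurableSet e), μ e < ∞ → N (chi μ he) < ∞)
    {e : Set Ω} (he : MeasurableSet e) (hef : μ e < ∞) (he0 : μ e ≠ 0) :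
    dualNorm N (chi μ he) ≤ μ e / N (chi μ he) := by
  refine iSup₂_le fun x hx => ?_
  rw [lintegral_chi_mul, ENNReal.le_div_iff_mul_le
    (Or.inl fun h => he0 ((hN.chi_eq_zero_iff he).1 h)) (Or.inl (hc e he hef).ne)]
  simpa [hx] using hN.setLIntegral_mul_le hS ht he hef x

theorem IsIdealNorm.dual_chi_lt_top (hN : IsIdealNorm N) (hS : Related N N) (ht : HasTilings μ)
    (hu : HasUnits μ)
    (hc : ∀ (e : Set Ω) (he : MeasurableSet e), μ e < ∞ → N (chi μ he) < ∞)
    (e : Set Ω) (he : MeasurableSet e) (hef : μ e < ∞) : dualNorm N (chi μ he) < ∞ := by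
  rcases eq_or_ne (μ e) 0 with he0 | he0
  · rw [((hN.dual hu hc).chi_eq_zero_iff he).2 he0]
    exact ENNReal.zero_lt_top
  · exact (hN.dual_chi_le hS ht hc he hef he0).trans_lt
      (ENNReal.div_lt_top hef.ne fun h => he0 ((hN.chi_eq_zero_iff he).1 h))

/-- The averaging inequality gives the upper bound; the lower one comes from testing the indicator
against itself. -/
theorem IsIdealNorm.isNormed_dual (hN : IsIdealNorm N) (hS : Related N N) (ht : HasTilings μ)
    (hc : ∀ (e : Set Ω) (he : MeasurableSet e), μ e < ∞ → N (chi μ he) < ∞) (h1 : IsNormed N) :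
    IsNormed (dualNorm N) := by
  rw [isNormed_iff] at h1 ⊢
  intro e he hee
  refine le_antisymm ?_ ?_
  · have := hN.dual_chi_le hS ht hc he (by simp [hee]) (by simp [hee])
    simpa [hee, h1 e he hee] using this
  · refine le_trans ?_ (le_dualNorm (h1 e he hee))
    rw [lintegral_chi_mul]
    calc (1 : ℝ≥0∞) = ∫⁻ ω in e, 1 ∂μ := by simp [hee]
      _ ≤ _ := by
        refine lintegral_mono_ae ((ae_restrict_iff' he).2 ?_)
        filter_upwards [coeFn_chi (μ := μ) he] with ω h2 hω
        rw [h2, Set.indicator_of_mem hω, Pi.one_apply, enorm_one]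

/-- A test function `x` for `f` is copied cell by cell to a test function for `g`. On paired cells
`|f| ≤ c * c ^ k` and `c ^ k ≤ |g|`, while the copies of `x` have equal integrals, so the pairing
with `g` loses at most a factor `c`. -/
theorem dualNorm_le_of_equimeasurable (hR : Related N M) (hμν : Compatible μ ν)
    (hN : IsIdealNorm N) (hM : IsIdealNorm M) {f : Ω →ₘ[μ] ℝ} {g : Ω' →ₘ[ν] ℝ}
    (hfg : ∀ s, distrib f s = distrib g s) : dualNorm N f ≤ dualNorm M g := by
  refine iSup₂_le fun x hx => le_of_forall_one_lt_sq_mul fun c hc => ?_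
  have hc0 : 0 < c := by linarith
  obtain ⟨A, B, hA, hB, hAd, hBd, hAB, hcov, hfA, hgB⟩ := hμν.exists_cells f.measurable g.measurable
    hfg hc
  obtain ⟨k, hk, hk0, hkA⟩ := hμν.transfer_cells hA hB hBd hAB x.measurable
  have hUA : MeasurableSet (⋃ i, A i) := MeasurableSet.iUnion hA
  -- The cells need not cover `Ω`; `x` is cut down to their union. The norm does not grow, and the
  -- pairing with `f` is unaffected because `f` vanishes elsewhere.
  let z : Ω →ₘ[μ] ℝ := AEEqFun.mk ((⋃ i, A i).indicator x)
    (x.measurable.indicator hUA).aestronglyMeasurable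
  let y : Ω' →ₘ[ν] ℝ := AEEqFun.mk k hk.aestronglyMeasurable
  have hzy : N z = M y := hR _ _ fun s => by
    rw [distrib_mk, distrib_mk]
    have h1 : {ω | (s : ℝ) < |(⋃ i, A i).indicator x ω|} = ⋃ i, A i ∩ {ω | (s : ℝ) < |x ω|} := by
      rw [← Set.iUnion_inter]
      ext ω
      by_cases hω : ω ∈ ⋃ i, A i
      · simp only [Set.mem_ofPred_eq, Set.indicator_of_mem hω, Set.mem_inter_iff, hω, true_and]
      · simp only [Set.mem_ofPred_eq, Set.indicator_of_notMem hω, Set.mem_inter_iff, hω, abs_zero,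
          false_and, iff_false]
        exact not_lt.2 s.2
    have h2 : {ω | (s : ℝ) < |k ω|} = ⋃ i, B i ∩ {ω | (s : ℝ) < |k ω|} := by
      rw [← Set.iUnion_inter]
      refine (Set.inter_eq_right.2 fun ω hω => ?_).symm
      by_contra hcon
      have h3 : k ω = 0 := hk0 ω fun i hi => hcon (Set.mem_iUnion.2 ⟨i, hi⟩)
      have h4 : (s : ℝ) < |k ω| := hω
      rw [h3, abs_zero] at h4
      exact absurd h4 (not_lt.2 s.2)
    rw [h1, h2, measure_iUnion (fun i j hij => (hAd hij).mono Set.inter_subset_left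
      Set.inter_subset_left) fun i => (hA i).inter (measurableSet_lt measurable_const
        x.measurable.abs), measure_iUnion (fun i j hij => (hBd hij).mono Set.inter_subset_left
      Set.inter_subset_left) fun i => (hB i).inter (measurableSet_lt measurable_const hk.abs)]
    simp only [hkA]
  have hzx : N z ≤ 1 := by
    rw [← hx]
    refine hN.mono _ _ (abs_le_abs_iff_ae.2 ?_)
    filter_upwards [AEEqFun.coeFn_mk ((⋃ i, A i).indicator x)
      (x.measurable.indicator hUA).aestronglyMeasurable] with ω h1
    rw [h1]
    by_cases hω : ω ∈ ⋃ i, A i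
    · rw [Set.indicator_of_mem hω]
    · rw [Set.indicator_of_notMem hω, abs_zero]; exact abs_nonneg _
  have hint : ∀ i, ∫⁻ ω in A i, ‖x ω‖ₑ ∂μ = ∫⁻ ω in B i, ‖k ω‖ₑ ∂ν := fun i =>
    lintegral_enorm_eq_of_distribution x.measurable hk fun s => by
      rw [Measure.restrict_apply' (hA i), Measure.restrict_apply' (hB i), Set.inter_comm, ← hkA,
        Set.inter_comm]
  have hcell : ∀ i, ∫⁻ ω in A i, ‖f ω * x ω‖ₑ ∂μ ≤
      ENNReal.ofReal c * ∫⁻ ω in B i, ‖g ω * k ω‖ₑ ∂ν := fun i => by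
    have hci : 0 < c ^ i := zpow_pos hc0 i
    calc ∫⁻ ω in A i, ‖f ω * x ω‖ₑ ∂μ ≤ ∫⁻ ω in A i, ENNReal.ofReal (c * c ^ i) * ‖x ω‖ₑ ∂μ := by
          refine setLIntegral_mono' (hA i) fun ω hω => ?_
          rw [enorm_mul, Real.enorm_eq_ofReal_abs (f ω)]
          gcongr
          exact hfA i ω hω
      _ = ENNReal.ofReal c * (ENNReal.ofReal (c ^ i) * ∫⁻ ω in B i, ‖k ω‖ₑ ∂ν) := by
          rw [lintegral_const_mul' _ _ ENNReal.ofReal_ne_top, hint,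
            ENNReal.ofReal_mul hc0.le, mul_assoc]
      _ = ENNReal.ofReal c * ∫⁻ ω in B i, ENNReal.ofReal (c ^ i) * ‖k ω‖ₑ ∂ν := by
          rw [lintegral_const_mul' _ _ ENNReal.ofReal_ne_top]
      _ ≤ ENNReal.ofReal c * ∫⁻ ω in B i, ‖g ω * k ω‖ₑ ∂ν := by
          refine mul_le_mul' le_rfl (setLIntegral_mono' (hB i) fun ω hω => ?_)
          rw [enorm_mul, Real.enorm_eq_ofReal_abs (g ω)]
          gcongr
          exact hgB i ω hω
  have hyN : M y ≤ 1 := hzy ▸ hzx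
  calc ∫⁻ ω, ‖f ω * x ω‖ₑ ∂μ = ∫⁻ ω in ⋃ i, A i, ‖f ω * x ω‖ₑ ∂μ := by
        rw [← lintegral_indicator hUA]
        refine lintegral_congr fun ω => ?_
        by_cases hω : ω ∈ ⋃ i, A i
        · rw [Set.indicator_of_mem hω]
        · have h0 : f ω = 0 := by
            by_contra hne
            exact hω (Set.mem_iUnion.2 (hcov ω hne))
          rw [Set.indicator_of_notMem hω, h0, zero_mul, enorm_zero]
    _ = ∑' i, ∫⁻ ω in A i, ‖f ω * x ω‖ₑ ∂μ := lintegral_iUnion hA hAd _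
    _ ≤ ∑' i, ENNReal.ofReal c * ∫⁻ ω in B i, ‖g ω * k ω‖ₑ ∂ν := ENNReal.tsum_le_tsum hcell
    _ = ENNReal.ofReal c * ∫⁻ ω in ⋃ i, B i, ‖g ω * k ω‖ₑ ∂ν := by
        rw [ENNReal.tsum_mul_left, lintegral_iUnion hB hBd]
    _ ≤ ENNReal.ofReal (c * c) * ∫⁻ ω, ‖g ω * y ω‖ₑ ∂ν := by
        -- One factor `c` would do; `c * c` is the form of the limit lemma shared with sums.
        refine mul_le_mul' (ENNReal.ofReal_le_ofReal (by nlinarith)) ?_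
        refine (setLIntegral_le_lintegral _ _).trans (lintegral_congr_ae ?_).le
        filter_upwards [AEEqFun.coeFn_mk k hk.aestronglyMeasurable] with ω h
        rw [h]
    _ ≤ ENNReal.ofReal (c * c) * dualNorm M g := by
        gcongr
        calc ∫⁻ ω, ‖g ω * y ω‖ₑ ∂ν ≤ dualNorm M g * M y :=
              hM.lintegral_mul_le (hyN.trans_lt ENNReal.one_lt_top)
          _ ≤ dualNorm M g * 1 := by gcongr
          _ = dualNorm M g := mul_one _

theorem Related.dual (hR : Related N M) (hμν : Compatible μ ν) (hνμ : Compatible ν μ)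
    (hN : IsIdealNorm N) : Related (dualNorm N) (dualNorm M) := fun _ _ hxy =>
  have hM := hR.isIdealNorm hνμ hN
  le_antisymm (dualNorm_le_of_equimeasurable hR hμν hN hM hxy)
    (dualNorm_le_of_equimeasurable hR.symm hνμ hM hN fun s => (hxy s).symm)

/-- The norming condition passes to sums. -/
theorem IsIdealNorm.isNormed_sum {N' : (Ω →ₘ[μ] ℝ) → ℝ≥0∞} (hN : IsIdealNorm N)
    (hN' : IsIdealNorm N') (hS : Related N N) (hS' : Related N' N') (ht : HasTilings μ)
    (h1 : IsNormed N) (h1' : IsNormed N') : IsNormed (sumNorm N N') := by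
  rw [isNormed_iff] at h1 h1' ⊢
  intro e he hee
  refine le_antisymm ?_ (le_iInf fun u => le_iInf fun v => le_iInf fun huv => ?_)
  · refine (sumNorm_le_of_eq (add_zero (chi μ he))).trans ?_
    rw [h1 e he hee, hN'.map_zero, add_zero]
  · have hu := hN.setLIntegral_mul_le hS ht he (by simp [hee]) u
    have hv := hN'.setLIntegral_mul_le hS' ht he (by simp [hee]) v
    rw [h1 e he hee, hee, mul_one, one_mul] at hu
    rw [h1' e he hee, hee, mul_one, one_mul] at hv
    refine le_trans ?_ (add_le_add hu hv)
    rw [← lintegral_add_left u.measurable.enorm]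
    calc (1 : ℝ≥0∞) = ∫⁻ ω in e, 1 ∂μ := by simp [hee]
      _ ≤ _ := by
        refine lintegral_mono_ae ((ae_restrict_iff' he).2 ?_)
        filter_upwards [AEEqFun.coeFn_add u v, coeFn_chi (μ := μ) he] with ω h2 h3 hω
        rw [huv, h3, Set.indicator_of_mem hω, Pi.one_apply, Pi.add_apply] at h2
        rw [← enorm_one (G := ℝ), h2]
        exact enorm_add_le _ _

end Dual

/-! ### Elements of order continuous norm form a closed ideal -/

section OrderContinuous

variable {Ω : Type u} [MeasurableSpace Ω] {μ : Measure Ω} {N : (Ω →ₘ[μ] ℝ) → ℝ≥0∞}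

theorem isOrderContinuousAt_zero (h0 : N 0 = 0) : IsOrderContinuousAt N 0 := by
  rintro D ⟨d, hd⟩ - hG hle ε hε
  refine ⟨d, hd, ?_⟩
  rw [le_antisymm ((hle d hd).trans abs_zero.le) (hG.1 hd), h0]
  exact hε

theorem IsOrderContinuousAt.mono {x y : Ω →ₘ[μ] ℝ} (h : IsOrderContinuousAt N y)
    (hxy : |x| ≤ |y|) : IsOrderContinuousAt N x := fun D hne hdir hG hle =>
  h D hne hdir hG fun d hd => (hle d hd).trans hxy

/-- Removes the domination by `|x|`: the truncations `d ⊓ |x|` again decrease to `0`. In this form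
the continuity of a summand applies to nets bounded by the sum only. -/
theorem IsOrderContinuousAt.exists_inf_lt {x : Ω →ₘ[μ] ℝ} (h : IsOrderContinuousAt N x)
    {D : Set (Ω →ₘ[μ] ℝ)} (hne : D.Nonempty) (hdir : DirectedOn (fun a b => b ≤ a) D)
    (hG : IsGLB D 0) {ε : ℝ≥0∞} (hε : 0 < ε) : ∃ d ∈ D, N (d ⊓ |x|) < ε := by
  have h1 : ∃ e ∈ (fun d => d ⊓ |x|) '' D, N e < ε := by
    refine h _ (hne.image _) ?_ ⟨?_, ?_⟩ ?_ ε hε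
    · rintro - ⟨a, ha, rfl⟩ - ⟨b, hb, rfl⟩
      obtain ⟨c, hc, hca, hcb⟩ := hdir a ha b hb
      exact ⟨_, ⟨c, hc, rfl⟩, inf_le_inf_right _ hca, inf_le_inf_right _ hcb⟩
    · rintro - ⟨a, ha, rfl⟩
      exact le_inf (hG.1 ha) (abs_nonneg _)
    · exact fun z hz => hG.2 fun a ha => (hz ⟨a, ha, rfl⟩).trans inf_le_left
    · rintro - ⟨a, ha, rfl⟩
      exact inf_le_right
  simpa using h1

theorem le_inf_abs_add_inf_abs {d x y : Ω →ₘ[μ] ℝ} (h0 : 0 ≤ d) (h : d ≤ |x| + |y|) :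
    d ≤ d ⊓ |x| + d ⊓ |y| := by
  have h1 : d - d ⊓ |x| ≤ d ⊓ |y| := by
    refine le_inf (sub_le_self _ (le_inf h0 (abs_nonneg _))) ?_
    rw [sub_le_iff_le_add, add_inf, le_inf_iff]
    exact ⟨le_add_of_nonneg_left (abs_nonneg _), by rwa [add_comm]⟩
  rwa [sub_le_iff_le_add'] at h1

theorem IsIdealNorm.le_inf_add_inf (hN : IsIdealNorm N) {d d' x y : Ω →ₘ[μ] ℝ} (h0 : 0 ≤ d)
    (hdd : d ≤ d') (h : d ≤ |x| + |y|) : N d ≤ N (d' ⊓ |x|) + N (d ⊓ |y|) :=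
  calc N d ≤ N (d ⊓ |x| + d ⊓ |y|) := hN.mono_of_nonneg h0 (le_inf_abs_add_inf_abs h0 h)
    _ ≤ N (d ⊓ |x|) + N (d ⊓ |y|) := hN.add_le _ _
    _ ≤ _ := add_le_add_left (hN.mono_of_nonneg (le_inf h0 (abs_nonneg _))
        (inf_le_inf_right _ hdd)) _

theorem IsIdealNorm.isOrderContinuousAt_add (hN : IsIdealNorm N) {x y : Ω →ₘ[μ] ℝ}
    (hx : IsOrderContinuousAt N x) (hy : IsOrderContinuousAt N y) :
    IsOrderContinuousAt N (x + y) := by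
  intro D hne hdir hG hle ε hε
  obtain ⟨a, ha, haε⟩ := hx.exists_inf_lt hne hdir hG (ENNReal.half_pos hε.ne')
  obtain ⟨b, hb, hbε⟩ := hy.exists_inf_lt hne hdir hG (ENNReal.half_pos hε.ne')
  obtain ⟨c, hc, hca, hcb⟩ := hdir a ha b hb
  refine ⟨c, hc, (hN.le_inf_add_inf (hG.1 hc) hca ((hle c hc).trans (abs_add_le x y))).trans_lt ?_⟩
  rw [← ENNReal.add_halves ε]
  exact ENNReal.add_lt_add haε ((hN.mono_of_nonneg (le_inf (hG.1 hc) (abs_nonneg _))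
    (inf_le_inf_right _ hcb)).trans_lt hbε)

/-- Closedness of `E₀`, which makes it complete: `d` is at most the sum of `d ⊓ |y|` and `d ⊓ |x -
y|`, and the second part is small for every `d`. -/
theorem IsIdealNorm.isOrderContinuousAt_of_approx (hN : IsIdealNorm N) {x : Ω →ₘ[μ] ℝ}
    (h : ∀ ε : ℝ≥0∞, 0 < ε → ∃ y, IsOrderContinuousAt N y ∧ N (x - y) < ε) :
    IsOrderContinuousAt N x := by
  intro D hne hdir hG hle ε hε
  obtain ⟨y, hy, hyε⟩ := h (ε / 2) (ENNReal.half_pos hε.ne')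
  obtain ⟨a, ha, haε⟩ := hy.exists_inf_lt hne hdir hG (ENNReal.half_pos hε.ne')
  have hax : a ≤ |y| + |x - y| := (hle a ha).trans (by simpa using abs_add_le y (x - y))
  refine ⟨a, ha, (hN.le_inf_add_inf (hG.1 ha) le_rfl hax).trans_lt ?_⟩
  rw [← ENNReal.add_halves ε]
  refine ENNReal.add_lt_add haε (lt_of_le_of_lt ?_ hyε)
  rw [← hN.map_abs (x - y)]
  exact hN.mono_of_nonneg (le_inf (hG.1 ha) (abs_nonneg _)) inf_le_right

theorem abs_smul_ae (c : ℝ) (x : Ω →ₘ[μ] ℝ) : ∀ᵐ ω ∂μ, |(c • x) ω| = |c| * |x ω| := by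
  filter_upwards [AEEqFun.coeFn_smul c x] with ω h
  rw [h, Pi.smul_apply, smul_eq_mul, abs_mul]

theorem IsIdealNorm.isOrderContinuousAt_smul (hN : IsIdealNorm N) {x : Ω →ₘ[μ] ℝ}
    (hx : IsOrderContinuousAt N x) (c : ℝ) : IsOrderContinuousAt N (c • x) := by
  have h1 : ∀ n : ℕ, IsOrderContinuousAt N ((n : ℝ) • x) := by
    intro n
    induction n with
    | zero => simpa using isOrderContinuousAt_zero hN.map_zero
    | succ n ih =>
      rw [Nat.cast_succ, add_smul, one_smul]
      exact hN.isOrderContinuousAt_add ih hx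
  obtain ⟨n, hn⟩ := exists_nat_ge |c|
  refine (h1 n).mono (abs_le_abs_iff_ae.2 ?_)
  filter_upwards [abs_smul_ae c x, abs_smul_ae (n : ℝ) x] with ω h2 h3
  rw [h2, h3, Nat.abs_cast]
  gcongr

theorem le_ocNorm (x : Ω →ₘ[μ] ℝ) : N x ≤ ocNorm N x := by
  unfold ocNorm
  split_ifs
  exacts [le_rfl, le_top]

theorem ocNorm_of_isOrderContinuousAt {x : Ω →ₘ[μ] ℝ} (h : IsOrderContinuousAt N x) :
    ocNorm N x = N x := if_pos h

theorem isOrderContinuousAt_of_ocNorm_lt_top {x : Ω →ₘ[μ] ℝ} (h : ocNorm N x < ∞) :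
    IsOrderContinuousAt N x := by
  by_contra hcon
  exact h.ne (if_neg hcon)

theorem IsIdealNorm.oc (hN : IsIdealNorm N) : IsIdealNorm (ocNorm N) where
  eq_zero_iff x := by
    refine ⟨fun h => (hN.eq_zero_iff x).1 (le_zero_iff.1 ((le_ocNorm x).trans h.le)), ?_⟩
    rintro rfl
    rw [ocNorm_of_isOrderContinuousAt (isOrderContinuousAt_zero hN.map_zero), hN.map_zero]
  smul c x := by
    rcases eq_or_ne c 0 with rfl | hc
    · rw [zero_smul, ocNorm_of_isOrderContinuousAt (isOrderContinuousAt_zero hN.map_zero),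
        hN.map_zero, enorm_zero, zero_mul]
    · by_cases hx : IsOrderContinuousAt N x
      · rw [ocNorm_of_isOrderContinuousAt hx,
          ocNorm_of_isOrderContinuousAt (hN.isOrderContinuousAt_smul hx c), hN.smul]
      · have hcx : ¬ IsOrderContinuousAt N (c • x) := fun h => hx <| by
          simpa [smul_smul, inv_mul_cancel₀ hc] using hN.isOrderContinuousAt_smul h c⁻¹
        rw [ocNorm, ocNorm, if_neg hx, if_neg hcx, ENNReal.mul_top (by simpa using hc)]
  add_le x y := by
    by_cases hx : IsOrderContinuousAt N x
    · by_cases hy : IsOrderContinuousAt N y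
      · rw [ocNorm_of_isOrderContinuousAt hx, ocNorm_of_isOrderContinuousAt hy,
          ocNorm_of_isOrderContinuousAt (hN.isOrderContinuousAt_add hx hy)]
        exact hN.add_le x y
      · rw [show ocNorm N y = ∞ from if_neg hy, add_top]
        exact le_top
    · rw [show ocNorm N x = ∞ from if_neg hx, top_add]
      exact le_top
  mono x y hxy := by
    by_cases hy : IsOrderContinuousAt N y
    · rw [ocNorm_of_isOrderContinuousAt hy, ocNorm_of_isOrderContinuousAt (hy.mono hxy)]
      exact hN.mono x y hxy
    · rw [show ocNorm N y = ∞ from if_neg hy]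
      exact le_top

theorem IsBanachIdealNorm.oc (hN : IsBanachIdealNorm N) : IsBanachIdealNorm (ocNorm N) where
  eq_zero_iff := hN.isIdealNorm.oc.eq_zero_iff
  smul := hN.isIdealNorm.oc.smul
  add_le := hN.isIdealNorm.oc.add_le
  mono := hN.isIdealNorm.oc.mono
  complete x hx hcau := by
    have hI := hN.isIdealNorm
    obtain ⟨y, hy, hlim⟩ := hN.complete x (fun n => (le_ocNorm _).trans_lt (hx n)) fun ε hε =>
      (hcau ε hε).imp fun K hK m hm n hn => (le_ocNorm _).trans_lt (hK m hm n hn)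
    have hxo : ∀ n, IsOrderContinuousAt N (x n) := fun n =>
      isOrderContinuousAt_of_ocNorm_lt_top (hx n)
    have hyo : IsOrderContinuousAt N y := hI.isOrderContinuousAt_of_approx fun ε hε => by
      obtain ⟨n, hn⟩ := (hlim.eventually (gt_mem_nhds hε)).exists
      exact ⟨x n, hxo n, by rwa [hI.map_sub_comm]⟩
    refine ⟨y, by rwa [ocNorm_of_isOrderContinuousAt hyo], ?_⟩
    have h1 : ∀ n, IsOrderContinuousAt N (x n - y) := fun n => by
      rw [sub_eq_add_neg]
      exact hI.isOrderContinuousAt_add (hxo n) (hyo.mono (abs_neg y).le)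
    simpa only [ocNorm_of_isOrderContinuousAt (h1 _)] using hlim

end OrderContinuous

/-! ### Order continuity from conditions on the distribution -/

section OrderContinuity

variable {Ω : Type u} [MeasurableSpace Ω] {μ : Measure Ω} {N : (Ω →ₘ[μ] ℝ) → ℝ≥0∞}

/-- A set directed downwards to zero has members that are small off sets of small measure. -/
theorem exists_mem_measure_lt {D : Set (Ω →ₘ[μ] ℝ)} (hne : D.Nonempty)
    (hdir : DirectedOn (fun a b => b ≤ a) D) (hG : IsGLB D 0) {Q : Set Ω} (hQ : MeasurableSet Q)
    (hQf : μ Q < ∞) {η : ℝ} (hη : 0 < η) {ρ : ℝ≥0∞} (hρ : 0 < ρ) :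
    ∃ d ∈ D, μ (Q ∩ {ω | η < d ω}) < ρ := by
  let f : (Ω →ₘ[μ] ℝ) → Ω → ℝ≥0∞ := fun d ω => ENNReal.ofReal (min (d ω) 1)
  have hf : ∀ d, Measurable (f d) := fun d => (d.measurable.min measurable_const).ennreal_ofReal
  have hf1 : ∀ d ω, f d ω ≤ 1 := fun d ω =>
    (ENNReal.ofReal_le_ofReal (min_le_right _ _)).trans ENNReal.ofReal_one.le
  have hfmono : ∀ {a b : Ω →ₘ[μ] ℝ}, a ≤ b → f a ≤ᵐ[μ.restrict Q] f b := fun {a b} hab =>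
    ae_restrict_of_ae <| (AEEqFun.coeFn_le.2 hab).mono fun ω h =>
      ENNReal.ofReal_le_ofReal (min_le_min_right _ h)
  let φ : (Ω →ₘ[μ] ℝ) → ℝ≥0∞ := fun d => ∫⁻ ω in Q, f d ω ∂μ
  have hφ : ∀ g : Ω → ℝ≥0∞, (∀ ω, g ω ≤ 1) → ∫⁻ ω in Q, g ω ∂μ ≠ ∞ := fun g hg =>
    ((lintegral_mono hg).trans_lt (by simpa using hQf)).ne
  -- The directed set may be uncountable, so it is controlled through integrals over `Q`: a
  -- decreasing sequence in `D` already reaches their infimum `m`.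
  set m : ℝ≥0∞ := ⨅ d ∈ D, φ d with hm
  have hmle : ∀ d ∈ D, m ≤ φ d := fun d hd => iInf₂_le d hd
  have hmt : m ≠ ∞ := by
    obtain ⟨d, hd⟩ := hne
    exact ((hmle d hd).trans_lt (hφ _ (hf1 d)).lt_top).ne
  have hlt : ∀ c, m < c → ∃ d ∈ D, φ d < c := fun c h => by
    simpa only [hm, iInf_lt_iff, exists_prop] using h
  have hnear : ∀ n : ℕ, ∃ d ∈ D, φ d < m + (n + 1 : ℝ≥0∞)⁻¹ := fun n => by
    have h1 : m < m + (n + 1 : ℝ≥0∞)⁻¹ :=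
      ENNReal.lt_add_right hmt (by simp)
    exact hlt _ h1
  obtain ⟨a, ha⟩ := exists_seq_dep (P := fun n d => d ∈ D ∧ φ d < m + (n + 1 : ℝ≥0∞)⁻¹)
    (Q := fun _ d e => e ≤ d) (by simpa using hnear 0) (fun n d hd => by
      obtain ⟨e, he, heφ⟩ := hnear (n + 1)
      obtain ⟨c, hc, hcd, hce⟩ := hdir d hd.1 e he
      exact ⟨c, ⟨hc, (lintegral_mono_ae (hfmono hce)).trans_lt heφ⟩, hcd⟩)
  have hlim : ⨅ n, φ (a n) = m := by
    refine le_antisymm ?_ (le_iInf fun n => hmle _ (ha n).1.1)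
    have h1 : Tendsto (fun n : ℕ => m + (n + 1 : ℝ≥0∞)⁻¹) atTop (𝓝 (m + 0)) := by
      refine tendsto_const_nhds.add ?_
      simpa using (tendsto_add_atTop_iff_nat 1).2 ENNReal.tendsto_inv_nat_nhds_zero
    rw [add_zero] at h1
    exact ge_of_tendsto' h1 fun n => (iInf_le _ n).trans (ha n).1.2.le
  let g : Ω → ℝ≥0∞ := fun ω => ⨅ n, f (a n) ω
  have hg : Measurable g := Measurable.iInf fun n => hf (a n)
  have hg1 : ∀ ω, g ω ≤ 1 := fun ω => (iInf_le _ 0).trans (hf1 _ ω)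
  have hgm : ∫⁻ ω in Q, g ω ∂μ = m := by
    rw [lintegral_iInf_ae (fun n => hf (a n)) (fun n => hfmono (ha n).2) (hφ _ (hf1 _))]
    exact hlim
  -- By directedness the minimum of `g` and `f d` still has integral at least `m`, so it equals `g`
  -- almost everywhere on `Q`. Thus `g` restricted to `Q` gives a lower bound of `D`, which forces
  -- `m = 0`.
  have hgd : ∀ d ∈ D, ∀ᵐ ω ∂μ.restrict Q, g ω ≤ f d ω := by
    intro d hd
    have h1 : ∫⁻ ω in Q, g ω ∂μ ≤ ∫⁻ ω in Q, min (g ω) (f d ω) ∂μ := by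
      have h2 : ∀ ω, min (g ω) (f d ω) = ⨅ n, min (f (a n) ω) (f d ω) := fun ω => iInf_inf
      simp only [h2]
      rw [hgm, lintegral_iInf_ae (fun n => (hf (a n)).min (hf d))
        (fun n => (hfmono (ha n).2).mono fun ω h => min_le_min_right _ h)
        (hφ _ fun ω => (min_le_left _ _).trans (hf1 _ ω))]
      refine le_iInf fun n => ?_
      obtain ⟨c, hc, hca, hcd⟩ := hdir _ (ha n).1.1 d hd
      refine (hmle c hc).trans (lintegral_mono_ae ?_)
      filter_upwards [hfmono hca, hfmono hcd] with ω h3 h4 using le_min h3 h4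
    have h5 := ae_eq_of_ae_le_of_lintegral_le (ae_of_all _ fun ω => min_le_left (g ω) (f d ω))
      (hφ _ fun ω => (min_le_left _ _).trans (hg1 ω)) hg.aemeasurable h1
    filter_upwards [h5] with ω h6
    exact h6.symm.le.trans (min_le_right _ _)
  let z : Ω →ₘ[μ] ℝ := AEEqFun.mk (Q.indicator fun ω => (g ω).toReal)
    (hg.ennreal_toReal.indicator hQ).aestronglyMeasurable
  have hz : z =ᵐ[μ] Q.indicator fun ω => (g ω).toReal := AEEqFun.coeFn_mk _ _
  have hz0 : z ≤ 0 := hG.2 fun d hd => by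
    rw [← AEEqFun.coeFn_le]
    filter_upwards [hz, (ae_restrict_iff' hQ).1 (hgd d hd), AEEqFun.coeFn_le.2 (hG.1 hd),
      AEEqFun.coeFn_zero (β := ℝ) (μ := μ)] with ω h1 h2 h3 h4
    rw [h4] at h3
    rw [h1]
    by_cases hω : ω ∈ Q
    · rw [Set.indicator_of_mem hω]
      exact ENNReal.toReal_le_of_le_ofReal h3
        ((h2 hω).trans (ENNReal.ofReal_le_ofReal (min_le_left _ _)))
    · rwa [Set.indicator_of_notMem hω]
  have hm0 : m = 0 := by
    rw [← hgm, lintegral_eq_zero_iff hg]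
    refine (ae_restrict_iff' hQ).2 ?_
    filter_upwards [hz, AEEqFun.coeFn_le.2 hz0, AEEqFun.coeFn_zero (β := ℝ) (μ := μ)]
      with ω h1 h2 h3 hω
    rw [h1, h3, Set.indicator_of_mem hω] at h2
    have h4 : (g ω).toReal = 0 := le_antisymm h2 ENNReal.toReal_nonneg
    exact ((ENNReal.toReal_eq_zero_iff _).1 h4).resolve_right
      ((hg1 ω).trans_lt ENNReal.one_lt_top).ne
  have hk : 0 < min η 1 := lt_min hη one_pos
  have h1 : m < ENNReal.ofReal (min η 1) * ρ := by
    rw [hm0]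
    exact ENNReal.mul_pos (ENNReal.ofReal_pos.2 hk).ne' hρ.ne'
  obtain ⟨d, hd, hdφ⟩ := hlt _ h1
  refine ⟨d, hd, ?_⟩
  -- Markov's inequality; the level is capped at `1` because `f d` is.
  have h2 : ENNReal.ofReal (min η 1) * μ (Q ∩ {ω | η < d ω}) ≤ φ d := by
    refine le_trans ?_ (mul_meas_ge_le_lintegral (hf d) (ENNReal.ofReal (min η 1)))
    refine mul_le_mul' le_rfl ?_
    rw [Measure.restrict_apply' hQ, Set.inter_comm]
    refine measure_mono (Set.inter_subset_inter_left _ fun ω hω => ?_)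
    exact ENNReal.ofReal_le_ofReal (min_le_min_right _ (le_of_lt hω))
  exact (ENNReal.mul_lt_mul_iff_right (ENNReal.ofReal_pos.2 hk).ne' ENNReal.ofReal_ne_top).1
    (h2.trans_lt hdφ)

/-- The part of `|x|` above the level `K`. -/
noncomputable def tail (x : Ω →ₘ[μ] ℝ) (K : ℝ≥0) : Ω →ₘ[μ] ℝ :=
  AEEqFun.mk (fun ω => max (|x ω| - K) 0)
    ((x.measurable.abs.sub_const _).max measurable_const).aestronglyMeasurable

/-- The part of `|x|` below the level `δ`. -/
noncomputable def trunc (x : Ω →ₘ[μ] ℝ) (δ : ℝ≥0) : Ω →ₘ[μ] ℝ :=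
  AEEqFun.mk (fun ω => min |x ω| δ) (x.measurable.abs.min measurable_const).aestronglyMeasurable

theorem coeFn_tail (x : Ω →ₘ[μ] ℝ) (K : ℝ≥0) : tail x K =ᵐ[μ] fun ω => max (|x ω| - K) 0 :=
  AEEqFun.coeFn_mk _ _

theorem coeFn_trunc (x : Ω →ₘ[μ] ℝ) (δ : ℝ≥0) : trunc x δ =ᵐ[μ] fun ω => min |x ω| δ :=
  AEEqFun.coeFn_mk _ _

theorem distrib_tail (x : Ω →ₘ[μ] ℝ) (K s : ℝ≥0) : distrib (tail x K) s = distrib x (s + K) := by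
  rw [distrib_eq_of_ae (coeFn_tail x K), distrib]
  congr 1
  ext ω
  simp only [Set.mem_ofPred_eq, abs_of_nonneg (le_max_right _ (0 : ℝ)), lt_max_iff, NNReal.coe_add]
  rw [or_iff_left (not_lt.2 s.coe_nonneg), lt_sub_iff_add_lt]

theorem distrib_trunc (x : Ω →ₘ[μ] ℝ) (δ s : ℝ≥0) :
    distrib (trunc x δ) s = if s < δ then distrib x s else 0 := by
  rw [distrib_eq_of_ae (coeFn_trunc x δ), distrib]
  have h : ∀ ω, |min |x ω| δ| = min |x ω| δ := fun ω => abs_of_nonneg (le_min (abs_nonneg _) δ.2)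
  simp only [h, lt_min_iff, NNReal.coe_lt_coe]
  split_ifs with hs <;> simp [hs]

/-- The conditions on the distribution of `x` that characterize order continuity. -/
structure HasSmallParts (N : (Ω →ₘ[μ] ℝ) → ℝ≥0∞) (x : Ω →ₘ[μ] ℝ) : Prop where
  distrib_lt_top : ∀ s, 0 < s → distrib x s < ∞
  tail : ∀ ε : ℝ≥0∞, 0 < ε → ∃ K, N (tail x K) < ε
  trunc : ∀ ε : ℝ≥0∞, 0 < ε → ∃ δ, 0 < δ ∧ N (trunc x δ) < ε
  chi : ∀ ε : ℝ≥0∞, 0 < ε → ∃ δ : ℝ≥0∞, 0 < δ ∧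
    ∀ (e : Set Ω) (he : MeasurableSet e), μ e < δ → N (chi μ he) < ε

theorem exists_smul_lt (c : ℝ≥0∞) (hc : c ≠ ∞) {ε : ℝ≥0∞} (hε : 0 < ε) :
    ∃ η : ℝ, 0 < η ∧ ‖η‖ₑ * c < ε := by
  obtain ⟨t, ht0, ht⟩ := ENNReal.exists_nnreal_pos_mul_lt hc hε.ne'
  exact ⟨t, ht0, by rwa [Real.enorm_eq_ofReal t.coe_nonneg, ENNReal.ofReal_coe_nnreal]⟩

/-- With `Q = {|x| > δ}` and `R = Q ∩ {d > η}` one has `d ≤ trunc x δ + tail x K + η χ_Q + K χ_R`.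
The first two terms are small by the choice of `δ` and `K`, the third by that of `η`, since `χ_Q`
has finite norm, and the last because `R` has small measure for a suitable `d`. -/
theorem IsIdealNorm.isOrderContinuousAt_of_hasSmallParts (hN : IsIdealNorm N)
    (hc : ∀ (e : Set Ω) (he : MeasurableSet e), μ e < ∞ → N (SymSpaces.chi μ he) < ∞)
    {x : Ω →ₘ[μ] ℝ} (h : HasSmallParts N x) : IsOrderContinuousAt N x := by
  intro D hne hdir hG hle ε hε
  have hε4 : 0 < ε / 2 / 2 := ENNReal.half_pos (ENNReal.half_pos hε.ne').ne'
  obtain ⟨K, hK⟩ := h.tail _ hε4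
  obtain ⟨δ, hδ0, hδ⟩ := h.trunc _ hε4
  have hQ : MeasurableSet {ω | (δ : ℝ) < |x ω|} := measurableSet_lt measurable_const x.measurable.abs
  have hQf : μ {ω | (δ : ℝ) < |x ω|} < ∞ := h.distrib_lt_top δ hδ0
  generalize hQd : {ω | (δ : ℝ) < |x ω|} = Q at hQ hQf
  obtain ⟨η, hη, hηε⟩ := exists_smul_lt _ (hc Q hQ hQf).ne hε4
  -- The summand `1` keeps the denominator nonzero when `K = 0`.
  obtain ⟨ρ, hρ0, hρ⟩ := h.chi (ε / 2 / 2 / (‖(K : ℝ)‖ₑ + 1))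
    (ENNReal.div_pos hε4.ne' (by simp))
  obtain ⟨d, hd, hdρ⟩ := exists_mem_measure_lt hne hdir hG hQ hQf hη hρ0
  have hR : MeasurableSet (Q ∩ {ω | η < d ω}) :=
    hQ.inter (measurableSet_lt measurable_const d.measurable)
  have hKR : ‖(K : ℝ)‖ₑ * N (SymSpaces.chi μ hR) < ε / 2 / 2 := by
    have h1 := hρ _ hR hdρ
    rw [ENNReal.lt_div_iff_mul_lt (by simp) (by simp)] at h1
    refine lt_of_le_of_lt ?_ h1
    rw [mul_comm]
    gcongr
    exact le_self_add
  refine ⟨d, hd, ?_⟩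
  have hd4 : d ≤ (SymSpaces.trunc x δ + SymSpaces.tail x K) +
      (η • SymSpaces.chi μ hQ + (K : ℝ) • SymSpaces.chi μ hR) := by
    rw [← AEEqFun.coeFn_le]
    filter_upwards [AEEqFun.coeFn_add (SymSpaces.trunc x δ + SymSpaces.tail x K)
      (η • SymSpaces.chi μ hQ + (K : ℝ) • SymSpaces.chi μ hR),
      AEEqFun.coeFn_add (SymSpaces.trunc x δ) (SymSpaces.tail x K),
      AEEqFun.coeFn_add (η • SymSpaces.chi μ hQ) ((K : ℝ) • SymSpaces.chi μ hR),
      AEEqFun.coeFn_smul η (SymSpaces.chi μ hQ), AEEqFun.coeFn_smul (K : ℝ) (SymSpaces.chi μ hR),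
      coeFn_chi (μ := μ) hQ, coeFn_chi (μ := μ) hR, coeFn_trunc x δ, coeFn_tail x K,
      AEEqFun.coeFn_le.2 (hle d hd), AEEqFun.coeFn_abs x] with ω h1 h2 h3 h4 h5 h6 h7 h8 h9 h10 h11
    rw [h1, Pi.add_apply, h2, h3, Pi.add_apply, Pi.add_apply, h4, h5, Pi.smul_apply, Pi.smul_apply,
      h6, h7, h8, h9]
    rw [h11] at h10
    simp only [smul_eq_mul]
    have hK0 : (0 : ℝ) ≤ K := K.2
    have h12 : 0 ≤ max (|x ω| - K) 0 := le_max_right _ _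
    have h13 : |x ω| - K ≤ max (|x ω| - K) 0 := le_max_left _ _
    by_cases hω : ω ∈ Q
    · have h14 : 0 ≤ min |x ω| δ := le_min (abs_nonneg _) δ.2
      rw [Set.indicator_of_mem hω]
      by_cases hω' : η < d ω
      · rw [Set.indicator_of_mem (show ω ∈ Q ∩ {ω | η < d ω} from ⟨hω, hω'⟩)]
        simp only [Pi.one_apply]
        linarith
      · rw [Set.indicator_of_notMem fun h => hω' h.2]
        simp only [Pi.one_apply]
        linarith
    · have h14 : min |x ω| δ = |x ω| := min_eq_left (by
        rw [← hQd] at hω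
        exact not_lt.1 hω)
      rw [Set.indicator_of_notMem hω, Set.indicator_of_notMem fun h => hω h.1, h14]
      linarith
  calc N d ≤ N ((SymSpaces.trunc x δ + SymSpaces.tail x K) +
      (η • SymSpaces.chi μ hQ + (K : ℝ) • SymSpaces.chi μ hR)) := hN.mono_of_nonneg (hG.1 hd) hd4
    _ ≤ (N (SymSpaces.trunc x δ) + N (SymSpaces.tail x K)) +
      (‖η‖ₑ * N (SymSpaces.chi μ hQ) + ‖(K : ℝ)‖ₑ * N (SymSpaces.chi μ hR)) := by
      rw [← hN.smul, ← hN.smul]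
      exact (hN.add_le _ _).trans (add_le_add (hN.add_le _ _) (hN.add_le _ _))
    _ < (ε / 2 / 2 + ε / 2 / 2) + (ε / 2 / 2 + ε / 2 / 2) :=
      ENNReal.add_lt_add (ENNReal.add_lt_add hδ hK) (ENNReal.add_lt_add hηε hKR)
    _ = ε := by rw [ENNReal.add_halves, ENNReal.add_halves]

theorem IsOrderContinuousAt.exists_seq_lt {x : Ω →ₘ[μ] ℝ} (h : IsOrderContinuousAt N x)
    {z : ℕ → Ω →ₘ[μ] ℝ} (hz : Antitone z) (h0 : ∀ n, 0 ≤ z n)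
    (hlim : ∀ᵐ ω ∂μ, Tendsto (fun n => z n ω) atTop (𝓝 0)) (hle : ∀ n, z n ≤ |x|)
    {ε : ℝ≥0∞} (hε : 0 < ε) : ∃ n, N (z n) < ε := by
  have h1 : ∃ d ∈ Set.range z, N d < ε := by
    refine h _ (Set.range_nonempty z) ?_ ⟨?_, fun w hw => ?_⟩ ?_ ε hε
    · rintro - ⟨m, rfl⟩ - ⟨n, rfl⟩
      exact ⟨_, ⟨max m n, rfl⟩, hz (le_max_left _ _), hz (le_max_right _ _)⟩
    · rintro - ⟨n, rfl⟩
      exact h0 n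
    · rw [← AEEqFun.coeFn_le]
      filter_upwards [hlim, ae_all_iff.2 fun n => AEEqFun.coeFn_le.2 (hw ⟨n, rfl⟩),
        AEEqFun.coeFn_zero (β := ℝ) (μ := μ)] with ω h1 h2 h3
      rw [h3]
      exact ge_of_tendsto' h1 h2
    · rintro - ⟨n, rfl⟩
      exact hle n
  simpa using h1

end OrderContinuity

/-! ### Conditions on the distribution from order continuity -/

section OrderContinuity

variable {Ω : Type u} [MeasurableSpace Ω] {μ : Measure Ω} {N : (Ω →ₘ[μ] ℝ) → ℝ≥0∞}

theorem smul_chi_ae (c : ℝ) {e : Set Ω} (he : MeasurableSet e) :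
    (c • chi μ he : Ω →ₘ[μ] ℝ) =ᵐ[μ] e.indicator fun _ => c := by
  filter_upwards [AEEqFun.coeFn_smul c (chi μ he), coeFn_chi (μ := μ) he] with ω h1 h2
  rw [h1, Pi.smul_apply, h2]
  by_cases hω : ω ∈ e <;> simp [hω]

/-- If `A = {|x| > s}` had infinite measure, the functions `s χ_{A \ B}` with `μ B < ∞` would
decrease to `0` below `|x|`, though all are equimeasurable with `s χ_A`. -/
theorem IsIdealNorm.distrib_lt_top_of_isOrderContinuousAt (hN : IsIdealNorm N)
    (hS : Related N N) (hu : HasUnits μ) {x : Ω →ₘ[μ] ℝ} (h : IsOrderContinuousAt N x) {s : ℝ≥0}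
    (hs : 0 < s) : distrib x s < ∞ := by
  by_contra htop
  rw [not_lt_top_iff] at htop
  have hs0 : (0 : ℝ) < s := hs
  have hA : MeasurableSet {ω | (s : ℝ) < |x ω|} := measurableSet_lt measurable_const x.measurable.abs
  have hsub : ∀ B : Set Ω, ∀ᵐ ω ∂μ, ({ω | (s : ℝ) < |x ω|} \ B).indicator (fun _ => (s : ℝ)) ω ≤
      |x ω| := fun B => ae_of_all _ fun ω => by
    by_cases hω : ω ∈ {ω | (s : ℝ) < |x ω|} \ B
    · rw [Set.indicator_of_mem hω]
      exact le_of_lt hω.1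
    · rw [Set.indicator_of_notMem hω]
      exact abs_nonneg _
  have hAt : μ {ω | (s : ℝ) < |x ω|} = ∞ := htop
  generalize {ω | (s : ℝ) < |x ω|} = A at hA hsub hAt
  let D : Set (Ω →ₘ[μ] ℝ) := {d | ∃ (B : Set Ω) (hB : MeasurableSet B), μ B < ∞ ∧
    d = (s : ℝ) • chi μ (hA.diff hB)}
  have hε : 0 < N ((s : ℝ) • chi μ hA) := by
    rw [pos_iff_ne_zero, ne_eq, hN.eq_zero_iff, smul_eq_zero, not_or, eq_zero_iff_distrib,
      distrib_chi, if_pos one_pos, hAt]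
    exact ⟨hs0.ne', ENNReal.top_ne_zero⟩
  obtain ⟨-, ⟨B, hB, hBf, rfl⟩, hlt⟩ : ∃ d ∈ D, N d < N ((s : ℝ) • chi μ hA) := by
    refine h D ⟨_, ∅, .empty, by simp, rfl⟩ ?_ ⟨?_, fun w hw => ?_⟩ ?_ _ hε
    · have hmono : ∀ {B B' : Set Ω} (hB : MeasurableSet B) (hB' : MeasurableSet B'), B ⊆ B' →
          (s : ℝ) • chi μ (hA.diff hB') ≤ (s : ℝ) • chi μ (hA.diff hB) := by
        intro B B' hB hB' hBB
        rw [← AEEqFun.coeFn_le]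
        filter_upwards [smul_chi_ae (μ := μ) (s : ℝ) (hA.diff hB),
          smul_chi_ae (μ := μ) (s : ℝ) (hA.diff hB')] with ω h1 h2
        rw [h1, h2]
        exact Set.indicator_le_indicator_of_subset (Set.sdiff_subset_sdiff_right hBB)
          (fun _ => hs0.le) ω
      rintro - ⟨B, hB, hBf, rfl⟩ - ⟨B', hB', hBf', rfl⟩
      exact ⟨_, ⟨B ∪ B', hB.union hB', measure_union_lt_top hBf hBf', rfl⟩,
        hmono hB (hB.union hB') Set.subset_union_left,
        hmono hB' (hB.union hB') Set.subset_union_right⟩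
    · rintro - ⟨B, hB, hBf, rfl⟩
      exact smul_nonneg_ae hs0.le (chi_nonneg _)
    -- A lower bound with nonzero positive part would be positive on some `e` of finite nonzero
    -- measure, where the member of `D` with `B = e` vanishes.
    · by_contra hcon
      have hw0 : w ⊔ 0 ≠ 0 := fun h0 => hcon (sup_eq_right.1 h0)
      obtain ⟨η, e, he, hη, he0, hef, hle⟩ := hu.exists_chi_le hw0
      refine he0 (measure_mono_null (t := {ω | ¬ ω ∉ e}) (by intro; simp) ?_)
      change ∀ᵐ ω ∂μ, ω ∉ e
      filter_upwards [AEEqFun.coeFn_le.2 hle, smul_chi_ae (μ := μ) η he,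
        AEEqFun.coeFn_abs (w ⊔ 0), AEEqFun.coeFn_sup w 0, AEEqFun.coeFn_zero (β := ℝ) (μ := μ),
        AEEqFun.coeFn_le.2 (hw ⟨e, he, hef, rfl⟩), smul_chi_ae (μ := μ) (s : ℝ) (hA.diff he)]
        with ω h1 h2 h3 h4 h5 h6 h7 hω
      rw [h7, Set.indicator_of_notMem fun h => h.2 hω] at h6
      rw [h2, h3, h4, h5, Set.indicator_of_mem hω, Pi.zero_apply, sup_eq_right.2 h6, abs_zero] at h1
      exact absurd h1 (not_le.2 hη)
    · rintro - ⟨B, hB, hBf, rfl⟩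
      rw [← AEEqFun.coeFn_le]
      filter_upwards [smul_chi_ae (μ := μ) (s : ℝ) (hA.diff hB), hsub B, AEEqFun.coeFn_abs x]
        with ω h1 h2 h3
      rwa [h1, h3]
  refine hlt.ne ?_
  rw [hN.smul, hN.smul, hS.map_chi (hA.diff hB) hA]
  rw [hAt, eq_top_iff, ← hAt]
  by_contra hcon
  refine (measure_union_lt_top (not_le.1 hcon |>.trans_le le_top) hBf).not_ge ?_
  rw [← hAt]
  exact measure_mono fun ω hω => by
    by_cases h' : ω ∈ B
    · exact Or.inr h'
    · exact Or.inl ⟨hω, h'⟩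

theorem IsOrderContinuousAt.exists_tail_lt {x : Ω →ₘ[μ] ℝ} (h : IsOrderContinuousAt N x)
    {ε : ℝ≥0∞} (hε : 0 < ε) : ∃ K, N (tail x K) < ε := by
  have key : ∃ n : ℕ, N (tail x n) < ε := by
    refine h.exists_seq_lt ?_ ?_ ?_ ?_ hε
    · intro m n hmn
      rw [← AEEqFun.coeFn_le]
      filter_upwards [coeFn_tail x m, coeFn_tail x n] with ω h1 h2
      have : ((m : ℝ≥0) : ℝ) ≤ ((n : ℝ≥0) : ℝ) := by simpa using hmn
      rw [h1, h2]
      exact max_le_max_right _ (sub_le_sub_left this _)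
    · intro n
      rw [← AEEqFun.coeFn_le]
      filter_upwards [coeFn_tail x n, AEEqFun.coeFn_zero (β := ℝ) (μ := μ)] with ω h1 h2
      rw [h1, h2]
      exact le_max_right _ _
    · filter_upwards [ae_all_iff.2 fun n : ℕ => coeFn_tail x n] with ω h1
      simp only [h1]
      obtain ⟨k, hk⟩ := exists_nat_ge |x ω|
      refine tendsto_const_nhds.congr' ((eventually_ge_atTop k).mono fun n hn => ?_)
      have h2 : (k : ℝ) ≤ n := by exact_mod_cast hn
      refine (max_eq_right ?_).symm
      rw [NNReal.coe_natCast]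
      linarith
    · intro n
      rw [← AEEqFun.coeFn_le]
      filter_upwards [coeFn_tail x n, AEEqFun.coeFn_abs x] with ω h1 h2
      rw [h1, h2]
      exact max_le (sub_le_self _ (NNReal.coe_nonneg _)) (abs_nonneg _)
  exact key.imp' _ fun _ hn => hn

theorem IsOrderContinuousAt.exists_trunc_lt {x : Ω →ₘ[μ] ℝ} (h : IsOrderContinuousAt N x)
    {ε : ℝ≥0∞} (hε : 0 < ε) : ∃ δ, 0 < δ ∧ N (trunc x δ) < ε := by
  let δ : ℕ → ℝ≥0 := fun n => 1 / ((n : ℝ≥0) + 1)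
  have hδ : ∀ n, 0 < δ n := fun n => by positivity
  have hanti : Antitone δ := fun m n hmn => by
    simp only [δ]
    gcongr
  have hlim : Tendsto (fun n => (δ n : ℝ)) atTop (𝓝 0) := by
    simpa [δ] using tendsto_one_div_add_atTop_nhds_zero_nat (𝕜 := ℝ)
  have key : ∃ n : ℕ, N (trunc x (δ n)) < ε := by
    refine h.exists_seq_lt ?_ ?_ ?_ ?_ hε
    · intro m n hmn
      rw [← AEEqFun.coeFn_le]
      filter_upwards [coeFn_trunc x (δ m), coeFn_trunc x (δ n)] with ω h1 h2
      rw [h1, h2]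
      exact min_le_min_left _ (by exact_mod_cast hanti hmn)
    · intro n
      rw [← AEEqFun.coeFn_le]
      filter_upwards [coeFn_trunc x (δ n), AEEqFun.coeFn_zero (β := ℝ) (μ := μ)] with ω h1 h2
      rw [h1, h2]
      exact le_min (abs_nonneg _) (NNReal.coe_nonneg _)
    · filter_upwards [ae_all_iff.2 fun n : ℕ => coeFn_trunc x (δ n)] with ω h1
      simp only [h1]
      exact squeeze_zero (fun n => le_min (abs_nonneg _) (NNReal.coe_nonneg _))
        (fun n => min_le_right _ _) hlim
    · intro n
      rw [← AEEqFun.coeFn_le]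
      filter_upwards [coeFn_trunc x (δ n), AEEqFun.coeFn_abs x] with ω h1 h2
      rw [h1, h2]
      exact min_le_left _ _
  exact key.imp' δ fun n hn => ⟨hδ n, hn⟩

/-- Otherwise there are sets of measure at most `2⁻¹ ^ n` whose indicators have norm at least `ε`;
by symmetry they may be placed inside a set `A` with `η χ_A ≤ |x|`. By Borel–Cantelli the unions of
their tails decrease to a null set, yet the norms stay bounded below. -/
theorem IsIdealNorm.exists_chi_lt_of_isOrderContinuousAt (hN : IsIdealNorm N)
    (hS : Related N N) (hu : HasUnits μ) (hc : Cuts μ μ) {x : Ω →ₘ[μ] ℝ} (hx : x ≠ 0)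
    (h : IsOrderContinuousAt N x) {ε : ℝ≥0∞} (hε : 0 < ε) : ∃ δ : ℝ≥0∞, 0 < δ ∧
      ∀ (e : Set Ω) (he : MeasurableSet e), μ e < δ → N (chi μ he) < ε := by
  by_contra! hcon
  obtain ⟨η, A, hA, hη, hA0, hAf, hle⟩ := hu.exists_chi_le hx
  have hex : ∀ n : ℕ, ∃ C ⊆ A, ∃ hC : MeasurableSet C, μ C ≤ 2⁻¹ ^ n ∧ ε ≤ N (chi μ hC) := by
    intro n
    obtain ⟨B, hB, hBlt, hBε⟩ := hcon (min (μ A) (2⁻¹ ^ n))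
      (lt_min (pos_iff_ne_zero.2 hA0) (ENNReal.pow_pos (by norm_num) n))
    have hBA := hBlt.trans_le (min_le_left _ _)
    obtain ⟨C, hCA, hC, hCB⟩ := hc B hB (hBA.trans hAf) A hA hBA.le
    refine ⟨C, hCA, hC, ?_, ?_⟩
    · rw [hCB]
      exact (hBlt.trans_le (min_le_right _ _)).le
    · rwa [hS.map_chi hC hB hCB]
  choose C hCA hC hCn hCε using hex
  have hsum : ∑' n, μ (C n) ≠ ∞ := by
    refine ((ENNReal.tsum_le_tsum hCn).trans_lt ?_).ne
    rw [ENNReal.tsum_geometric]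
    norm_num
  have hV : ∀ n, MeasurableSet (⋃ m, ⋃ _ : n ≤ m, C m) := fun n =>
    MeasurableSet.iUnion fun m => MeasurableSet.iUnion fun _ => hC m
  have key : ∃ n, N (η • chi μ (hV n)) < ‖η‖ₑ * ε := by
    refine h.exists_seq_lt ?_ ?_ ?_ ?_ (ENNReal.mul_pos (by simpa using hη.ne') hε.ne')
    · intro m n hmn
      rw [← AEEqFun.coeFn_le]
      filter_upwards [smul_chi_ae (μ := μ) η (hV m), smul_chi_ae (μ := μ) η (hV n)] with ω h1 h2
      rw [h1, h2]
      refine Set.indicator_le_indicator_of_subset ?_ (fun _ => hη.le) ω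
      exact Set.iUnion_mono fun k => Set.iUnion_subset fun hk =>
        Set.subset_iUnion_of_subset (hmn.trans hk) subset_rfl
    · exact fun n => smul_nonneg_ae hη.le (chi_nonneg _)
    · filter_upwards [ae_eventually_notMem hsum, ae_all_iff.2 fun n =>
        smul_chi_ae (μ := μ) η (hV n)] with ω h1 h2
      simp only [h2]
      obtain ⟨k, hk⟩ := eventually_atTop.1 h1
      refine tendsto_const_nhds.congr' ((eventually_ge_atTop k).mono fun n hn => ?_)
      refine (Set.indicator_of_notMem ?_ _).symm
      simp only [Set.mem_iUnion, not_exists]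
      exact fun m hm => hk m (hn.trans hm)
    · refine fun n => le_trans ?_ hle
      rw [← AEEqFun.coeFn_le]
      filter_upwards [smul_chi_ae (μ := μ) η (hV n), smul_chi_ae (μ := μ) η hA] with ω h1 h2
      rw [h1, h2]
      exact Set.indicator_le_indicator_of_subset (Set.iUnion₂_subset fun m _ => hCA m)
        (fun _ => hη.le) ω
  obtain ⟨n, hn⟩ := key
  rw [hN.smul] at hn
  refine hn.not_ge (mul_le_mul' le_rfl ((hCε n).trans ?_))
  exact hN.mono_of_nonneg (chi_nonneg _) (chi_mono _ _ (Set.subset_iUnion₂_of_subset n le_rfl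
    subset_rfl))

/-- The condition `x ≠ 0` is essential: `0` always has order continuous norm, but the clause on
indicators concerns the whole space. -/
theorem IsIdealNorm.hasSmallParts_of_isOrderContinuousAt (hN : IsIdealNorm N)
    (hS : Related N N) (hu : HasUnits μ) (hc : Cuts μ μ) {x : Ω →ₘ[μ] ℝ} (hx : x ≠ 0)
    (h : IsOrderContinuousAt N x) : HasSmallParts N x where
  distrib_lt_top _ hs := hN.distrib_lt_top_of_isOrderContinuousAt hS hu h hs
  tail _ hε := h.exists_tail_lt hε
  trunc _ hε := h.exists_trunc_lt hε
  chi _ hε := hN.exists_chi_lt_of_isOrderContinuousAt hS hu hc hx h hε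

end OrderContinuity

/-! ### Transfer of order continuity -/

section Related

variable {Ω : Type u} [MeasurableSpace Ω] {μ : Measure Ω}
variable {Ω' : Type v} [MeasurableSpace Ω'] {ν : Measure Ω'}
variable {N : (Ω →ₘ[μ] ℝ) → ℝ≥0∞} {M : (Ω' →ₘ[ν] ℝ) → ℝ≥0∞}

theorem HasSmallParts.transfer (hR : Related N M) (hνμ : Compatible ν μ) {x : Ω →ₘ[μ] ℝ}
    {y : Ω' →ₘ[ν] ℝ} (hxy : ∀ s, distrib x s = distrib y s) (h : HasSmallParts N x) :
    HasSmallParts M y where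
  distrib_lt_top s hs := by
    rw [← hxy]
    exact h.distrib_lt_top s hs
  tail ε hε := (h.tail ε hε).imp fun K hK => by
    rwa [← hR _ _ fun s => by rw [distrib_tail x, distrib_tail, hxy]]
  trunc ε hε := (h.trunc ε hε).imp fun δ hδ => ⟨hδ.1, by
    rw [← hR _ _ fun s => by rw [distrib_trunc x, distrib_trunc, hxy]]
    exact hδ.2⟩
  chi ε hε := by
    obtain ⟨δ, hδ0, hδ⟩ := h.chi ε hε
    refine ⟨δ, hδ0, fun e he hlt => ?_⟩
    obtain ⟨d, -, hd, hde⟩ := hνμ.cuts e he (hlt.trans_le le_top) Set.univ .univ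
      (by rw [← hνμ.univ]; exact measure_mono (Set.subset_univ _))
    rw [← hR.map_chi hd he hde]
    exact hδ d hd (hde ▸ hlt)

/-- Uncountable nets cannot be copied, so the proof passes through `HasSmallParts`; the
distributions of `tail x K` and `trunc x δ` depend only on that of `x`. -/
theorem Related.isOrderContinuousAt (hR : Related N M) (hνμ : Compatible ν μ)
    (hN : IsIdealNorm N) (hS : Related N N) (hcut : Cuts μ μ)
    (hc : ∀ (e : Set Ω) (he : MeasurableSet e), μ e < ∞ → N (chi μ he) < ∞)
    {x : Ω →ₘ[μ] ℝ} {y : Ω' →ₘ[ν] ℝ} (hxy : ∀ s, distrib x s = distrib y s)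
    (h : IsOrderContinuousAt N x) : IsOrderContinuousAt M y := by
  have hM := hR.isIdealNorm hνμ hN
  rcases eq_or_ne x 0 with rfl | hx
  · have hy : y = 0 := by
      rw [eq_zero_iff_distrib, ← hxy, ← eq_zero_iff_distrib]
    rw [hy]
    exact isOrderContinuousAt_zero hM.map_zero
  · exact hM.isOrderContinuousAt_of_hasSmallParts (hR.map_chi_lt_top hνμ hc)
      ((hN.hasSmallParts_of_isOrderContinuousAt hS hνμ.units' hcut hx h).transfer hR hνμ hxy)

theorem Related.oc (hR : Related N M) (hμν : Compatible μ ν) (hνμ : Compatible ν μ)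
    (hN : IsIdealNorm N) (hcut : Cuts μ μ) (hcut' : Cuts ν ν)
    (hc : ∀ (e : Set Ω) (he : MeasurableSet e), μ e < ∞ → N (chi μ he) < ∞) :
    Related (ocNorm N) (ocNorm M) := fun x y hxy => by
  have hiff : IsOrderContinuousAt N x ↔ IsOrderContinuousAt M y :=
    ⟨hR.isOrderContinuousAt hνμ hN (hR.symm.related_right hμν) hcut hc hxy,
      hR.symm.isOrderContinuousAt hμν (hR.isIdealNorm hνμ hN) (hR.related_right hνμ) hcut'
        (hR.map_chi_lt_top hνμ hc) fun s => (hxy s).symm⟩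
  unfold ocNorm
  by_cases hx : IsOrderContinuousAt N x
  · rw [if_pos hx, if_pos (hiff.1 hx), hR x y hxy]
  · rw [if_neg hx, if_neg fun hy => hx (hiff.2 hy)]

theorem IsIdealNorm.ocNorm_chi_lt_top (hN : IsIdealNorm N) (hS : Related N N)
    (hμ : Compatible μ μ) (hc : ∀ (e : Set Ω) (he : MeasurableSet e), μ e < ∞ → N (chi μ he) < ∞)
    (hx : ∃ x, x ≠ 0 ∧ ocNorm N x < ∞) (e : Set Ω) (he : MeasurableSet e) (hef : μ e < ∞) :
    ocNorm N (chi μ he) < ∞ :=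
  hN.oc.chi_lt_top (hS.oc hμ hμ hN hμ.cuts hμ.cuts hc) hμ.units hμ.cuts hx e he hef

end Related

/-! ### The lattice of symmetric spaces -/

section Lattice

variable {Ω : Type u} [MeasurableSpace Ω] {μ : Measure Ω}

/-- A symmetric space from its norm, with maximal width expressed by indicator functions. -/
def SymmetricSpace.ofIdealNorm (N : (Ω →ₘ[μ] ℝ) → ℝ≥0∞) (hN : IsIdealNorm N)
    (hR : RieszFischer N) (hS : Related N N) (hu : HasUnits μ)
    (hc : ∀ (e : Set Ω) (he : MeasurableSet e), μ e < ∞ → N (chi μ he) < ∞) :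
    SymmetricSpace μ where
  nrm := N
  isBanachIdeal := hN.isBanachIdealNorm hR
  maximalWidth := isMaximalWidth_of_chi hu hc
  isSymmetric := isSymmetricNorm_iff.2 hS

namespace SymmetricSpace

variable (E F : SymmetricSpace μ)

theorem isIdealNorm : IsIdealNorm E.nrm := E.isBanachIdeal.isIdealNorm

theorem rieszFischer : RieszFischer E.nrm := E.isBanachIdeal.rieszFischer

theorem related : Related E.nrm E.nrm := isSymmetricNorm_iff.1 E.isSymmetric

theorem chi_lt_top (hμ : Compatible μ μ) (h0 : μ Set.univ ≠ 0) (e : Set Ω)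
    (he : MeasurableSet e) (hef : μ e < ∞) : E.nrm (chi μ he) < ∞ :=
  E.isIdealNorm.chi_lt_top E.related hμ.units hμ.cuts
    (exists_ne_zero_of_isMaximalWidth h0 E.maximalWidth) e he hef

end SymmetricSpace

/-- Symmetry of each construction is its preservation of relatedness in the case `ν = μ`. -/
theorem Compatible.isSymmetricLattice (hμ : Compatible μ μ) (ht : HasTilings μ)
    (h0 : μ Set.univ ≠ 0) : IsSymmetricLattice μ where
  inter E F := by
    refine ⟨.ofIdealNorm (interNorm E.nrm F.nrm) (E.isIdealNorm.inter F.isIdealNorm)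
      (E.isIdealNorm.rieszFischer_inter F.isIdealNorm E.rieszFischer F.rieszFischer)
      (E.related.inter F.related) hμ.units fun e he hef =>
        max_lt (E.chi_lt_top hμ h0 e he hef) (F.chi_lt_top hμ h0 e he hef), rfl, ⟨?_, ?_⟩, ?_⟩
    · rintro H (rfl | rfl) x
      exacts [le_max_left _ _, le_max_right _ _]
    · exact fun H hH x => max_le (hH (Or.inl rfl) x) (hH (Or.inr rfl) x)
    · intro hE hF e he hee x hx
      change max (E.nrm x) (F.nrm x) = 1
      rw [hE e he hee x hx, hF e he hee x hx, max_self]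
  sum E F := by
    have hle : ∀ x, sumNorm E.nrm F.nrm x ≤ E.nrm x := fun x => by
      simpa [F.isIdealNorm.map_zero] using sumNorm_le_of_eq (N := E.nrm) (N' := F.nrm) (add_zero x)
    have hle' : ∀ x, sumNorm E.nrm F.nrm x ≤ F.nrm x := fun x => by
      simpa [E.isIdealNorm.map_zero] using sumNorm_le_of_eq (N := E.nrm) (N' := F.nrm) (zero_add x)
    refine ⟨.ofIdealNorm (sumNorm E.nrm F.nrm)
      (E.isIdealNorm.sum F.isIdealNorm E.rieszFischer F.rieszFischer)
      (E.rieszFischer.sum F.rieszFischer)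
      (E.related.sum F.related hμ hμ E.isIdealNorm F.isIdealNorm E.rieszFischer F.rieszFischer)
      hμ.units fun e he hef => (hle _).trans_lt (E.chi_lt_top hμ h0 e he hef), rfl, ⟨?_, ?_⟩,
      E.isIdealNorm.isNormed_sum F.isIdealNorm E.related F.related ht⟩
    · rintro H (rfl | rfl) x
      exacts [hle x, hle' x]
    · intro H hH x
      refine le_iInf fun u => le_iInf fun v => le_iInf fun huv => ?_
      rw [← huv]
      exact (H.isIdealNorm.add_le u v).trans
        (add_le_add (hH (Or.inl rfl) u) (hH (Or.inr rfl) v))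
  dual E :=
    have hc := E.chi_lt_top hμ h0
    ⟨.ofIdealNorm (dualNorm E.nrm) (E.isIdealNorm.dual hμ.units hc)
      (E.isIdealNorm.rieszFischer_dual hμ.units hc) (E.related.dual hμ hμ E.isIdealNorm) hμ.units
      (E.isIdealNorm.dual_chi_lt_top E.related ht hμ.units hc), rfl,
      E.isIdealNorm.isNormed_dual E.related ht hc⟩
  oc E hE := by
    have hc := E.chi_lt_top hμ h0
    have hoc := E.isIdealNorm.ocNorm_chi_lt_top E.related hμ hc hE
    refine ⟨⟨ocNorm E.nrm, E.isBanachIdeal.oc, isMaximalWidth_of_chi hμ.units hoc,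
      isSymmetricNorm_iff.2 (E.related.oc hμ hμ E.isIdealNorm hμ.cuts hμ.cuts hc)⟩, rfl, ?_⟩
    rw [isNormed_iff, isNormed_iff]
    intro h e he hee
    change ocNorm E.nrm (chi μ he) = 1
    rw [ocNorm_of_isOrderContinuousAt (isOrderContinuousAt_of_ocNorm_lt_top
      (hoc e he (by simp [hee]))), h e he hee]

end Lattice

/-! ### Replanting -/

section Mekler

variable {Ω : Type u} [MeasurableSpace Ω] {μ : Measure Ω}
variable {Ω' : Type v} [MeasurableSpace Ω'] {ν : Measure Ω'}
variable {N : (Ω →ₘ[μ] ℝ) → ℝ≥0∞} {M : (Ω' →ₘ[ν] ℝ) → ℝ≥0∞}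

/-- Well-definedness: by symmetry the infimum is taken over equal values. -/
theorem Related.mekler_right (hS : Related N N) : Related N (mekler ν N) := fun x _ hxy =>
  le_antisymm (le_iInf₂ fun x' hx' => (hS x x' fun s =>
    (hxy s).trans (rearr_eq_iff.1 hx' s).symm).le) (iInf₂_le x (rearr_eq_iff.2 hxy))

theorem Related.eq_of_related {M' : (Ω' →ₘ[ν] ℝ) → ℝ≥0∞} (hR : Related N M)
    (hR' : Related N M') (h : Compatible ν μ) : M = M' := by
  funext y
  obtain ⟨x, hx⟩ := h.exists_equimeasurable y
  rw [← hR x y fun s => (hx s).symm, ← hR' x y fun s => (hx s).symm]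

/-- Every element over `ν` has an equimeasurable one over `μ`, so a norm related to `N` is unique.
The commutation formulas and the inverse of replanting thus follow from relatedness alone. -/
theorem Related.mekler_eq (hR : Related N M) (hμν : Compatible μ ν) (hνμ : Compatible ν μ) :
    mekler ν N = M :=
  (hR.symm.related_right hμν).mekler_right.eq_of_related hR hνμ

/-- The symmetric space replanted from `μ` to `ν`. -/
noncomputable def SymmetricSpace.replant (E : SymmetricSpace μ) (hμ : Compatible μ μ)
    (hνμ : Compatible ν μ) (h0 : μ Set.univ ≠ 0) : SymmetricSpace ν :=
  .ofIdealNorm (mekler ν E.nrm) (E.related.mekler_right.isIdealNorm hνμ E.isIdealNorm)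
    (E.related.mekler_right.rieszFischer hνμ E.isIdealNorm E.rieszFischer)
    (E.related.mekler_right.related_right hνμ) hνμ.units
    (E.related.mekler_right.map_chi_lt_top hνμ (E.chi_lt_top hμ h0))

theorem mekler_mono {N' : (Ω →ₘ[μ] ℝ) → ℝ≥0∞} (h : ∀ x, N x ≤ N' x) :
    ∀ y, mekler ν N y ≤ mekler ν N' y := fun _ =>
  iInf₂_mono fun x _ => h x

theorem SymmetricSpace.mekler_mekler (E : SymmetricSpace μ) (hμν : Compatible μ ν)
    (hνμ : Compatible ν μ) : mekler μ (mekler ν E.nrm) = E.nrm :=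
  E.related.mekler_right.symm.mekler_eq hνμ hμν

/-- Replanting is an isomorphism of ordered sets. -/
noncomputable def replantIso (hμ : Compatible μ μ) (hν : Compatible ν ν) (hμν : Compatible μ ν)
    (hνμ : Compatible ν μ) (h0 : μ Set.univ ≠ 0) (h0' : ν Set.univ ≠ 0) :
    SymmetricSpace μ ≃o SymmetricSpace ν where
  toFun E := E.replant hμ hνμ h0
  invFun F := F.replant hν hμν h0'
  left_inv E := SymmetricSpace.ext (E.mekler_mekler hμν hνμ)
  right_inv F := SymmetricSpace.ext (F.mekler_mekler hνμ hμν)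
  map_rel_iff' {E F} := by
    refine ⟨fun h x => ?_, fun h => mekler_mono h⟩
    have h1 := mekler_mono (ν := μ) h x
    change mekler μ (mekler ν F.nrm) x ≤ mekler μ (mekler ν E.nrm) x at h1
    rwa [F.mekler_mekler hμν hνμ, E.mekler_mekler hμν hνμ] at h1

end Mekler

end SymSpaces

/-! ### The main theorem -/

theorem theorem10 {Ω : Type*} {Ω' : Type*} [MeasurableSpace Ω] [MeasurableSpace Ω']
    (μ : MeasureTheory.Measure Ω) (ν : MeasureTheory.Measure Ω')
    (hμ : SymSpaces.Admissible μ) (hν : SymSpaces.Admissible ν)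
    (τ : SymSpaces.SpaceType) (hτμ : τ.Holds μ) (hτν : τ.Holds ν) :
    SymSpaces.IsSymmetricLattice μ ∧ SymSpaces.IsSymmetricLattice ν ∧
    ∃ Φ : SymSpaces.SymmetricSpace μ ≃o SymSpaces.SymmetricSpace ν,
      (∀ E, (Φ E).nrm = SymSpaces.mekler ν E.nrm) ∧
      (∀ F, (Φ.symm F).nrm = SymSpaces.mekler μ F.nrm) ∧
      (∀ E x y, SymSpaces.rearr x = SymSpaces.rearr y → (Φ E).nrm y = E.nrm x) ∧
      (∀ E F, SymSpaces.mekler ν (SymSpaces.interNorm E.nrm F.nrm) =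
        SymSpaces.interNorm (Φ E).nrm (Φ F).nrm) ∧
      (∀ E F, SymSpaces.mekler ν (SymSpaces.sumNorm E.nrm F.nrm) =
        SymSpaces.sumNorm (Φ E).nrm (Φ F).nrm) ∧
      (∀ E, SymSpaces.mekler ν (SymSpaces.ocNorm E.nrm) = SymSpaces.ocNorm (Φ E).nrm) ∧
      (∀ E, SymSpaces.mekler ν (SymSpaces.dualNorm E.nrm) = SymSpaces.dualNorm (Φ E).nrm) ∧
      (∀ E, SymSpaces.IsNormed E.nrm ↔ SymSpaces.IsNormed (Φ E).nrm) := by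
  have cμ := hτμ.compatible hτμ
  have cν := hτν.compatible hτν
  have cμν := hτμ.compatible hτν
  have cνμ := hτν.compatible hτμ
  have h0 := hτμ.univ_ne_zero
  have h0' := hτν.univ_ne_zero
  let Φ := SymSpaces.replantIso cμ cν cμν cνμ h0 h0'
  have hΦ : ∀ E, SymSpaces.Related E.nrm (Φ E).nrm := fun E => E.related.mekler_right
  refine ⟨cμ.isSymmetricLattice hτμ.hasTilings h0, cν.isSymmetricLattice hτν.hasTilings h0', Φ,
    fun E => rfl, fun F => rfl, fun E x y hxy => (hΦ E x y (SymSpaces.rearr_eq_iff.1 hxy)).symm,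
    fun E F => ((hΦ E).inter (hΦ F)).mekler_eq cμν cνμ,
    fun E F => ((hΦ E).sum (hΦ F) cμν cνμ E.isIdealNorm F.isIdealNorm E.rieszFischer
      F.rieszFischer).mekler_eq cμν cνμ,
    fun E => ((hΦ E).oc cμν cνμ E.isIdealNorm cμ.cuts cν.cuts
      (E.chi_lt_top cμ h0)).mekler_eq cμν cνμ,
    fun E => ((hΦ E).dual cμν cνμ E.isIdealNorm).mekler_eq cμν cνμ,
    fun E => ⟨(hΦ E).isNormed cνμ, (hΦ E).symm.isNormed cμν⟩⟩
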